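/- All graphs are finite and simple. A graph is outerplanar if its vertices can be placed on a circle so that no two edges, drawn as chords, cross. A \emph{maximal outerplanar graph} is an outerplanar graph with at least $3$ vertices to which no edge can be added without destroying outerplanarity (equivalently, it has an embedding in which the outer face is a cycle through all vertices and all interior faces are triangles). Its interior faces are its triangles; its \emph{dual tree} has the interior faces as vertices, two faces being adjacent if they share an edge. Let $H$ be a maximal outerplanar graph. An edge $(a,b)$ of $H$ is a \emph{cutting edge} if $H-\{a,b\}$ is disconnected, and a \emph{non-cutting edge} otherwise. For a cutting edge $(a,b)$ there are exactly two \emph{cut-components}: maximal outerplanar subgraphs $H_1,H_2$ of $H$ with $H_1\cup H_2=H$ whose intersection is the edge $(a,b)$ with its ends. An \emph{outerplanar path} is a maximal outerplanar graph $P$ whose dual tree is a path $f_1,\dots,f_k$ ($k\ge 1$); $P$ \emph{connects} its edges $e,e'$ if, for one of the two orientations of this path, $e$ is incident to $f_1$ and $e'$ is incident to $f_k$. Let $(u,v)$ be a non-cutting edge of $H$. A subgraph $U$ of $H$ is a \emph{bonnet of $H$ with cap $(u,v)$} if $U=P\cup F_1\cup F_2$, where $P$ is an outerplanar path and each of $F_1$,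 $F_2$ is an outerplanar path or an empty fan, and (1) $P$ connects two distinct non-cutting edges of $H$ and contains $u$, $v$ and their common neighbour; (2) $F_1$ contains only $u$ and neighbours of $u$ in $H$, and $F_2$ contains only $v$ and neighbours of $v$ in $H$; (3) $F_1$ and $F_2$ are edge-disjoint, $F_1$ and $P$ have exactly one edge in common, which is incident to $u$, and $F_2$ and $P$ have exactly one edge in common, which is incident to $v$; (4) all neighbours of $u$ and of $v$ in $H$ belong to $U$. Here an empty fan is one without faces; it consists of nothing but the common edge required in (3). An \emph{anchor-edge} of $U$ in $H$ is an edge of $U$ that is a cutting edge of $H$ but not of $U$. The \emph{hanging subgraph} at an anchor-edge $(a,b)$ is the cut-component of $H$ with respect to $(a,b)$ that does not contain the cap $(u,v)$. A \emph{bonnet system on $H$ with root-edge $(u,v)$} consists, recursively, of a bonnet $U_0$ of $H$ with cap $(u,v)$ and, for each anchor-edge $(u_i,v_i)$ of $U_0$ in $H$ with hanging subgraph $S_i$, a bonnet system $\mathcal U_i$ on $S_i$ with root-edge $(u_i,v_i)$. Its \emph{depth} is $1+\max_i d(\mathcal U_i)$, where $d(\mathcal U_i)$ is the depth of $\mathcal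 U_i$, and is $1$ if there are no anchor-edges. The \emph{rooted bonnet depth} $bd(G;u,v)$ of a maximal outerplanar graph $G$ is the minimum depth of a bonnet system on $G$ with root-edge $(u,v)$, and the \emph{free bonnet depth} $bd^{\mathit{free}}(G)$ is the minimum of $bd(G;u,v)$ over all non-cutting edges $(u,v)$ of $G$. A \emph{planar flat visibility representation} of $G$ represents every vertex by a horizontal line segment whose $y$-coordinate is an integer, and every edge by a vertical or horizontal line segment that connects the segments of its two ends, such that the segments of different vertices are disjoint, the segment of an edge is disjoint from the segments of all vertices that are not its ends, and the segments of two different edges meet only in points of the segment of a common end-vertex. It need not realize any prescribed embedding of $G$. Its \emph{height} is the number of horizontal lines with integer $y$-coordinate that intersect the drawing. \textbf{Theorem.} Every maximal outerplanar graph $G$ has a planar flat visibility representation of height at most $2\,bd^{\mathit{free}}(G)+1$. -/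

import Mathlib

namespace BonnetDrawing

universe u

/-! ### Maximal outerplanar graphs -/

/-- `G` is outerplanar: its vertices can be placed on a circle (`pos` lists them in the order in
which they are met when walking around the circle from some starting point), so that no two edges
cross when they are drawn as chords. Two chords cross exactly if their ends alternate. -/
def IsOuterplanar {V : Type u} (G : SimpleGraph V) : Prop :=
  ∃ pos : V → ℕ, Function.Injective pos ∧
    ∀ a b c d : V, G.Adj a b → G.Adj c d → ¬ (pos a < pos c ∧ pos c < pos b ∧ pos b < pos d)

/-- A maximal outerplanar graph is a finite outerplanar graph on at least three vertices to which
no edge can be added without losing outerplanarity. -/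
def IsMaximalOuterplanar {V : Type u} (G : SimpleGraph V) : Prop :=
  3 ≤ Nat.card V ∧ Maximal IsOuterplanar G

variable {V : Type u} {G : SimpleGraph V}

/-! ### Cutting edges, cut-components -/

/-- The edge `e` of `H` is a cutting edge if deleting both its ends (as vertices) from `H` leaves
a disconnected graph. -/
def IsCuttingEdge (H : G.Subgraph) (e : Sym2 V) : Prop :=
  e ∈ H.edgeSet ∧ ¬ (H.deleteVerts {x | x ∈ e}).coe.Preconnected

/-- An edge of `H` that is not a cutting edge of `H`. -/
def IsNonCuttingEdge (H : G.Subgraph) (e : Sym2 V) : Prop :=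
  e ∈ H.edgeSet ∧ ¬ IsCuttingEdge H e

/-- `S` and `T` are the two cut-components of `H` with respect to the edge `a`: maximal outerplanar
subgraphs whose union is `H` and whose intersection is the edge `a` with its two ends. -/
structure AreCutComponents (H : G.Subgraph) (a : Sym2 V) (S T : G.Subgraph) : Prop where
  left_maximalOuterplanar : IsMaximalOuterplanar S.coe
  right_maximalOuterplanar : IsMaximalOuterplanar T.coe
  sup_eq : S ⊔ T = H
  inf_verts : (S ⊓ T).verts = {x | x ∈ a}
  inf_edgeSet : (S ⊓ T).edgeSet = {a}

/-! ### The dual tree and outerplanar paths -/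

/-- The interior faces of a maximal outerplanar graph `P` in its standard embedding. They are
precisely the triangles of `P`. -/
abbrev Face (P : G.Subgraph) : Type u :=
  {t : Finset V // P.spanningCoe.IsNClique 3 t}

/-- The dual tree (weak dual) of a maximal outerplanar graph: its vertices are the interior faces,
and two different faces are adjacent if they share an edge. -/
def dualTree (P : G.Subgraph) : SimpleGraph (Face P) where
  Adj s t := s ≠ t ∧ ∃ a b : V, a ≠ b ∧ a ∈ s.1 ∧ b ∈ s.1 ∧ a ∈ t.1 ∧ b ∈ t.1
  symm := ⟨fun _ _ ⟨hne, a, b, hab, h1, h2, h3, h4⟩ => ⟨hne.symm, a, b, hab, h3, h4, h1, h2⟩⟩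
  loopless := ⟨fun _ h => h.1 rfl⟩

/-- An outerplanar path: a maximal outerplanar graph whose dual tree is a path. -/
def IsOuterplanarPath (P : G.Subgraph) : Prop :=
  IsMaximalOuterplanar P.coe ∧
    ∃ k : ℕ, Nonempty (SimpleGraph.pathGraph (k + 1) ≃g dualTree P)

/-- The outerplanar path `P` connects its edges `e` and `e'`: `e` is incident to the first face
and `e'` is incident to the last face of the path that is the dual tree of `P`. -/
def PathConnects (P : G.Subgraph) (e e' : Sym2 V) : Prop :=
  e ∈ P.edgeSet ∧ e' ∈ P.edgeSet ∧
    ∃ (k : ℕ) (f : SimpleGraph.pathGraph (k + 1) ≃g dualTree P),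
      (∀ x ∈ e, x ∈ (f 0).1) ∧ (∀ x ∈ e', x ∈ (f (Fin.last k)).1)

/-! ### Bonnets -/

/-- `F` is a fan at `x` attached to `P`, inside `H`: an outerplanar path that contains only `x` and
neighbours of `x` and that has exactly one edge in common with `P`, this edge being incident to `x`.
The empty fan is allowed; it has no faces and is represented by the common edge alone. -/
structure IsFan (H P : G.Subgraph) (x : V) (F : G.Subgraph) : Prop where
  le : F ≤ H
  path_or_empty : IsOuterplanarPath F ∨ ∃ (y : V) (h : G.Adj x y), F = G.subgraphOfAdj h
  neighbors : ∀ y ∈ F.verts, y = x ∨ H.Adj x y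
  common_edge : ∃ y : V, F.edgeSet ∩ P.edgeSet = {s(x, y)}

/-- `U` is a bonnet of `H` with cap `s(u, v)`, ribbon `P`, fan `F₁` at `u`, fan `F₂` at `v`. -/
structure IsBonnetWith (H U : G.Subgraph) (u v : V) (P F₁ F₂ : G.Subgraph) : Prop where
  cap : IsNonCuttingEdge H s(u, v)
  le : U ≤ H
  union : U = P ⊔ F₁ ⊔ F₂
  ribbon_path : IsOuterplanarPath P
  ribbon_connects : ∃ e e' : Sym2 V,
    e ≠ e' ∧ IsNonCuttingEdge H e ∧ IsNonCuttingEdge H e' ∧ PathConnects P e e'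
  ribbon_contains : ∃ w : V, H.Adj u w ∧ H.Adj v w ∧ u ∈ P.verts ∧ v ∈ P.verts ∧ w ∈ P.verts
  fan_left : IsFan H P u F₁
  fan_right : IsFan H P v F₂
  fans_disjoint : Disjoint F₁.edgeSet F₂.edgeSet
  neighbors_left : ∀ x : V, H.Adj u x → x ∈ U.verts
  neighbors_right : ∀ x : V, H.Adj v x → x ∈ U.verts

/-- `U` is a bonnet of `H` with cap `e`. -/
def IsBonnet (H U : G.Subgraph) (e : Sym2 V) : Prop :=
  ∃ (u v : V) (P F₁ F₂ : G.Subgraph), e = s(u, v) ∧ IsBonnetWith H U u v P F₁ F₂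

/-- The anchor-edges of `U` in `H`: edges of `U` that are cutting edges of `H` but not of `U`. -/
def anchorEdges (H U : G.Subgraph) : Set (Sym2 V) :=
  {a | a ∈ U.edgeSet ∧ IsCuttingEdge H a ∧ ¬ IsCuttingEdge U a}

/-- `S` is the hanging subgraph of `H` at the anchor-edge `a` of a bonnet with cap `e`: the
cut-component of `H` with respect to `a` that does not contain the cap. -/
def IsHangingSubgraph (H : G.Subgraph) (e a : Sym2 V) (S : G.Subgraph) : Prop :=
  (∃ T : G.Subgraph, AreCutComponents H a S T) ∧ e ∉ S.edgeSet

/-! ### Bonnet systems and bonnet depth -/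

/-- A bonnet system on `H` with root-edge `e`: a root bonnet `U` of `H` with cap `e`, together with
a bonnet system, with root-edge `a`, of the hanging subgraph `S a` at each anchor-edge `a` of `U`. -/
inductive BonnetSystem {V : Type u} {G : SimpleGraph V} : G.Subgraph → Sym2 V → Type u
  | mk (H : G.Subgraph) (e : Sym2 V) (U : G.Subgraph) (isBonnet : IsBonnet H U e)
      (S : anchorEdges H U → G.Subgraph)
      (isHanging : ∀ a : anchorEdges H U, IsHangingSubgraph H e a.1 (S a))
      (sub : ∀ a : anchorEdges H U, BonnetSystem (S a) a.1) : BonnetSystem H e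

/-- The depth of a bonnet system: one more than the maximum depth of the hanging bonnet systems
(one, if there are no anchor-edges). -/
noncomputable def BonnetSystem.depth {V : Type u} {G : SimpleGraph V} {H : G.Subgraph}
    {e : Sym2 V} : BonnetSystem H e → ℕ
  | .mk _ _ _ _ _ _ sub => 1 + ⨆ a, (sub a).depth

/-- The rooted bonnet depth `bd(G; e)`: the minimum depth of a bonnet system on `G` with
root-edge `e`. -/
noncomputable def bonnetDepth (G : SimpleGraph V) (e : Sym2 V) : ℕ :=
  sInf {d | ∃ B : BonnetSystem (⊤ : G.Subgraph) e, B.depth = d}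

/-- The free bonnet depth: the minimum of the rooted bonnet depth over all root-edges, that is,
over all non-cutting edges of `G`. -/
noncomputable def freeBonnetDepth (G : SimpleGraph V) : ℕ :=
  sInf {d | ∃ e : Sym2 V, IsNonCuttingEdge (⊤ : G.Subgraph) e ∧ bonnetDepth G e = d}

/-! ### Planar flat visibility representations -/

/-- The horizontal segment at height `y` from `l` to `r`. -/
def hSegment (l r : ℝ) (y : ℤ) : Set (ℝ × ℝ) :=
  Set.Icc l r ×ˢ {(y : ℝ)}

/-- The vertical segment at abscissa `x` from height `y₁` to height `y₂`. -/
def vSegment (x : ℝ) (y₁ y₂ : ℤ) : Set (ℝ × ℝ) :=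
  {x} ×ˢ Set.Icc (y₁ : ℝ) (y₂ : ℝ)

/-- A planar flat visibility representation of `G`: every vertex is a horizontal segment on an
integer layer, and every edge is a vertical or horizontal segment joining the segments of its two
ends. Elements of the drawing are disjoint except where incidence in `G` makes them meet. -/
structure FlatVisibilityRepresentation (G : SimpleGraph V) where
  layer : V → ℤ
  left : V → ℝ
  right : V → ℝ
  left_lt_right : ∀ v : V, left v < right v
  edgeSeg : Sym2 V → Set (ℝ × ℝ)
  /-- An edge is drawn as a vertical segment between two different layers, with both of its ends on
  the segments of its end-vertices, or as a horizontal segment from the right end of one of its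
  end-vertices to the left end of the other one. -/
  edge_drawn : ∀ e ∈ G.edgeSet, ∃ a b : V, e = s(a, b) ∧
    ((layer a < layer b ∧ ∃ x : ℝ, x ∈ Set.Icc (left a) (right a) ∧
        x ∈ Set.Icc (left b) (right b) ∧ edgeSeg e = vSegment x (layer a) (layer b)) ∨
      (layer a = layer b ∧ right a < left b ∧
        edgeSeg e = hSegment (right a) (left b) (layer a)))
  /-- Different vertices are disjoint. -/
  vertex_vertex : ∀ a b : V, a ≠ b →
    Disjoint (hSegment (left a) (right a) (layer a)) (hSegment (left b) (right b) (layer b))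
  /-- An edge is disjoint from every vertex that is not one of its ends. -/
  edge_vertex : ∀ e ∈ G.edgeSet, ∀ w : V, w ∉ e →
    Disjoint (edgeSeg e) (hSegment (left w) (right w) (layer w))
  /-- Two different edges meet at most on a vertex that is an end of both. -/
  edge_edge : ∀ e ∈ G.edgeSet, ∀ f ∈ G.edgeSet, e ≠ f → ∀ p ∈ edgeSeg e ∩ edgeSeg f,
    ∃ w : V, w ∈ e ∧ w ∈ f ∧ p ∈ hSegment (left w) (right w) (layer w)

/-- The set of points of the plane covered by the drawing. -/
def FlatVisibilityRepresentation.support (R : FlatVisibilityRepresentation G) : Set (ℝ × ℝ) :=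
  (⋃ v : V, hSegment (R.left v) (R.right v) (R.layer v)) ∪ ⋃ e ∈ G.edgeSet, R.edgeSeg e

/-- The height: the number of layers, i.e. of horizontal lines with integer ordinate that meet the
drawing. -/
noncomputable def FlatVisibilityRepresentation.height (R : FlatVisibilityRepresentation G) : ℕ∞ :=
  Set.encard {y : ℤ | ∃ x : ℝ, (x, (y : ℝ)) ∈ R.support}

end BonnetDrawing

namespace BonnetDrawing

universe u

/-! ### Recursive structure of bonnet systems -/

section Profile

variable {V : Type u}

/-! A drawing is built as a list of columns, each telling which vertex occupies which integer layer.
By induction on d, the part of the graph beyond an edge ab that is exhausted by d levels of bonnets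
has a drawing on layers 0, …, 2d whose layer 0 is filled by a on the left and b on the right, so
that ab is drawn horizontally (`HasCapDrawing`). Such a cap can be hung, upright or reflected,
wherever a and b should follow each other on one layer.

In the inductive step let w be the apex of ab. A bonnet splits at w into a half at a and a half at b
(`RibbonFan`). In each half the root end runs along layer 0 and w ends on layer 2d + 2. A ribbon
needs layers 1, …, 2d + 2: caps of the previous level take 2d + 1 layers, and one more carries the
vertex on the opposite side. A fan needs layers 0, …, 2d + 1, since the root end replaces that
vertex. Where the ribbon leaves the root end, the ribbon drawing and the fan drawing are put side by
side (`hasHalfDrawing_leave`). Two mirrored halves make a cap on two more layers than before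
(`hasCapDrawing_apex`), and `exists_gridDrawing` with `GridDrawing.toRepresentation` makes the
columns geometric.

The combinatorial half shows that a bonnet system of depth d yields `BonnetLevels` d
(`BonnetSystem.bonnetLevels`). Cutting the circle at the root edge orders the vertices linearly with
the root ends extreme. Maximality turns into saturation, and the part beyond an edge is an interval.
Since the dual tree of the ribbon is a path, each ribbon triangle continues across at most one
further side (`not_both_extend`), and the last one has an outer edge. The fans occupy the gaps next
to the root ends (`IsFan.fills_gap`), and every other edge over a gap of the bonnet is outer or an
anchor-edge.

Bonnet depths are infima in ℕ, which are 0 on the empty set. The bound therefore also needs a bonnet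
system for every root (`exists_bonnetSystem`) and a non-cutting edge (`exists_isNonCuttingEdge`), so
that the infima are attained. -/

/-- The part of a triangulation beyond the edge `a b` can be traversed by a ribbon that ends in an
outer edge, everything left aside by the ribbon satisfying `Q`. -/
inductive Ribbon (Lf : V → V → Prop) (Ap : V → V → V → Prop) (Q : V → V → Prop) : V → V → Prop
  | leaf {a b : V} : Lf a b → Ribbon Lf Ap Q a b
  | swap {a b : V} : Ribbon Lf Ap Q a b → Ribbon Lf Ap Q b a
  | step {a b z : V} : Ap a b z → Q z a → Ribbon Lf Ap Q z b → Ribbon Lf Ap Q a b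

/-- The part of a triangulation beyond the edge `a x` is a fan at `a`, up to parts that
satisfy `Q`. -/
inductive FanBeyond (Lf : V → V → Prop) (Ap : V → V → V → Prop) (Q : V → V → Prop) (a : V) :
    V → Prop
  | leaf {x : V} : Lf a x → FanBeyond Lf Ap Q a x
  | step {x z : V} : Ap a x z → Q x z → FanBeyond Lf Ap Q a z → FanBeyond Lf Ap Q a x

/-- The part of a triangulation beyond the edge `a x` is covered by a ribbon that turns around `a`
and then leaves it, and by a fan at `a`, up to parts that satisfy `Q`. -/
inductive RibbonFan (Lf : V → V → Prop) (Ap : V → V → V → Prop) (Q : V → V → Prop) (a : V) :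
    V → Prop
  | leaf {x : V} : Lf a x → RibbonFan Lf Ap Q a x
  | along {x z : V} : Ap a x z → Q z x → RibbonFan Lf Ap Q a z → RibbonFan Lf Ap Q a x
  | leave {x z : V} : Ap a x z → FanBeyond Lf Ap Q a z → Ribbon Lf Ap Q z x → RibbonFan Lf Ap Q a x

/-- The part of a triangulation beyond the edge `a b` is exhausted by `d` levels of bonnets. -/
def BonnetLevels (Lf : V → V → Prop) (Ap : V → V → V → Prop) : ℕ → V → V → Prop
  | 0, a, b => Lf a b
  -- Admitting outer edges at every level makes the predicate monotone in the depth.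
  | d + 1, a, b => Lf a b ∨ ∃ w, Ap a b w ∧ RibbonFan Lf Ap (BonnetLevels Lf Ap d) a w ∧
      RibbonFan Lf Ap (BonnetLevels Lf Ap d) b w

end Profile

/-! ### Lists of columns -/

section Columns

variable {V : Type u}

/-- A column of a discrete drawing tells which vertex occupies each layer. -/
abbrev Column (V : Type u) : Type u := ℤ → Option V

/-- `x` does not occur in `L`. -/
def Absent (x : V) (L : List (Column V)) : Prop := ∀ c ∈ L, ∀ k, c k ≠ some x

/-- `x` occurs in every column of `L`, precisely on layer `y`. -/
def Full (x : V) (y : ℤ) (L : List (Column V)) : Prop := ∀ c ∈ L, ∀ k, c k = some x ↔ k = y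

/-- `x` occupies layer `y` on a final section of `L`. -/
def Ends (x : V) (y : ℤ) (L : List (Column V)) : Prop :=
  ∃ A B, L = A ++ B ∧ B ≠ [] ∧ Absent x A ∧ Full x y B

/-- `x` occupies layer `y` on an initial section of `L`. -/
def Starts (x : V) (y : ℤ) (L : List (Column V)) : Prop :=
  ∃ A B, L = A ++ B ∧ A ≠ [] ∧ Full x y A ∧ Absent x B

/-- `x` occupies a single layer on a nonempty interval of columns of `L`. -/
def Bar (x : V) (L : List (Column V)) : Prop :=
  ∃ y A B C, L = A ++ B ++ C ∧ B ≠ [] ∧ Absent x A ∧ Full x y B ∧ Absent x C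

/-- `a` and `b` see each other in the column `c`. -/
def Sees (c : Column V) (a b : V) : Prop :=
  ∃ i j, i < j ∧ ((c i = some a ∧ c j = some b) ∨ (c i = some b ∧ c j = some a)) ∧
    ∀ k, i < k → k < j → c k = none

/-- `a` and `b` see each other in a column of `L`, or horizontally. -/
def Visible (L : List (Column V)) (a b : V) : Prop :=
  (∃ c ∈ L, Sees c a b) ∨ ∃ c c' k, [c, c'] <:+: L ∧
    ((c k = some a ∧ c' k = some b) ∨ (c k = some b ∧ c' k = some a))

/-- All occurrences in `L` are between the layers `lo` and `hi`, of elements of `X`. -/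
def Within (lo hi : ℤ) (X : Set V) (L : List (Column V)) : Prop :=
  ∀ c ∈ L, ∀ k x, c k = some x → (lo ≤ k ∧ k ≤ hi) ∧ x ∈ X

variable {x a b : V} {y lo hi : ℤ} {X Y : Set V} {L M N : List (Column V)}

theorem Absent.append (h : Absent x L) (h' : Absent x M) : Absent x (L ++ M) := by
  intro c hc; rcases List.mem_append.1 hc with hc | hc
  exacts [h c hc, h' c hc]

theorem Full.append (h : Full x y L) (h' : Full x y M) : Full x y (L ++ M) := by
  intro c hc; rcases List.mem_append.1 hc with hc | hc
  exacts [h c hc, h' c hc]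

theorem Within.append (h : Within lo hi X L) (h' : Within lo hi X M) :
    Within lo hi X (L ++ M) := by
  intro c hc; rcases List.mem_append.1 hc with hc | hc
  exacts [h c hc, h' c hc]

theorem Within.mono {lo' hi' : ℤ} (h : Within lo hi X L) (h1 : lo' ≤ lo) (h2 : hi ≤ hi')
    (hX : X ⊆ Y) : Within lo' hi' Y L := fun c hc k x hx =>
  ⟨⟨h1.trans (h c hc k x hx).1.1, (h c hc k x hx).1.2.trans h2⟩, hX (h c hc k x hx).2⟩

theorem Within.absent (h : Within lo hi X L) (hx : x ∉ X) : Absent x L :=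
  fun c hc k hk => hx (h c hc k x hk).2

theorem Full.ends (h : Full x y L) (hL : L ≠ []) : Ends x y L :=
  ⟨[], L, rfl, hL, by simp [Absent], h⟩

theorem Full.starts (h : Full x y L) (hL : L ≠ []) : Starts x y L :=
  ⟨L, [], by simp, hL, h, by simp [Absent]⟩

theorem Ends.append_full (h : Ends x y L) (h' : Full x y M) : Ends x y (L ++ M) := by
  obtain ⟨A, B, rfl, hB, hA, hf⟩ := h
  exact ⟨A, B ++ M, by simp, by simp [hB], hA, hf.append h'⟩

theorem Ends.append_left (h : Ends x y M) (h' : Absent x L) : Ends x y (L ++ M) := by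
  obtain ⟨A, B, rfl, hB, hA, hf⟩ := h
  exact ⟨L ++ A, B, by simp, hB, h'.append hA, hf⟩

theorem Full.append_starts (h : Full x y L) (h' : Starts x y M) : Starts x y (L ++ M) := by
  obtain ⟨A, B, rfl, hB, hA, hf⟩ := h'
  exact ⟨L ++ A, B, by simp, by simp [hB], h.append hA, hf⟩

theorem Starts.append_right (h : Starts x y L) (h' : Absent x M) : Starts x y (L ++ M) := by
  obtain ⟨A, B, rfl, hB, hA, hf⟩ := h
  exact ⟨A, B ++ M, by simp, hB, hA, hf.append h'⟩

/-- The two sections lie on the same layer and touch at the seam. This is how a vertex shared by two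
partial drawings becomes a single segment. -/
theorem Ends.append_starts (h : Ends x y L) (h' : Starts x y M) : Bar x (L ++ M) := by
  obtain ⟨A, B, rfl, hB, hA, hf⟩ := h
  obtain ⟨A', B', rfl, hB', hA', hf'⟩ := h'
  exact ⟨y, A, B ++ A', B', by simp, by simp [hB], hA, hf.append hA', hf'⟩

theorem Ends.bar (h : Ends x y L) : Bar x L := by
  obtain ⟨A, B, rfl, hB, hA, hf⟩ := h
  exact ⟨y, A, B, [], by simp, hB, hA, hf, by simp [Absent]⟩

theorem Bar.append_right (h : Bar x L) (h' : Absent x M) : Bar x (L ++ M) := by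
  obtain ⟨y, A, B, C, rfl, hB, hA, hf, hC⟩ := h
  exact ⟨y, A, B, C ++ M, by simp, hB, hA, hf, hC.append h'⟩

theorem Bar.append_left (h : Bar x M) (h' : Absent x L) : Bar x (L ++ M) := by
  obtain ⟨y, A, B, C, rfl, hB, hA, hf, hC⟩ := h
  exact ⟨y, L ++ A, B, C, by simp, hB, h'.append hA, hf, hC⟩

theorem Absent.reverse (h : Absent x L) : Absent x L.reverse := fun c hc => h c (by simpa using hc)

theorem Full.reverse (h : Full x y L) : Full x y L.reverse := fun c hc => h c (by simpa using hc)

theorem Within.reverse (h : Within lo hi X L) : Within lo hi X L.reverse :=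
  fun c hc => h c (by simpa using hc)

theorem Ends.reverse (h : Ends x y L) : Starts x y L.reverse := by
  obtain ⟨A, B, rfl, hB, hA, hf⟩ := h
  exact ⟨B.reverse, A.reverse, by simp, by simpa using hB, hf.reverse, hA.reverse⟩

theorem Bar.reverse (h : Bar x L) : Bar x L.reverse := by
  obtain ⟨y, A, B, C, rfl, hB, hA, hf, hC⟩ := h
  exact ⟨y, C.reverse, B.reverse, A.reverse, by simp, by simpa using hB, hC.reverse, hf.reverse,
    hA.reverse⟩

theorem Sees.symm {c : Column V} (h : Sees c a b) : Sees c b a := by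
  obtain ⟨i, j, hij, h1, h2⟩ := h
  exact ⟨i, j, hij, h1.symm, h2⟩

theorem Visible.symm (h : Visible L a b) : Visible L b a := by
  rcases h with ⟨c, hc, h⟩ | ⟨c, c', k, h, h'⟩
  exacts [Or.inl ⟨c, hc, h.symm⟩, Or.inr ⟨c, c', k, h, h'.symm⟩]

theorem Visible.mono (h : Visible L a b) (hL : L <:+: M) : Visible M a b := by
  rcases h with ⟨c, hc, h⟩ | ⟨c, c', k, h, h'⟩
  exacts [Or.inl ⟨c, hL.subset hc, h⟩, Or.inr ⟨c, c', k, h.trans hL, h'⟩]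

theorem Visible.append_right (h : Visible L a b) : Visible (L ++ M) a b :=
  h.mono (List.prefix_append _ _).isInfix

theorem Visible.append_left (h : Visible M a b) : Visible (L ++ M) a b :=
  h.mono (List.suffix_append _ _).isInfix

theorem Visible.reverse (h : Visible L a b) : Visible L.reverse a b := by
  rcases h with ⟨c, hc, h⟩ | ⟨c, c', k, h, h'⟩
  · exact Or.inl ⟨c, by simpa using hc, h⟩
  · refine Or.inr ⟨c', c, k, by simpa using List.reverse_infix.2 h, ?_⟩
    tauto

/-- The last column of `L` and the first of `M` carry `a` and `b` on one layer. Horizontal edges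
arise only in this way. -/
theorem visible_of_full (hL : L ≠ []) (hM : M ≠ []) (h : Full a y L) (h' : Full b y M) :
    Visible (L ++ M) a b := by
  obtain ⟨A, c, rfl⟩ := List.eq_nil_or_concat L |>.resolve_left hL
  obtain ⟨c', B, rfl⟩ := List.exists_cons_of_ne_nil hM
  refine Or.inr ⟨c, c', y, ⟨A, B, by simp⟩, Or.inl ⟨?_, ?_⟩⟩
  · exact (h c (by simp) y).2 rfl
  · exact (h' c' (by simp) y).2 rfl

/-- Move the layer `j` of a column to `t + ε * j` and add the vertices of `g`. -/
def hang (g : Column V) (ε t : ℤ) (c : Column V) : Column V :=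
  fun k => (g k).or (c (ε * (k - t)))

/-- The vertices of `g` lie outside the image of the layers `lo, …, hi`. -/
structure Hangs (g : Column V) (ε t lo hi : ℤ) : Prop where
  unit : ε = 1 ∨ ε = -1
  free : ∀ j, lo ≤ j → j ≤ hi → g (t + ε * j) = none

/-! ### Bars and visibilities survive hanging -/

section hang

variable {g : Column V} {ε t : ℤ}

/-- `g` is empty on the image of the layers used by `L`, so it hides nothing, and ε is its own
inverse. -/
theorem hang_eq_some_iff (hg : Hangs g ε t lo hi) (h : Within lo hi X L) {c : Column V}
    (hc : c ∈ L) (hx : ∀ k, g k ≠ some x) (k : ℤ) :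
    hang g ε t c k = some x ↔ c (ε * (k - t)) = some x := by
  unfold hang
  rw [Option.or_eq_some_iff]
  constructor
  · rintro (h1 | h1)
    exacts [absurd h1 (hx k), h1.2]
  · intro h1
    have h2 := (h c hc _ _ h1).1
    have := hg.free _ h2.1 h2.2
    refine Or.inr ⟨?_, h1⟩
    rcases hg.unit with rfl | rfl <;> simpa using this

theorem Absent.hang (h' : Absent x L) (hg : Hangs g ε t lo hi) (h : Within lo hi X L)
    (hx : ∀ k, g k ≠ some x) : Absent x (L.map (hang g ε t)) := by
  intro _ hc' k
  obtain ⟨c, hc, rfl⟩ := List.mem_map.1 hc'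
  rw [Ne, hang_eq_some_iff hg h hc hx]
  exact h' c hc _

theorem Full.hang (h' : Full x y L) (hg : Hangs g ε t lo hi) (h : Within lo hi X L)
    (hx : ∀ k, g k ≠ some x) : Full x (t + ε * y) (L.map (hang g ε t)) := by
  intro _ hc' k
  obtain ⟨c, hc, rfl⟩ := List.mem_map.1 hc'
  rw [hang_eq_some_iff hg h hc hx, h' c hc]
  rcases hg.unit with rfl | rfl <;> constructor <;> intro <;> omega

/-- Applies to the vertex that `g` adds alongside the hung drawing. -/
theorem full_hang (h : Absent x L) (hx : ∀ k, g k = some x ↔ k = y) :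
    Full x y (L.map (BonnetDrawing.hang g ε t)) := by
  intro _ hc' k
  obtain ⟨c, hc, rfl⟩ := List.mem_map.1 hc'
  unfold BonnetDrawing.hang
  rw [Option.or_eq_some_iff, hx]
  exact ⟨fun h1 => h1.elim id fun h2 => absurd h2.2 (h c hc _), Or.inl⟩

theorem Within.of_append_left (h : Within lo hi X (L ++ M)) : Within lo hi X L :=
  fun c hc => h c (by simp [hc])

theorem Within.of_append_right (h : Within lo hi X (L ++ M)) : Within lo hi X M :=
  fun c hc => h c (by simp [hc])

theorem Ends.hang (h' : Ends x y L) (hg : Hangs g ε t lo hi) (h : Within lo hi X L)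
    (hx : ∀ k, g k ≠ some x) : Ends x (t + ε * y) (L.map (hang g ε t)) := by
  obtain ⟨A, B, rfl, hB, hA, hf⟩ := h'
  exact ⟨_, _, List.map_append, by simpa using hB, hA.hang hg h.of_append_left hx,
    hf.hang hg h.of_append_right hx⟩

theorem Starts.hang (h' : Starts x y L) (hg : Hangs g ε t lo hi) (h : Within lo hi X L)
    (hx : ∀ k, g k ≠ some x) : Starts x (t + ε * y) (L.map (hang g ε t)) := by
  obtain ⟨A, B, rfl, hB, hA, hf⟩ := h'
  exact ⟨_, _, List.map_append, by simpa using hB, hA.hang hg h.of_append_left hx,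
    hf.hang hg h.of_append_right hx⟩

theorem Bar.hang (h' : Bar x L) (hg : Hangs g ε t lo hi) (h : Within lo hi X L)
    (hx : ∀ k, g k ≠ some x) : Bar x (L.map (hang g ε t)) := by
  obtain ⟨y, A, B, C, rfl, hB, hA, hf, hC⟩ := h'
  exact ⟨_, _, _, _, by simp only [List.map_append], by simpa using hB,
    hA.hang hg h.of_append_left.of_append_left hx,
    hf.hang hg h.of_append_left.of_append_right hx,
    hC.hang hg h.of_append_right hx⟩

theorem Within.hang {lo' hi' : ℤ} (h : Within lo hi X L) (hg : Hangs g ε t lo hi)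
    (hg' : ∀ k x, g k = some x → (lo' ≤ k ∧ k ≤ hi') ∧ x ∈ Y) (hX : X ⊆ Y)
    (hr : ∀ j, lo ≤ j → j ≤ hi → lo' ≤ t + ε * j ∧ t + ε * j ≤ hi') :
    Within lo' hi' Y (L.map (hang g ε t)) := by
  intro _ hc' k x hk
  obtain ⟨c, hc, rfl⟩ := List.mem_map.1 hc'
  unfold BonnetDrawing.hang at hk
  rw [Option.or_eq_some_iff] at hk
  rcases hk with hk | hk
  · exact hg' k x hk
  · have h1 := h c hc _ _ hk.2
    have h2 := hr _ h1.1.1 h1.1.2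
    refine ⟨?_, hX h1.2⟩
    rcases hg.unit with rfl | rfl <;> simpa using h2

theorem hang_apply (hg : Hangs g ε t lo hi) (c : Column V) (j : ℤ) (h1 : lo ≤ j) (h2 : j ≤ hi) :
    BonnetDrawing.hang g ε t c (t + ε * j) = c j := by
  unfold BonnetDrawing.hang
  rw [hg.free j h1 h2]
  rcases hg.unit with rfl | rfl <;> simp

/-- The layers between the two ends lie in the range that `g` keeps free, so no added vertex blocks
the line of sight. -/
theorem Sees.hang {c : Column V} (h' : Sees c a b) (hg : Hangs g ε t lo hi) (h : Within lo hi X L)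
    (hc : c ∈ L) : Sees (hang g ε t c) a b := by
  obtain ⟨i, j, hij, h1, h2⟩ := h'
  have hi' : lo ≤ i := by
    rcases h1 with h1 | h1 <;> exact (h c hc _ _ h1.1).1.1
  have hj' : j ≤ hi := by
    rcases h1 with h1 | h1 <;> exact (h c hc _ _ h1.2).1.2
  have e1 := hang_apply hg c i hi' (by omega)
  have e2 := hang_apply hg c j (by omega) hj'
  have e3 : ∀ k, i < k → k < j → BonnetDrawing.hang g ε t c (t + ε * k) = none := fun k h3 h4 => by
    rw [hang_apply hg c k (by omega) (by omega), h2 k h3 h4]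
  rcases hg.unit with rfl | rfl
  · refine ⟨t + 1 * i, t + 1 * j, by omega, by rw [e1, e2]; exact h1, fun k h3 h4 => ?_⟩
    simpa using e3 (k - t) (by omega) (by omega)
  -- A reflection exchanges the lower and the upper end.
  · refine ⟨t + -1 * j, t + -1 * i, by omega, by rw [e1, e2]; tauto, fun k h3 h4 => ?_⟩
    simpa using e3 (t - k) (by omega) (by omega)

theorem Visible.hang (h' : Visible L a b) (hg : Hangs g ε t lo hi) (h : Within lo hi X L) :
    Visible (L.map (hang g ε t)) a b := by
  rcases h' with ⟨c, hc, h'⟩ | ⟨c, c', k, h1, h2⟩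
  · exact Or.inl ⟨_, List.mem_map_of_mem hc, h'.hang hg h hc⟩
  · have hc : c ∈ L := h1.subset (by simp)
    have hk : lo ≤ k ∧ k ≤ hi := by
      rcases h2 with h2 | h2 <;> exact (h c hc _ _ h2.1).1
    refine Or.inr ⟨_, _, t + ε * k, List.IsInfix.map (BonnetDrawing.hang g ε t) h1, ?_⟩
    rw [hang_apply hg _ k hk.1 hk.2, hang_apply hg _ k hk.1 hk.2]
    exact h2

end hang

/-- The column with `a` on layer `i` and nothing else. -/
def single (a : V) (i : ℤ) : Column V := fun k => if k = i then some a else none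

/-- The column with `a` on layer `i`, `b` on layer `j` and nothing else. -/
def pair (a : V) (i : ℤ) (b : V) (j : ℤ) : Column V :=
  fun k => if k = i then some a else if k = j then some b else none

theorem single_eq_some {a : V} {i k : ℤ} : single a i k = some x ↔ k = i ∧ a = x := by
  unfold single; split_ifs <;> simp [*]

theorem pair_eq_some {i j k : ℤ} (hij : i ≠ j) :
    pair a i b j k = some x ↔ (k = i ∧ a = x) ∨ (k = j ∧ b = x) := by
  unfold pair
  split_ifs with h h'
  · simp [h, hij]
  · simp [h', hij.symm]
  · simp [h, h']

theorem sees_pair {i j : ℤ} (hij : i < j) : Sees (pair a i b j) a b := by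
  refine ⟨i, j, hij, Or.inl ⟨by simp [pair], by simp [pair, hij.ne']⟩, fun k h1 h2 => ?_⟩
  simp [pair, h1.ne', h2.ne]

theorem visible_pair {i j : ℤ} (hij : i < j) : Visible [pair a i b j] a b :=
  Or.inl ⟨_, by simp, sees_pair hij⟩

theorem full_pair_left {i j : ℤ} (hij : i ≠ j) (hab : a ≠ b) : Full a i [pair a i b j] := by
  intro c hc k
  rw [List.mem_singleton.1 hc, pair_eq_some hij]
  simp [hab.symm]

theorem full_pair_right {i j : ℤ} (hij : i ≠ j) (hab : a ≠ b) : Full b j [pair a i b j] := by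
  intro c hc k
  rw [List.mem_singleton.1 hc, pair_eq_some hij]
  simp [hab]

theorem absent_pair {i j : ℤ} (hij : i ≠ j) (ha : x ≠ a) (hb : x ≠ b) :
    Absent x [pair a i b j] := by
  intro c hc k
  rw [List.mem_singleton.1 hc, Ne, pair_eq_some hij]
  simp [ha.symm, hb.symm]

theorem within_pair {i j : ℤ} (hij : i ≠ j) (ha : a ∈ X) (hb : b ∈ X) (h1 : lo ≤ i) (h2 : i ≤ hi)
    (h3 : lo ≤ j) (h4 : j ≤ hi) : Within lo hi X [pair a i b j] := by
  intro c hc k x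
  rw [List.mem_singleton.1 hc, pair_eq_some hij]
  rintro (⟨rfl, rfl⟩ | ⟨rfl, rfl⟩)
  exacts [⟨⟨h1, h2⟩, ha⟩, ⟨⟨h3, h4⟩, hb⟩]

end Columns

/-! ### Drawing bonnet systems column by column -/

section Construction

variable {V : Type u}

/-- `R a b` is the set of vertices of the part beyond the edge `a b` of a triangulation with edges
`E`, where `Lf a b` tells that `a b` is an outer edge and `Ap a b w` that the triangle beyond `a b`
is `a b w`. -/
structure Regions (E Lf : V → V → Prop) (Ap : V → V → V → Prop) (R : V → V → Set V) : Prop where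
  symm : ∀ a b, R a b = R b a
  left_mem : ∀ a b, a ∈ R a b
  leaf_ne : ∀ a b, Lf a b → a ≠ b
  leaf : ∀ a b, Lf a b → R a b = {a, b}
  irrefl : ∀ a, ¬ E a a
  apex_symm : ∀ a b w, Ap a b w → Ap b a w
  union : ∀ a b w, Ap a b w → R a b = R a w ∪ R w b
  inter : ∀ a b w x, Ap a b w → x ∈ R a w → x ∈ R w b → x = w
  apex_ne : ∀ a b w, Ap a b w → a ≠ w
  edge : ∀ a b w x y, Ap a b w → x ∈ R a b → y ∈ R a b → E x y →
    (x ∈ R a w ∧ y ∈ R a w) ∨ (x ∈ R w b ∧ y ∈ R w b) ∨ (x = a ∧ y = b) ∨ (x = b ∧ y = a)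

/-- The list `L` of columns shows all edges of `E` within `X`. -/
def Shows (E : V → V → Prop) (X : Set V) (L : List (Column V)) : Prop :=
  ∀ x ∈ X, ∀ y ∈ X, E x y → Visible L x y

/-- The part beyond `a b` has a drawing on layers `0, …, 2 d` where layer `0` is shared by `a` to
the left and `b` to the right. -/
def HasCapDrawing (E : V → V → Prop) (R : V → V → Set V) (d : ℕ) (a b : V) : Prop :=
  ∃ A B, A ≠ [] ∧ B ≠ [] ∧ Full a 0 A ∧ Full b 0 B ∧ Absent a B ∧ Absent b A ∧
    Within 0 (2 * d) (R a b) (A ++ B) ∧ (∀ x ∈ R a b, x ≠ a → x ≠ b → Bar x (A ++ B)) ∧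
    Shows E (R a b) (A ++ B)

/-- The part beyond `a b` has a drawing on layers `1, …, n` where `a` on layer `1` and
`b` on layer `n` reach the right end. -/
def HasRibbonDrawing (E : V → V → Prop) (R : V → V → Set V) (n : ℤ) (a b : V) : Prop :=
  ∃ L, Within 1 n (R a b) L ∧ Ends a 1 L ∧ Ends b n L ∧
    (∀ x ∈ R a b, x ≠ a → x ≠ b → Bar x L) ∧ Shows E (R a b) L

/-- The part beyond `a x` has a drawing on layers `0, …, n` where `a` occupies layer `0` and
`x` on layer `1` reaches the left end. -/
def HasFanDrawing (E : V → V → Prop) (R : V → V → Set V) (n : ℤ) (a x : V) : Prop :=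
  ∃ L, Within 0 n (R a x) L ∧ Full a 0 L ∧ Starts x 1 L ∧
    (∀ z ∈ R a x, z ≠ a → z ≠ x → Bar z L) ∧ Shows E (R a x) L

/-- The part beyond `a x` has a drawing on layers `0, …, n` where `a` occupies layer `0` and
`x` on layer `n` reaches the right end. -/
def HasHalfDrawing (E : V → V → Prop) (R : V → V → Set V) (n : ℤ) (a x : V) : Prop :=
  ∃ L, L ≠ [] ∧ Within 0 n (R a x) L ∧ Full a 0 L ∧ Ends x n L ∧
    (∀ z ∈ R a x, z ≠ a → z ≠ x → Bar z L) ∧ Shows E (R a x) L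

variable {E Lf : V → V → Prop} {Ap : V → V → V → Prop} {R : V → V → Set V}

namespace Regions

variable (hR : Regions E Lf Ap R)
include hR

theorem right_mem (a b : V) : b ∈ R a b := hR.symm b a ▸ hR.left_mem b a

theorem shows_leaf {a b : V} {L : List (Column V)} (h : Lf a b) (hab : Visible L a b) :
    Shows E (R a b) L := by
  intro x hx y hy hxy
  rw [hR.leaf a b h] at hx hy
  have := hR.irrefl
  rcases hx with rfl | rfl <;> rcases hy with rfl | rfl
  · exact absurd hxy (this _)
  · exact hab
  · exact hab.symm
  · exact absurd hxy (this _)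

theorem shows_apex {a b w : V} {L : List (Column V)} (h : Ap a b w) (h1 : Shows E (R a w) L)
    (h2 : Shows E (R w b) L) (hab : Visible L a b) : Shows E (R a b) L := by
  intro x hx y hy hxy
  rcases hR.edge a b w x y h hx hy hxy with h3 | h3 | ⟨rfl, rfl⟩ | ⟨rfl, rfl⟩
  exacts [h1 x h3.1 y h3.2 hxy, h2 x h3.1 y h3.2 hxy, hab, hab.symm]

theorem apex_ne' {a b w : V} (h : Ap a b w) : b ≠ w := hR.apex_ne b a w (hR.apex_symm _ _ _ h)

theorem left_notMem {a b w : V} (h : Ap a b w) : a ∉ R w b := fun h1 =>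
  hR.apex_ne a b w h (hR.inter a b w a h (hR.left_mem _ _) h1)

theorem right_notMem {a b w : V} (h : Ap a b w) : b ∉ R a w := fun h1 =>
  hR.apex_ne' h (hR.inter a b w b h h1 (hR.right_mem _ _))

theorem ne {a b w : V} (h : Ap a b w) : a ≠ b := fun h1 =>
  hR.left_notMem h (h1 ▸ hR.right_mem w b)

theorem left_sub {a b w : V} (h : Ap a b w) : R a w ⊆ R a b := by
  rw [hR.union a b w h]; exact Set.subset_union_left

theorem right_sub {a b w : V} (h : Ap a b w) : R w b ⊆ R a b := by
  rw [hR.union a b w h]; exact Set.subset_union_right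

end Regions

theorem Shows.append_left {X : Set V} {L M : List (Column V)} (h : Shows E X M) :
    Shows E X (L ++ M) := fun x hx y hy hxy => (h x hx y hy hxy).append_left

theorem Shows.append_right {X : Set V} {L M : List (Column V)} (h : Shows E X L) :
    Shows E X (L ++ M) := fun x hx y hy hxy => (h x hx y hy hxy).append_right

theorem Shows.hang {X Y : Set V} {L : List (Column V)} {g : Column V} {ε t lo hi : ℤ}
    (h' : Shows E X L) (hg : Hangs g ε t lo hi) (h : Within lo hi Y L) :
    Shows E X (L.map (hang g ε t)) := fun x hx y hy hxy => (h' x hx y hy hxy).hang hg h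

theorem Shows.reverse {X : Set V} {L : List (Column V)} (h : Shows E X L) :
    Shows E X L.reverse := fun x hx y hy hxy => (h x hx y hy hxy).reverse

theorem hangs_none {ε t lo hi : ℤ} (h : ε = 1 ∨ ε = -1) :
    Hangs (fun _ => none : Column V) ε t lo hi := ⟨h, fun _ _ _ => rfl⟩

theorem hangs_single {ε t lo hi k : ℤ} {v : V} (h : ε = 1 ∨ ε = -1)
    (hk : ∀ j, lo ≤ j → j ≤ hi → t + ε * j ≠ k) : Hangs (single v k) ε t lo hi :=
  ⟨h, fun j h1 h2 => by simp [single, hk j h1 h2]⟩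

theorem single_ne {v x : V} {i : ℤ} (h : x ≠ v) (k : ℤ) : single v i k ≠ some x := by
  rw [Ne, single_eq_some]; exact fun h1 => h h1.2.symm

theorem single_iff {v : V} {i : ℤ} (k : ℤ) : single v i k = some v ↔ k = i := by
  simp [single_eq_some]

/-! ### Drawings of ribbons -/

theorem HasRibbonDrawing.swap (hR : Regions E Lf Ap R) {n : ℤ} {a b : V}
    (h : HasRibbonDrawing E R n a b) : HasRibbonDrawing E R n b a := by
  obtain ⟨L, h1, h2, h3, h4, h5⟩ := h
  -- The reflection j ↦ n + 1 - j exchanges the layers 1 and n.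
  have hg : Hangs (fun _ => none : Column V) (-1) (n + 1) 1 n := hangs_none (by simp)
  rw [HasRibbonDrawing, ← hR.symm a b]
  refine ⟨L.map (hang (fun _ => none) (-1) (n + 1)),
    h1.hang hg (by simp) subset_rfl (fun j _ _ => by omega), ?_, ?_,
    fun x hx ha hb => (h4 x hx hb ha).hang hg h1 (by simp), h5.hang hg h1⟩
  · convert h3.hang hg h1 (by simp) using 1; ring
  · convert h2.hang hg h1 (by simp) using 1; ring

theorem hasRibbonDrawing_leaf (hR : Regions E Lf Ap R) {n : ℤ} (hn : 1 < n) {a b : V}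
    (h : Lf a b) : HasRibbonDrawing E R n a b := by
  have hab := hR.leaf_ne a b h
  refine ⟨[pair a 1 b n],
    within_pair hn.ne (hR.left_mem _ _) (hR.right_mem _ _) le_rfl hn.le hn.le le_rfl,
    (full_pair_left hn.ne hab).ends (by simp), (full_pair_right hn.ne hab).ends (by simp), ?_,
    hR.shows_leaf h (visible_pair hn)⟩
  intro x hx ha hb
  rw [hR.leaf a b h] at hx
  rcases hx with h1 | h1 <;> contradiction

/-- To the right of the ribbon beyond zb, the cap beyond za is put on layers 1, …, 2d + 1. Its left
root z prolongs the bar of z, then a takes over layer 1, while b runs above the cap on layer 2d + 2.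
A last column shows ab. -/
theorem hasRibbonDrawing_step (hR : Regions E Lf Ap R) {d : ℕ} {a b z : V} (h : Ap a b z)
    (hQ : HasCapDrawing E R d z a) (hz : HasRibbonDrawing E R (2 * d + 2) z b) :
    HasRibbonDrawing E R (2 * d + 2) a b := by
  obtain ⟨L, w0, ez, eb, br, sh⟩ := hz
  obtain ⟨A, B, hA, hB, fz, fa, nz, na, w, br', sh'⟩ := hQ
  have hg : Hangs (single b (2 * d + 2)) 1 1 0 (2 * d) :=
    hangs_single (by simp) (fun j _ _ => by omega)
  have haz := hR.apex_ne _ _ _ h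
  have hbz := hR.apex_ne' h
  have hab := hR.ne h
  have ha := hR.left_notMem h
  have hb := hR.right_notMem h
  rw [hR.symm] at hb
  have wA := w.of_append_left
  have wB := w.of_append_right
  have hn : (1 : ℤ) ≠ 2 * d + 2 := by omega
  have sub1 := hR.left_sub h
  rw [hR.symm a z] at sub1
  have sub2 := hR.right_sub h
  have fb : Full b (2 * d + 2) ((A ++ B).map (hang (single b (2 * d + 2)) 1 1)) :=
    full_hang (w.absent hb) single_iff
  refine ⟨L ++ ((A ++ B).map (hang (single b (2 * d + 2)) 1 1) ++ [pair a 1 b (2 * d + 2)]),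
    (w0.mono le_rfl le_rfl sub2).append ((w.hang hg ?_ sub1 ?_).append
      (within_pair hn (hR.left_mem _ _) (hR.right_mem _ _) ?_ ?_ ?_ ?_)), ?_, ?_, ?_, ?_⟩
  · intro k x hk
    obtain ⟨rfl, rfl⟩ := single_eq_some.1 hk
    exact ⟨by omega, hR.right_mem _ _⟩
  · intro j _ _; omega
  · omega
  · omega
  · omega
  · omega
  · rw [List.map_append, List.append_assoc]
    refine Ends.append_left (Ends.append_left ?_ ?_) (w0.absent ha)
    · refine Full.ends ?_ (by simp)
      exact Full.append (by simpa using fa.hang hg wB (single_ne hab)) (full_pair_left hn hab)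
    · exact na.hang hg wA (single_ne hab)
  · exact eb.append_full (fb.append (full_pair_right hn hab))
  · intro x hx hxa hxb
    rw [hR.union _ _ _ h] at hx
    by_cases hxz : x = z
    · subst hxz
      -- The bar of the apex consists of its end in the ribbon and its start in the cap, both on
      -- layer 1.
      refine ez.append_starts ?_
      rw [List.map_append, List.append_assoc]
      refine (Full.starts (by simpa using fz.hang hg wA (single_ne hxb)) (by simpa)).append_right ?_
      exact (nz.hang hg wB (single_ne hxb)).append (absent_pair hn hxa hxb)
    · rcases hx with hx | hx
      · refine Bar.append_left (Bar.append_right ?_ (absent_pair hn hxa hxb))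
          (w0.absent fun h1 => hxz (hR.inter _ _ _ _ h hx h1))
        rw [hR.symm] at hx
        exact (br' x hx hxz hxa).hang hg w (single_ne hxb)
      · refine (br x hx hxz hxb).append_right (Absent.append ?_ (absent_pair hn hxa hxb))
        refine (w.absent fun h1 => hxz (hR.inter _ _ _ _ h ?_ hx)).hang hg w (single_ne hxb)
        rwa [hR.symm]
  · refine hR.shows_apex h ?_ sh.append_right
      (visible_pair (show (1 : ℤ) < 2 * d + 2 by omega)).append_left.append_left
    rw [hR.symm]
    exact (sh'.hang hg w).append_right.append_left

theorem Ribbon.hasRibbonDrawing (hR : Regions E Lf Ap R) {d : ℕ} {Q : V → V → Prop}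
    (hQ : ∀ a b, Q a b → HasCapDrawing E R d a b) {a b : V} (h : Ribbon Lf Ap Q a b) :
    HasRibbonDrawing E R (2 * d + 2) a b := by
  induction h with
  | leaf h => exact hasRibbonDrawing_leaf hR (by omega) h
  | swap _ ih => exact ih.swap hR
  | step h h1 _ ih => exact hasRibbonDrawing_step hR h (hQ _ _ h1) ih

/-! ### Drawings of fans -/

theorem hasFanDrawing_leaf (hR : Regions E Lf Ap R) {n : ℤ} (hn : 1 ≤ n) {a x : V}
    (h : Lf a x) : HasFanDrawing E R n a x := by
  have hab := hR.leaf_ne a x h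
  refine ⟨[pair a 0 x 1],
    within_pair (by simp) (hR.left_mem _ _) (hR.right_mem _ _) (by omega) (by omega) (by omega) hn,
    full_pair_left (by simp) hab, (full_pair_right (by simp) hab).starts (by simp), ?_,
    hR.shows_leaf h (visible_pair (by simp))⟩
  intro z hz ha hb
  rw [hR.leaf a x h] at hz
  rcases hz with h1 | h1 <;> contradiction

/-- Above a, the cap beyond xz fills layers 1, …, 2d + 1 with x to the left and z to the right,
where the drawing beyond az takes over z on layer 1. A first column shows ax. -/
theorem hasFanDrawing_step (hR : Regions E Lf Ap R) {d : ℕ} {a x z : V} (h : Ap a x z)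
    (hQ : HasCapDrawing E R d x z) (hz : HasFanDrawing E R (2 * d + 1) a z) :
    HasFanDrawing E R (2 * d + 1) a x := by
  obtain ⟨L, w0, fa, ez, br, sh⟩ := hz
  obtain ⟨A, B, hA, hB, fx, fz, nx, nz, w, br', sh'⟩ := hQ
  have hg : Hangs (single a 0) 1 1 0 (2 * d) :=
    hangs_single (by simp) (fun j _ _ => by omega)
  have haz := hR.apex_ne _ _ _ h
  have hxz := hR.apex_ne' h
  have hax := hR.ne h
  have ha := hR.left_notMem h
  have hx := hR.right_notMem h
  rw [hR.symm] at ha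
  have wA := w.of_append_left
  have wB := w.of_append_right
  have hn : (0 : ℤ) ≠ 1 := by omega
  have sub1 := hR.left_sub h
  have sub2 := hR.right_sub h
  rw [hR.symm z x] at sub2
  have fa' : Full a 0 ((A ++ B).map (hang (single a 0) 1 1)) :=
    full_hang (w.absent ha) single_iff
  refine ⟨[pair a 0 x 1] ++ ((A ++ B).map (hang (single a 0) 1 1) ++ L),
    (within_pair hn (hR.left_mem _ _) (hR.right_mem _ _) ?_ ?_ ?_ ?_).append
      ((w.hang hg ?_ sub2 ?_).append (w0.mono le_rfl le_rfl sub1)), ?_, ?_, ?_, ?_⟩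
  · omega
  · omega
  · omega
  · omega
  · intro k v hk
    obtain ⟨rfl, rfl⟩ := single_eq_some.1 hk
    exact ⟨by omega, hR.left_mem _ _⟩
  · intro j _ _; omega
  · exact (full_pair_left hn hax).append (fa'.append fa)
  · refine (full_pair_right hn hax).append_starts ?_
    refine Starts.append_right ?_ (w0.absent hx)
    rw [List.map_append]
    refine (Full.starts ?_ (by simpa)).append_right (nx.hang hg wB (single_ne hax.symm))
    simpa using fx.hang hg wA (single_ne hax.symm)
  · intro y hy hya hyx
    rw [hR.union _ _ _ h] at hy
    refine Bar.append_left ?_ (absent_pair hn hya hyx)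
    by_cases hyz : y = z
    · subst hyz
      refine Ends.append_starts (y := 1) ?_ ez
      rw [List.map_append]
      refine (Full.ends ?_ (by simpa)).append_left (nz.hang hg wA (single_ne hya))
      simpa using fz.hang hg wB (single_ne hya)
    · rcases hy with hy | hy
      · refine (br y hy hya hyz).append_left ((w.absent fun h1 => hyz ?_).hang hg w (single_ne hya))
        rw [hR.symm] at h1
        exact hR.inter _ _ _ _ h hy h1
      · refine Bar.append_right ?_ (w0.absent fun h1 => hyz (hR.inter _ _ _ _ h h1 hy))
        rw [hR.symm] at hy
        exact (br' y hy hyx hyz).hang hg w (single_ne hya)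
  · refine hR.shows_apex h sh.append_left.append_left ?_
      (visible_pair (show (0 : ℤ) < 1 by omega)).append_right
    rw [hR.symm]
    exact (sh'.hang hg w).append_right.append_left

theorem FanBeyond.hasFanDrawing (hR : Regions E Lf Ap R) {d : ℕ} {Q : V → V → Prop}
    (hQ : ∀ a b, Q a b → HasCapDrawing E R d a b) {a x : V} (h : FanBeyond Lf Ap Q a x) :
    HasFanDrawing E R (2 * d + 1) a x := by
  induction h with
  | leaf h => exact hasFanDrawing_leaf hR (by omega) h
  | step h h1 _ ih => exact hasFanDrawing_step hR h (hQ _ _ h1) ih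

/-! ### Drawings of half bonnets -/

theorem hasHalfDrawing_leaf (hR : Regions E Lf Ap R) {n : ℤ} (hn : 0 < n) {a x : V}
    (h : Lf a x) : HasHalfDrawing E R n a x := by
  have hab := hR.leaf_ne a x h
  refine ⟨[pair a 0 x n], by simp,
    within_pair hn.ne (hR.left_mem _ _) (hR.right_mem _ _) le_rfl hn.le hn.le le_rfl,
    full_pair_left hn.ne hab, (full_pair_right hn.ne hab).ends (by simp), ?_,
    hR.shows_leaf h (visible_pair hn)⟩
  intro z hz ha hb
  rw [hR.leaf a x h] at hz
  rcases hz with h1 | h1 <;> contradiction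

/-- The cap beyond zx hangs upside down from layer 2d + 2, on layers 2, …, 2d + 2: z prolongs its
bar on the top layer and x replaces it there, while a stays on layer 0. -/
theorem hasHalfDrawing_along (hR : Regions E Lf Ap R) {d : ℕ} {a x z : V} (h : Ap a x z)
    (hQ : HasCapDrawing E R d z x) (hz : HasHalfDrawing E R (2 * d + 2) a z) :
    HasHalfDrawing E R (2 * d + 2) a x := by
  obtain ⟨L, hL, w0, fa, ez, br, sh⟩ := hz
  obtain ⟨A, B, hA, hB, fz, fx, nz, nx, w, br', sh'⟩ := hQ
  have hg : Hangs (single a 0) (-1) (2 * d + 2) 0 (2 * d) :=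
    hangs_single (by simp) (fun j _ _ => by omega)
  have haz := hR.apex_ne _ _ _ h
  have hxz := hR.apex_ne' h
  have hax := hR.ne h
  have ha := hR.left_notMem h
  have hx := hR.right_notMem h
  have wA := w.of_append_left
  have wB := w.of_append_right
  have hn : (0 : ℤ) < 2 * d + 2 := by omega
  have sub1 := hR.left_sub h
  have sub2 := hR.right_sub h
  have fa' : Full a 0 ((A ++ B).map (hang (single a 0) (-1) (2 * d + 2))) :=
    full_hang (w.absent ha) single_iff
  refine ⟨L ++ ((A ++ B).map (hang (single a 0) (-1) (2 * d + 2)) ++ [pair a 0 x (2 * d + 2)]),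
    by simp, (w0.mono le_rfl le_rfl sub1).append ((w.hang hg ?_ sub2 ?_).append
      (within_pair hn.ne (hR.left_mem _ _) (hR.right_mem _ _) ?_ ?_ ?_ ?_)), ?_, ?_, ?_, ?_⟩
  · intro k v hk
    obtain ⟨rfl, rfl⟩ := single_eq_some.1 hk
    exact ⟨by omega, hR.left_mem _ _⟩
  · intro j _ _; omega
  · omega
  · omega
  · omega
  · omega
  · exact fa.append (fa'.append (full_pair_left hn.ne hax))
  · rw [List.map_append, List.append_assoc]
    refine Ends.append_left (Ends.append_left ?_ ?_) (w0.absent hx)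
    · refine Full.ends ?_ (by simp)
      exact Full.append (by simpa using fx.hang hg wB (single_ne hax.symm))
        (full_pair_right hn.ne hax)
    · exact nx.hang hg wA (single_ne hax.symm)
  · intro y hy hya hyx
    rw [hR.union _ _ _ h] at hy
    by_cases hyz : y = z
    · subst hyz
      refine ez.append_starts ?_
      rw [List.map_append, List.append_assoc]
      refine (Full.starts (by simpa using fz.hang hg wA (single_ne hya)) (by simpa)).append_right ?_
      exact (nz.hang hg wB (single_ne hya)).append (absent_pair hn.ne hya hyx)
    · rcases hy with hy | hy
      · refine (br y hy hya hyz).append_right (Absent.append ?_ (absent_pair hn.ne hya hyx))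
        exact (w.absent fun h1 => hyz (hR.inter _ _ _ _ h hy h1)).hang hg w (single_ne hya)
      · refine Bar.append_left (Bar.append_right ?_ (absent_pair hn.ne hya hyx))
          (w0.absent fun h1 => hyz (hR.inter _ _ _ _ h h1 hy))
        exact (br' y hy hyz hyx).hang hg w (single_ne hya)
  · exact hR.shows_apex h sh.append_right (sh'.hang hg w).append_right.append_left
      (visible_pair hn).append_left.append_left

/-- The ribbon beyond zx lies on layers 1, …, 2d + 2 and receives a below it. The fan beyond az lies
on layers 0, …, 2d + 1 and receives x above it. Side by side they fit, because z ends the ribbon and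
starts the fan on layer 1. -/
theorem hasHalfDrawing_leave (hR : Regions E Lf Ap R) {d : ℕ} {a x z : V} (h : Ap a x z)
    (hf : HasFanDrawing E R (2 * d + 1) a z) (hr : HasRibbonDrawing E R (2 * d + 2) z x) :
    HasHalfDrawing E R (2 * d + 2) a x := by
  obtain ⟨F, wF, fa, sz, brF, shF⟩ := hf
  obtain ⟨L, wL, ez, ex, brL, shL⟩ := hr
  have hgF : Hangs (single x (2 * d + 2)) 1 0 0 (2 * d + 1) :=
    hangs_single (by simp) (fun j _ _ => by omega)
  have hgL : Hangs (single a 0) 1 0 1 (2 * d + 2) :=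
    hangs_single (by simp) (fun j _ _ => by omega)
  have hax := hR.ne h
  have ha := hR.left_notMem h
  have hx := hR.right_notMem h
  have hn : (0 : ℤ) < 2 * d + 2 := by omega
  have sub1 := hR.left_sub h
  have sub2 := hR.right_sub h
  refine ⟨L.map (hang (single a 0) 1 0) ++ (F.map (hang (single x (2 * d + 2)) 1 0) ++
      [pair a 0 x (2 * d + 2)]),
    by simp, (wL.hang hgL ?_ sub2 ?_).append ((wF.hang hgF ?_ sub1 ?_).append
      (within_pair hn.ne (hR.left_mem _ _) (hR.right_mem _ _) ?_ ?_ ?_ ?_)), ?_, ?_, ?_, ?_⟩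
  · intro k v hk
    obtain ⟨rfl, rfl⟩ := single_eq_some.1 hk
    exact ⟨by omega, hR.left_mem _ _⟩
  · intro j _ _; omega
  · intro k v hk
    obtain ⟨rfl, rfl⟩ := single_eq_some.1 hk
    exact ⟨by omega, hR.right_mem _ _⟩
  · intro j _ _; omega
  · omega
  · omega
  · omega
  · omega
  · exact (full_hang (wL.absent ha) single_iff).append
      (Full.append (by simpa using fa.hang hgF wF (single_ne hax)) (full_pair_left hn.ne hax))
  · refine Ends.append_full (by simpa using ex.hang hgL wL (single_ne hax.symm)) ?_
    exact (full_hang (wF.absent hx) single_iff).append (full_pair_right hn.ne hax)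
  · intro y hy hya hyx
    rw [hR.union _ _ _ h] at hy
    by_cases hyz : y = z
    · subst hyz
      refine Ends.append_starts (ez.hang hgL wL (single_ne hya))
        (Starts.append_right (sz.hang hgF wF (single_ne hyx)) (absent_pair hn.ne hya hyx))
    · rcases hy with hy | hy
      · refine Bar.append_left (Bar.append_right ?_ (absent_pair hn.ne hya hyx))
          ((wL.absent fun h1 => hyz (hR.inter _ _ _ _ h hy h1)).hang hgL wL (single_ne hya))
        exact (brF y hy hya hyz).hang hgF wF (single_ne hyx)
      · refine Bar.append_right ((brL y hy hyz hyx).hang hgL wL (single_ne hya))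
          (Absent.append ?_ (absent_pair hn.ne hya hyx))
        exact (wF.absent fun h1 => hyz (hR.inter _ _ _ _ h h1 hy)).hang hgF wF (single_ne hyx)
  · exact hR.shows_apex h (shF.hang hgF wF).append_right.append_left (shL.hang hgL wL).append_right
      (visible_pair hn).append_left.append_left

theorem RibbonFan.hasHalfDrawing (hR : Regions E Lf Ap R) {d : ℕ} {Q : V → V → Prop}
    (hQ : ∀ a b, Q a b → HasCapDrawing E R d a b) {a x : V} (h : RibbonFan Lf Ap Q a x) :
    HasHalfDrawing E R (2 * d + 2) a x := by
  induction h with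
  | leaf h => exact hasHalfDrawing_leaf hR (by omega) h
  | along h h1 _ ih => exact hasHalfDrawing_along hR h (hQ _ _ h1) ih
  | leave h h1 h2 =>
    exact hasHalfDrawing_leave hR h (h1.hasFanDrawing hR hQ) (h2.hasRibbonDrawing hR hQ)

/-! ### Cap drawings -/

theorem hasCapDrawing_leaf (hR : Regions E Lf Ap R) {d : ℕ} {a b : V} (h : Lf a b) :
    HasCapDrawing E R d a b := by
  have hab := hR.leaf_ne a b h
  have key : ∀ v : V, Full v 0 [single v 0] := fun v c hc k => by
    rw [List.mem_singleton.1 hc, single_iff]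
  have key' : ∀ v x : V, x ≠ v → Absent x [single v 0] := fun v x hx c hc k => by
    rw [List.mem_singleton.1 hc]; exact single_ne hx k
  have hw : ∀ v ∈ R a b, Within 0 (2 * d) (R a b) [single v 0] := fun v hv c hc k x hx => by
    rw [List.mem_singleton.1 hc] at hx
    obtain ⟨rfl, rfl⟩ := single_eq_some.1 hx
    exact ⟨by omega, hv⟩
  refine ⟨[single a 0], [single b 0], by simp, by simp, key a, key b, key' _ _ hab,
    key' _ _ hab.symm, (hw a (hR.left_mem _ _)).append (hw b (hR.right_mem _ _)), ?_,
    hR.shows_leaf h (visible_of_full (by simp) (by simp) (key a) (key b))⟩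
  intro z hz ha hb
  rw [hR.leaf a b h] at hz
  rcases hz with h1 | h1 <;> contradiction

/-- The half at a is followed by the mirror image of the half at b. The two sections of w merge on
layer 2d + 2, now the top layer 2(d + 1), and a meets b on layer 0, which gives the edge ab. -/
theorem hasCapDrawing_apex (hR : Regions E Lf Ap R) {d : ℕ} {a b w : V} (h : Ap a b w)
    (ha : HasHalfDrawing E R (2 * d + 2) a w) (hb : HasHalfDrawing E R (2 * d + 2) b w) :
    HasCapDrawing E R (d + 1) a b := by
  obtain ⟨A, hA, wA, fa, ewA, brA, shA⟩ := ha
  obtain ⟨B, hB, wB, fb, ewB, brB, shB⟩ := hb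
  have sub1 := hR.left_sub h
  have sub2 := hR.right_sub h
  have ha := hR.left_notMem h
  have hb := hR.right_notMem h
  rw [hR.symm] at sub2 ha
  refine ⟨A, B.reverse, hA, by simpa, fa, fb.reverse, (wB.absent ha).reverse, wA.absent hb,
    (wA.mono le_rfl (by push_cast; omega) sub1).append
      (wB.mono le_rfl (by push_cast; omega) sub2).reverse, ?_,
    hR.shows_apex h shA.append_right ?_ (visible_of_full hA (by simpa) fa fb.reverse)⟩
  · intro x hx hxa hxb
    rw [hR.union _ _ _ h, hR.symm w b] at hx
    by_cases hxw : x = w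
    · subst hxw
      exact ewA.append_starts ewB.reverse
    · rcases hx with hx | hx
      · refine (brA x hx hxa hxw).append_right (wB.absent fun h1 => hxw ?_).reverse
        rw [hR.symm] at h1
        exact hR.inter _ _ _ _ h hx h1
      · refine (brB x hx hxb hxw).reverse.append_left (wA.absent fun h1 => hxw ?_)
        rw [hR.symm] at hx
        exact hR.inter _ _ _ _ h h1 hx
  · rw [hR.symm]
    exact shB.reverse.append_left

theorem BonnetLevels.hasCapDrawing (hR : Regions E Lf Ap R) (d : ℕ) :
    ∀ a b, BonnetLevels Lf Ap d a b → HasCapDrawing E R d a b := by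
  induction d with
  | zero => exact fun a b h => hasCapDrawing_leaf hR h
  | succ d ih =>
    rintro a b (h | ⟨w, h, h1, h2⟩)
    · exact hasCapDrawing_leaf hR h
    · exact hasCapDrawing_apex hR h (h1.hasHalfDrawing hR ih) (h2.hasHalfDrawing hR ih)

end Construction

/-! ### From columns to flat visibility representations -/

section Realization

variable {V : Type u}

/-- A drawing on the integer grid. -/
structure GridDrawing (G : SimpleGraph V) (n : ℕ) where
  row : V → ℤ
  fst : V → ℤ
  lst : V → ℤ
  row_mem : ∀ v, 0 ≤ row v ∧ row v ≤ n
  fst_le_lst : ∀ v, fst v ≤ lst v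
  eq_of_mem : ∀ a b i, row a = row b → fst a ≤ i → i ≤ lst a → fst b ≤ i → i ≤ lst b → a = b
  adj : ∀ e ∈ G.edgeSet, ∃ a b, e = s(a, b) ∧
    ((row a < row b ∧ ∃ i, (fst a ≤ i ∧ i ≤ lst a) ∧ (fst b ≤ i ∧ i ≤ lst b) ∧
      ∀ w, row a < row w → row w < row b → ¬ (fst w ≤ i ∧ i ≤ lst w)) ∨
    (row a = row b ∧ lst a + 1 = fst b))

namespace GridDrawing

variable {G : SimpleGraph V} {n : ℕ} (D : GridDrawing G n)

/-- The left end of the segment of a vertex. -/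
noncomputable def left (v : V) : ℝ := D.fst v - 1 / 3

/-- The right end of the segment of a vertex. -/
noncomputable def right (v : V) : ℝ := D.lst v + 1 / 3

/-- `S` is a segment that can represent the edge from `a` to `b`. -/
def Draws (S : Set (ℝ × ℝ)) (a b : V) : Prop :=
  (D.row a < D.row b ∧ ∃ i : ℤ, (D.fst a ≤ i ∧ i ≤ D.lst a) ∧ (D.fst b ≤ i ∧ i ≤ D.lst b) ∧
      (∀ w, D.row a < D.row w → D.row w < D.row b → ¬ (D.fst w ≤ i ∧ i ≤ D.lst w)) ∧
      S = vSegment i (D.row a) (D.row b)) ∨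
    (D.row a = D.row b ∧ D.lst a + 1 = D.fst b ∧
      S = hSegment (D.right a) (D.left b) (D.row a))

/-- The conditional form allows a choice for all of `Sym2 V`; non-edges get a dummy set. -/
theorem exists_draws (e : Sym2 V) :
    ∃ S, e ∈ G.edgeSet → ∃ a b, e = s(a, b) ∧ D.Draws S a b := by
  by_cases he : e ∈ G.edgeSet
  · obtain ⟨a, b, hab, ⟨h1, i, h2, h3, h4⟩ | ⟨h1, h2⟩⟩ := D.adj e he
    · exact ⟨_, fun _ => ⟨a, b, hab, Or.inl ⟨h1, i, h2, h3, h4, rfl⟩⟩⟩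
    · exact ⟨_, fun _ => ⟨a, b, hab, Or.inr ⟨h1, h2, rfl⟩⟩⟩
  · exact ⟨∅, fun h => absurd h he⟩

/-- The segment of an edge. -/
noncomputable def edgeSeg (e : Sym2 V) : Set (ℝ × ℝ) := (D.exists_draws e).choose

theorem edgeSeg_spec {e : Sym2 V} (he : e ∈ G.edgeSet) :
    ∃ a b, e = s(a, b) ∧ D.Draws (D.edgeSeg e) a b := (D.exists_draws e).choose_spec he

/-- The margin 1/3 adds no integer abscissa to a segment and leaves a gap of width 1/3 between
segments in consecutive columns, which is the room for a horizontal edge. -/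
theorem left_le_iff {v : V} {i : ℤ} : D.left v ≤ i ↔ D.fst v ≤ i := by
  unfold left
  constructor
  · intro h
    have : (D.fst v : ℝ) < (i + 1 : ℤ) := by push_cast; linarith
    have := Int.cast_lt.1 this
    omega
  · intro h
    have : (D.fst v : ℝ) ≤ i := Int.cast_le.2 h
    linarith

theorem le_right_iff {v : V} {i : ℤ} : (i : ℝ) ≤ D.right v ↔ i ≤ D.lst v := by
  unfold right
  constructor
  · intro h
    have : (i : ℝ) < (D.lst v + 1 : ℤ) := by push_cast; linarith
    have := Int.cast_lt.1 this
    omega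
  · intro h
    have : (i : ℝ) ≤ D.lst v := Int.cast_le.2 h
    linarith

theorem mem_seg {v : V} {p : ℝ × ℝ} : p ∈ hSegment (D.left v) (D.right v) (D.row v) ↔
    (D.left v ≤ p.1 ∧ p.1 ≤ D.right v) ∧ p.2 = D.row v := Iff.rfl

theorem mem_vSegment {x : ℝ} {y z : ℤ} {p : ℝ × ℝ} :
    p ∈ vSegment x y z ↔ p.1 = x ∧ (y : ℝ) ≤ p.2 ∧ p.2 ≤ z := Iff.rfl

theorem mem_hSegment {l r : ℝ} {y : ℤ} {p : ℝ × ℝ} :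
    p ∈ hSegment l r y ↔ (l ≤ p.1 ∧ p.1 ≤ r) ∧ p.2 = y := Iff.rfl

theorem lt_or_lt {a b : V} (hab : a ≠ b) (h : D.row a = D.row b) :
    D.lst a < D.fst b ∨ D.lst b < D.fst a := by
  by_contra! h1
  have ha := D.fst_le_lst a
  have hb := D.fst_le_lst b
  rcases le_total (D.fst a) (D.fst b) with h2 | h2
  · exact hab (D.eq_of_mem a b (D.fst b) h h2 h1.1 le_rfl hb)
  · exact hab (D.eq_of_mem a b (D.fst a) h le_rfl ha h2 h1.2)

/-- A vertical edge stands at an integer abscissa, where its line of sight is free. A horizontal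
edge fills the gap between two consecutive columns, and a third vertex on that row ends before it or
starts after it. -/
theorem edge_vertex {S : Set (ℝ × ℝ)} {a b w : V} (h : D.Draws S a b) (ha : w ≠ a) (hb : w ≠ b) :
    Disjoint S (hSegment (D.left w) (D.right w) (D.row w)) := by
  rw [Set.disjoint_left]
  rintro ⟨x, y⟩ hp hq
  obtain ⟨⟨h1, h2⟩, h3⟩ := D.mem_seg.1 hq
  dsimp only at h1 h2 h3
  rcases h with ⟨hr, i, hi, hj, hw, rfl⟩ | ⟨hr, hl, rfl⟩
  · obtain ⟨h4, h5, h6⟩ := mem_vSegment.1 hp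
    dsimp only at h4 h5 h6
    subst h4 h3
    rw [D.left_le_iff] at h1
    rw [D.le_right_iff] at h2
    rw [Int.cast_le] at h5 h6
    rcases h5.eq_or_lt with h5 | h5
    · exact ha (D.eq_of_mem _ _ i h5.symm h1 h2 hi.1 hi.2)
    rcases h6.eq_or_lt with h6 | h6
    · exact hb (D.eq_of_mem _ _ i h6 h1 h2 hj.1 hj.2)
    exact hw w h5 h6 ⟨h1, h2⟩
  · obtain ⟨⟨h4, h5⟩, h6⟩ := mem_hSegment.1 hp
    dsimp only at h4 h5 h6
    have hwa : D.row w = D.row a := by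
      rw [h3] at h6; exact_mod_cast h6
    have hw' := D.fst_le_lst w
    have hb' := D.fst_le_lst b
    have ha' := D.fst_le_lst a
    unfold left right at *
    rcases D.lt_or_lt ha hwa with h7 | h7
    · have : (D.lst w : ℝ) < D.lst a := Int.cast_lt.2 (by omega)
      linarith
    · rcases D.lt_or_lt hb (hwa.trans hr) with h8 | h8
      · omega
      · have : (D.fst b : ℝ) < D.fst w := Int.cast_lt.2 (by omega)
        linarith

/-- Vertical edges in one column can only meet end to end, because a proper overlap would put an end
of one inside the line of sight of the other. A vertical and a horizontal edge never meet, since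
gaps contain no integer, and a gap determines the ends of its horizontal edge. -/
theorem edge_edge {S T : Set (ℝ × ℝ)} {a b c d : V} (h : D.Draws S a b) (h' : D.Draws T c d)
    (hne : s(a, b) ≠ s(c, d)) {p : ℝ × ℝ} (hp : p ∈ S) (hq : p ∈ T) :
    ∃ w, w ∈ s(a, b) ∧ w ∈ s(c, d) ∧ p ∈ hSegment (D.left w) (D.right w) (D.row w) := by
  obtain ⟨x, y⟩ := p
  rcases h with ⟨hr, i, hi, hj, hw, rfl⟩ | ⟨hr, hl, rfl⟩ <;>
    rcases h' with ⟨hr', i', hi', hj', hw', rfl⟩ | ⟨hr', hl', rfl⟩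
  · obtain ⟨h1, h2, h3⟩ := mem_vSegment.1 hp
    obtain ⟨h4, h5, h6⟩ := mem_vSegment.1 hq
    dsimp only at h1 h2 h3 h4 h5 h6
    subst h1
    have := Int.cast_injective h4
    subst this
    have n1 := fun h7 h8 => hw c h7 h8 hi'
    have n2 := fun h7 h8 => hw d h7 h8 hj'
    have n3 := fun h7 h8 => hw' a h7 h8 hi
    have n4 := fun h7 h8 => hw' b h7 h8 hj
    have l1 : D.row a ≤ D.row d := by exact_mod_cast h2.trans h6
    have l2 : D.row c ≤ D.row b := by exact_mod_cast h5.trans h3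
    -- With a common lower end, the shorter edge would end inside the line of sight of the longer
    -- one.
    have e1 : D.row a ≠ D.row c := fun h => by
      have := D.eq_of_mem _ _ i h hi.1 hi.2 hi'.1 hi'.2
      subst this
      rcases lt_trichotomy (D.row b) (D.row d) with h7 | h7 | h7
      · exact n4 hr h7
      · have := D.eq_of_mem _ _ i h7 hj.1 hj.2 hj'.1 hj'.2
        exact hne (by rw [this])
      · exact n2 hr' h7
    rcases lt_or_gt_of_ne e1 with h7 | h7
    · have h8 : D.row b = D.row c := by
        by_contra h8
        exact n1 h7 (by omega)
      have := D.eq_of_mem _ _ i h8 hj.1 hj.2 hi'.1 hi'.2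
      subst this
      refine ⟨b, by simp, by simp, D.mem_seg.2 ⟨⟨?_, ?_⟩, le_antisymm h3 h5⟩⟩
      · exact D.left_le_iff.2 hj.1
      · exact D.le_right_iff.2 hj.2
    · have h8 : D.row a = D.row d := by
        by_contra h8
        exact n3 h7 (by omega)
      have := D.eq_of_mem _ _ i h8 hi.1 hi.2 hj'.1 hj'.2
      subst this
      refine ⟨a, by simp, by simp, D.mem_seg.2 ⟨⟨?_, ?_⟩, le_antisymm h6 h2⟩⟩
      · exact D.left_le_iff.2 hi.1
      · exact D.le_right_iff.2 hi.2
  · exfalso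
    obtain ⟨h1, h2, h3⟩ := mem_vSegment.1 hp
    obtain ⟨⟨h4, h5⟩, h6⟩ := mem_hSegment.1 hq
    dsimp only at h1 h2 h3 h4 h5 h6
    unfold left right at *
    have h7 : (D.lst c : ℝ) < i := by linarith
    have h8 : (i : ℝ) < D.fst d := by linarith
    rw [Int.cast_lt] at h7 h8
    omega
  · exfalso
    obtain ⟨h1, h2, h3⟩ := mem_vSegment.1 hq
    obtain ⟨⟨h4, h5⟩, h6⟩ := mem_hSegment.1 hp
    dsimp only at h1 h2 h3 h4 h5 h6
    unfold left right at *
    have h7 : (D.lst a : ℝ) < i' := by linarith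
    have h8 : (i' : ℝ) < D.fst b := by linarith
    rw [Int.cast_lt] at h7 h8
    omega
  · exfalso
    obtain ⟨⟨h1, h2⟩, h3⟩ := mem_hSegment.1 hp
    obtain ⟨⟨h4, h5⟩, h6⟩ := mem_hSegment.1 hq
    dsimp only at h1 h2 h3 h4 h5 h6
    have hrow : D.row a = D.row c := by rw [h3] at h6; exact_mod_cast h6
    have ha := D.fst_le_lst a
    have hb := D.fst_le_lst b
    have hc := D.fst_le_lst c
    have hd := D.fst_le_lst d
    unfold left right at *
    have h7 : (D.lst a : ℝ) < D.fst d := by linarith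
    have h8 : (D.lst c : ℝ) < D.fst b := by linarith
    rw [Int.cast_lt] at h7 h8
    have h9 : D.lst a = D.lst c := by omega
    have e1 := D.eq_of_mem a c (D.lst a) hrow ha le_rfl (by omega) (by omega)
    have e2 := D.eq_of_mem b d (D.fst b) (by omega) le_rfl hb (by omega) (by omega)
    exact hne (by rw [e1, e2])

/-- The flat visibility representation given by a drawing on the grid. -/
noncomputable def toRepresentation : FlatVisibilityRepresentation G where
  layer := D.row
  left := D.left
  right := D.right
  left_lt_right v := by
    have : (D.fst v : ℝ) ≤ D.lst v := Int.cast_le.2 (D.fst_le_lst v)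
    unfold left right
    linarith
  edgeSeg := D.edgeSeg
  edge_drawn e he := by
    obtain ⟨a, b, hab, h⟩ := D.edgeSeg_spec he
    refine ⟨a, b, hab, ?_⟩
    rcases h with ⟨hr, i, hi, hj, hw, h⟩ | ⟨hr, hl, h⟩
    · exact Or.inl ⟨hr, i, ⟨D.left_le_iff.2 hi.1, D.le_right_iff.2 hi.2⟩,
        ⟨D.left_le_iff.2 hj.1, D.le_right_iff.2 hj.2⟩, h⟩
    · refine Or.inr ⟨hr, ?_, h⟩
      unfold left right
      rw [← hl]
      push_cast
      linarith
  vertex_vertex a b hab := by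
    rw [Set.disjoint_left]
    rintro ⟨x, y⟩ hp hq
    obtain ⟨⟨h1, h2⟩, h3⟩ := D.mem_seg.1 hp
    obtain ⟨⟨h4, h5⟩, h6⟩ := D.mem_seg.1 hq
    dsimp only at h1 h2 h3 h4 h5 h6
    have hrow : D.row a = D.row b := by rw [h3] at h6; exact_mod_cast h6
    unfold left right at *
    rcases D.lt_or_lt hab hrow with h7 | h7
    · have : (D.lst a : ℝ) + 1 ≤ D.fst b := by exact_mod_cast h7
      linarith
    · have : (D.lst b : ℝ) + 1 ≤ D.fst a := by exact_mod_cast h7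
      linarith
  edge_vertex e he w hw := by
    obtain ⟨a, b, rfl, h⟩ := D.edgeSeg_spec he
    simp only [Sym2.mem_iff, not_or] at hw
    exact D.edge_vertex h hw.1 hw.2
  edge_edge e he f hf hef p hp := by
    obtain ⟨a, b, hab, h⟩ := D.edgeSeg_spec he
    obtain ⟨c, d, hcd, h'⟩ := D.edgeSeg_spec hf
    obtain ⟨w, h1, h2, h3⟩ := D.edge_edge h h' (hab ▸ hcd ▸ hef) hp.1 hp.2
    exact ⟨w, hab ▸ h1, hcd ▸ h2, h3⟩

theorem height_le : D.toRepresentation.height ≤ ((n + 1 : ℕ) : ℕ∞) := by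
  have h : {y : ℤ | ∃ x : ℝ, (x, (y : ℝ)) ∈ D.toRepresentation.support} ⊆
      (Finset.Icc (0 : ℤ) n : Set ℤ) := by
    rintro y ⟨x, hx⟩
    rw [Finset.coe_Icc, Set.mem_Icc]
    rcases hx with hx | hx
    · obtain ⟨v, hv⟩ := Set.mem_iUnion.1 hx
      have h1 : (y : ℝ) = D.row v := (D.mem_seg.1 hv).2
      rw [Int.cast_injective h1]
      exact D.row_mem v
    · simp only [Set.mem_iUnion] at hx
      obtain ⟨e, he, hx⟩ := hx
      obtain ⟨a, b, hab, h⟩ := D.edgeSeg_spec he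
      change (x, (y : ℝ)) ∈ D.edgeSeg e at hx
      rcases h with ⟨hr, i, hi, hj, hw, h⟩ | ⟨hr, hl, h⟩
      · rw [h] at hx
        have h1 : (D.row a : ℝ) ≤ y := (mem_vSegment.1 hx).2.1
        have h2 : (y : ℝ) ≤ D.row b := (mem_vSegment.1 hx).2.2
        rw [Int.cast_le] at h1 h2
        have := D.row_mem a
        have := D.row_mem b
        omega
      · rw [h] at hx
        have h1 : (y : ℝ) = D.row a := (mem_hSegment.1 hx).2
        rw [Int.cast_injective h1]
        exact D.row_mem a
  refine (Set.encard_le_encard h).trans ?_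
  rw [Set.encard_coe_eq_coe_finsetCard, Int.card_Icc]
  simp

end GridDrawing

theorem Bar.exists_interval {x : V} {L : List (Column V)} (h : Bar x L) :
    ∃ y l r : ℤ, 0 ≤ l ∧ l ≤ r ∧ r < L.length ∧ ∀ (i : ℕ) (hi : i < L.length) (k : ℤ),
      L[i] k = some x ↔ k = y ∧ l ≤ i ∧ (i : ℤ) ≤ r := by
  obtain ⟨y, A, B, C, rfl, hB, hA, hf, hC⟩ := h
  have := List.length_pos_iff.2 hB
  refine ⟨y, A.length, A.length + B.length - 1, by omega, by omega, by simp,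
    fun i hi k => ?_⟩
  rcases lt_or_ge i A.length with h1 | h1
  · rw [List.getElem_append_left (by simp; omega), List.getElem_append_left h1]
    have := hA A[i] (List.getElem_mem _) k
    constructor
    · intro h; contradiction
    · intro h; omega
  rcases lt_or_ge i (A.length + B.length) with h2 | h2
  · rw [List.getElem_append_left (by simpa using h2), List.getElem_append_right h1]
    rw [hf _ (List.getElem_mem _) k]
    constructor
    · intro h; omega
    · intro h; omega
  · rw [List.getElem_append_right (by simpa using h2)]
    simp only [List.length_append] at hi
    have := hC (C[i - (A ++ B).length]'(by simp; omega)) (List.getElem_mem _) k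
    constructor
    · intro h; contradiction
    · intro h; omega

/-- Column indices become abscissas, and bars become intervals of indices. Two vertices never share
a cell because a column is a function. -/
theorem exists_gridDrawing {G : SimpleGraph V} {n : ℕ} {L : List (Column V)} {X : Set V}
    (hw : Within 0 n X L) (hb : ∀ x, Bar x L) (hv : ∀ x y, G.Adj x y → Visible L x y) :
    Nonempty (GridDrawing G n) := by
  choose row l r hl hlr hr hx using fun x => (hb x).exists_interval
  have key : ∀ x (i : ℤ), l x ≤ i → i ≤ r x →
      ∃ (j : ℕ) (hj : j < L.length), i = j ∧ L[j] (row x) = some x := by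
    intro x i h1 h2
    have h3 := hl x
    have h4 := hr x
    lift i to ℕ using by omega
    have h5 : i < L.length := by omega
    exact ⟨i, h5, rfl, (hx x i h5 _).2 ⟨rfl, h1, h2⟩⟩
  refine ⟨⟨row, l, r, fun v => ?_, hlr, ?_, fun e he => ?_⟩⟩
  · obtain ⟨j, hj, -, h⟩ := key v (l v) le_rfl (hlr v)
    exact (hw _ (List.getElem_mem _) _ _ h).1
  · intro a b i hab h1 h2 h3 h4
    obtain ⟨j, hj, rfl, h⟩ := key a i h1 h2
    obtain ⟨j', hj', h5, h'⟩ := key b j h3 h4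
    have : j = j' := by exact_mod_cast h5
    subst this
    rw [hab, h'] at h
    exact (Option.some_injective _ h).symm
  · induction e with | _ x y =>
    rcases hv x y he with ⟨c, hc, i, j, hij, h1, h2⟩ | ⟨c, c', k, ⟨A, B, hL⟩, h⟩
    · obtain ⟨m, hm, rfl⟩ := List.mem_iff_getElem.1 hc
      have main : ∀ a b, L[m] i = some a → L[m] j = some b →
          row a < row b ∧ ∃ i, (l a ≤ i ∧ i ≤ r a) ∧ (l b ≤ i ∧ i ≤ r b) ∧
            ∀ w, row a < row w → row w < row b → ¬ (l w ≤ i ∧ i ≤ r w) := by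
        intro a b ha hb
        obtain ⟨rfl, ha'⟩ := (hx a m hm i).1 ha
        obtain ⟨rfl, hb'⟩ := (hx b m hm j).1 hb
        refine ⟨hij, m, ha', hb', fun w h3 h4 h5 => ?_⟩
        have := (hx w m hm (row w)).2 ⟨rfl, h5⟩
        rw [h2 _ h3 h4] at this
        exact absurd this (by simp)
      rcases h1 with h1 | h1
      · exact ⟨x, y, rfl, Or.inl (main x y h1.1 h1.2)⟩
      · exact ⟨y, x, Sym2.eq_swap, Or.inl (main y x h1.1 h1.2)⟩
    · subst hL
      -- Different vertices on one row in adjacent columns force the first bar to end and the second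
      -- to begin exactly at the seam.
      have main : ∀ a b, c k = some a → c' k = some b → a ≠ b → row a = row b ∧ r a + 1 = l b := by
        intro a b ha hb hab
        have ea := hx a A.length (by simp)
        have ea' := hx a (A.length + 1) (by simp)
        have eb := hx b A.length (by simp)
        have eb' := hx b (A.length + 1) (by simp)
        have g1 : (A ++ [c, c'] ++ B)[A.length]'(by simp) = c := by simp
        have g2 : (A ++ [c, c'] ++ B)[A.length + 1]'(by simp) = c' := by simp
        simp only [g1, g2, Nat.cast_add, Nat.cast_one] at ea ea' eb eb'
        obtain ⟨rfl, h3, h4⟩ := (ea k).1 ha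
        obtain ⟨h7, h5, h6⟩ := (eb' (row a)).1 hb
        refine ⟨h7, ?_⟩
        have h8 : ¬ ((A.length : ℤ) + 1 ≤ r a) := fun h8 => by
          have := (ea' (row a)).2 ⟨rfl, by omega, h8⟩
          rw [hb] at this
          exact hab (Option.some_injective _ this).symm
        have h9 : ¬ (l b ≤ (A.length : ℤ)) := fun h9 => by
          have := (eb (row a)).2 ⟨h7, h9, by omega⟩
          rw [ha] at this
          exact hab (Option.some_injective _ this)
        omega
      have hxy : x ≠ y := G.ne_of_adj he
      rcases h with h | h
      · exact ⟨x, y, rfl, Or.inr (main x y h.1 h.2 hxy)⟩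
      · exact ⟨y, x, Sym2.eq_swap, Or.inr (main y x h.1 h.2 hxy.symm)⟩

end Realization

/-! ### Outerplanar graphs on a linear order -/

section Order

variable {V : Type u} [LinearOrder V] {G : SimpleGraph V}

/-- No two edges alternate. -/
def NonCrossing (G : SimpleGraph V) : Prop :=
  ∀ a b c d, G.Adj a b → G.Adj c d → ¬ (a < c ∧ c < b ∧ b < d)

/-- Two elements of `X` are related by `r` unless their chord is crossed. -/
def Saturated (X : Set V) (r : V → V → Prop) : Prop :=
  ∀ x ∈ X, ∀ y ∈ X, x < y →
    (∀ c ∈ X, ∀ d ∈ X, r c d → x < c → c < y → x ≤ d ∧ d ≤ y) → r x y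

/-- Consecutive elements of `X` are related by `r`. -/
def Linked (X : Set V) (r : V → V → Prop) : Prop :=
  ∀ x ∈ X, ∀ y ∈ X, x < y → (∀ z ∈ X, ¬ (x < z ∧ z < y)) → r x y

/-- `x` lies strictly between `a` and `b`. -/
def Btw (a x b : V) : Prop := (a < x ∧ x < b) ∨ (b < x ∧ x < a)

/-- No element lies strictly between `a` and `b`. -/
def Consecutive (a b : V) : Prop := a ≠ b ∧ ∀ x, ¬ Btw a x b

/-- `w` lies strictly between `a` and `b` and is adjacent to both. -/
def Apex (G : SimpleGraph V) (a b w : V) : Prop := Btw a w b ∧ G.Adj a w ∧ G.Adj b w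

/-- The elements between `a` and `b`. -/
def region (a b : V) : Set V := {x | x = a ∨ x = b ∨ Btw a x b}

theorem NonCrossing.regions (nc : NonCrossing G) :
    Regions G.Adj Consecutive (Apex G) region where
  symm a b := by ext x; simp only [region, Btw, Set.mem_ofPred_eq]; tauto
  left_mem a b := by simp [region]
  leaf_ne a b h := h.1
  leaf a b h := by
    ext x
    have := h.2 x
    simp only [region, Set.mem_ofPred_eq, Set.mem_insert_iff, Set.mem_singleton_iff]
    tauto
  irrefl a := G.irrefl
  apex_symm a b w h := ⟨by have := h.1; unfold Btw at *; tauto, h.2.2, h.2.1⟩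
  union a b w h := by
    ext x
    have := h.1
    simp only [region, Btw, Set.mem_ofPred_eq, Set.mem_union] at *
    grind
  inter a b w x h h1 h2 := by
    have := h.1
    simp only [region, Btw, Set.mem_ofPred_eq] at *
    grind
  apex_ne a b w h := G.ne_of_adj h.2.1
  -- An edge joining the two sides of w would cross aw or wb, unless it is ab. All orientations of
  -- the chords are supplied.
  edge a b w x y h hx hy hxy := by
    obtain ⟨h1, h2, h3⟩ := h
    have n1 := nc _ _ _ _ h2 hxy
    have n2 := nc _ _ _ _ h2 hxy.symm
    have n3 := nc _ _ _ _ h3 hxy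
    have n4 := nc _ _ _ _ h3 hxy.symm
    have n5 := nc _ _ _ _ h2.symm hxy
    have n6 := nc _ _ _ _ h2.symm hxy.symm
    have n7 := nc _ _ _ _ h3.symm hxy
    have n8 := nc _ _ _ _ h3.symm hxy.symm
    have m1 := nc _ _ _ _ hxy h2
    have m2 := nc _ _ _ _ hxy.symm h2
    have m3 := nc _ _ _ _ hxy h3
    have m4 := nc _ _ _ _ hxy.symm h3
    have m5 := nc _ _ _ _ hxy h2.symm
    have m6 := nc _ _ _ _ hxy.symm h2.symm
    have m7 := nc _ _ _ _ hxy h3.symm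
    have m8 := nc _ _ _ _ hxy.symm h3.symm
    simp only [region, Btw, Set.mem_ofPred_eq] at *
    rcases hx with rfl | rfl | hx | hx <;> rcases hy with rfl | rfl | hy | hy <;> grind

theorem Saturated.linked {X : Set V} {r : V → V → Prop} (h : Saturated X r) : Linked X r :=
  fun x hx y hy hxy hn => h x hx y hy hxy fun c hc _ _ _ h1 h2 => (hn c hc ⟨h1, h2⟩).elim

theorem NonCrossing.isOuterplanar [Finite V] (nc : NonCrossing G) : IsOuterplanar G := by
  -- The number of smaller vertices serves as position on the circle.
  have hm : StrictMono fun x : V => (Set.Iio x).ncard := fun x y hxy =>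
    Set.ncard_lt_ncard ⟨Set.Iio_subset_Iio hxy.le, fun h => lt_irrefl x (h hxy)⟩
  refine ⟨_, hm.injective, fun a b c d hab hcd => ?_⟩
  rw [hm.lt_iff_lt, hm.lt_iff_lt, hm.lt_iff_lt]
  exact nc a b c d hab hcd

theorem NonCrossing.sup_edge (nc : NonCrossing G) {x y : V} (hxy : x < y)
    (h : ∀ c d, G.Adj c d → x < c → c < y → x ≤ d ∧ d ≤ y) :
    NonCrossing (G ⊔ SimpleGraph.edge x y) := by
  intro a b c d hab hcd
  rw [SimpleGraph.sup_adj, SimpleGraph.edge_adj] at hab hcd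
  rcases hab with hab | hab <;> rcases hcd with hcd | hcd
  · exact nc a b c d hab hcd
  · have := h b a hab.symm
    grind
  · have := h c d hcd
    grind
  · grind

/-- An uncrossed chord can be added without creating a crossing, so maximality puts it into the
graph already. -/
theorem saturated_of_maximal (nc : NonCrossing G)
    (h : ∀ K : SimpleGraph V, NonCrossing K → G ≤ K → K ≤ G) : Saturated Set.univ G.Adj := by
  intro x _ y _ hxy hc
  refine h _ (nc.sup_edge hxy fun c d hcd => hc c trivial d trivial hcd) le_sup_left ?_
  rw [SimpleGraph.sup_adj, SimpleGraph.edge_adj]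
  exact Or.inr ⟨Or.inl ⟨rfl, rfl⟩, hxy.ne⟩

theorem NonCrossing.coe (nc : NonCrossing G) (P : G.Subgraph) : NonCrossing P.coe :=
  fun a b c d hab hcd h => nc a b c d hab.adj_sub hcd.adj_sub h

theorem IsMaximalOuterplanar.saturated_coe [Finite V] (nc : NonCrossing G) {P : G.Subgraph}
    (h : IsMaximalOuterplanar P.coe) : Saturated P.verts P.Adj := by
  have := saturated_of_maximal (nc.coe P) fun K hK hle => h.2.2 hK.isOuterplanar hle
  intro x hx y hy hxy hc
  exact this ⟨x, hx⟩ trivial ⟨y, hy⟩ trivial hxy fun c _ d _ => hc c c.2 d d.2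

/-- No edge of `P` crosses an edge of `G`, so a saturated `P` is an induced subgraph. -/
theorem adj_of_saturated (nc : NonCrossing G) {P : G.Subgraph} (h : Saturated P.verts P.Adj)
    {x y : V} (hx : x ∈ P.verts) (hy : y ∈ P.verts) (hxy : G.Adj x y) : P.Adj x y := by
  have main : ∀ x y, x ∈ P.verts → y ∈ P.verts → G.Adj x y → x < y → P.Adj x y := by
    intro x y hx hy hxy hlt
    refine h x hx y hy hlt fun c _ d _ hcd h1 h2 => ⟨?_, ?_⟩
    · by_contra h3
      exact nc d c x y hcd.adj_sub.symm hxy ⟨not_le.1 h3, h1, h2⟩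
    · by_contra h3
      exact nc x y c d hxy hcd.adj_sub ⟨h1, h2, not_le.1 h3⟩
  rcases lt_or_gt_of_ne hxy.ne with h1 | h1
  exacts [main x y hx hy hxy h1, (main y x hy hx hxy.symm h1).symm]

/-- The apex is the greatest neighbour z of a below b; one exists since a is linked to the next
vertex of `P`. An edge crossing zb would cross az or ab, or come from a and contradict the choice of
z. -/
theorem exists_apex [Finite V] (nc : NonCrossing G) {P : G.Subgraph}
    (hs : Saturated P.verts P.Adj) {a b : V} (h : P.Adj a b) {x : V} (hx : x ∈ P.verts)
    (hax : a < x) (hxb : x < b) : ∃ z, a < z ∧ z < b ∧ P.Adj a z ∧ P.Adj z b := by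
  obtain ⟨s, ⟨hs1, hs2⟩, hs3⟩ := Set.exists_min_image {s | s ∈ P.verts ∧ a < s} id
    (Set.toFinite _) ⟨x, hx, hax⟩
  have has : P.Adj a s := hs.linked a h.fst_mem s hs1 hs2 fun z hz hz' =>
    not_lt_of_ge (hs3 z ⟨hz, hz'.1⟩) hz'.2
  obtain ⟨z, ⟨hz1, hz2, hz3⟩, hz4⟩ := Set.exists_max_image {z | P.Adj a z ∧ a < z ∧ z < b} id
    (Set.toFinite _) ⟨s, has, hs2, (hs3 x ⟨hx, hax⟩).trans_lt hxb⟩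
  refine ⟨z, hz2, hz3, hz1, hs z hz1.snd_mem b h.snd_mem hz3 fun c _ d _ hcd h1 h2 => ⟨?_, ?_⟩⟩
  · by_contra! h3
    rcases lt_trichotomy d a with h4 | h4 | h4
    · exact nc d c a b hcd.adj_sub.symm h.adj_sub ⟨h4, hz2.trans h1, h2⟩
    · subst h4
      exact not_lt_of_ge (hz4 c ⟨hcd.symm, hz2.trans h1, h2⟩) h1
    · exact nc a z d c hz1.adj_sub hcd.adj_sub.symm ⟨h4, h3, h1⟩
  · by_contra! h3
    exact nc a b c d h.adj_sub hcd.adj_sub ⟨hz2.trans h1, h2, h3⟩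

theorem apex_unique (nc : NonCrossing G) {a b z t : V} (hz : Apex G a b z) (ht : Apex G a b t) :
    z = t := by
  obtain ⟨h1, h2, h3⟩ := hz
  obtain ⟨k1, k2, k3⟩ := ht
  have n1 := nc _ _ _ _ h2 k3.symm
  have n2 := nc _ _ _ _ k2 h3.symm
  have n3 := nc _ _ _ _ h3 k2.symm
  have n4 := nc _ _ _ _ k3 h2.symm
  unfold Btw at *
  grind

/-- On the circle, the vertices outside the interval form the other side of the chord ab. Two common
neighbours there give crossing edges, just as inside. -/
theorem outer_apex_unique (nc : NonCrossing G) {a b z t : V} (hz : ¬ Btw a z b) (ht : ¬ Btw a t b)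
    (h1 : G.Adj a z) (h2 : G.Adj b z) (h3 : G.Adj a t) (h4 : G.Adj b t) (hab : a ≠ b) : z = t := by
  have a1 := h1.ne
  have a2 := h2.ne
  have a3 := h3.ne
  have a4 := h4.ne
  have n1 := nc _ _ _ _ h1 h4
  have n2 := nc _ _ _ _ h1 h4.symm
  have n3 := nc _ _ _ _ h1.symm h4
  have n4 := nc _ _ _ _ h1.symm h4.symm
  have n5 := nc _ _ _ _ h4 h1
  have n6 := nc _ _ _ _ h4 h1.symm
  have n7 := nc _ _ _ _ h4.symm h1
  have n8 := nc _ _ _ _ h4.symm h1.symm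
  have m1 := nc _ _ _ _ h3 h2
  have m2 := nc _ _ _ _ h3 h2.symm
  have m3 := nc _ _ _ _ h3.symm h2
  have m4 := nc _ _ _ _ h3.symm h2.symm
  have m5 := nc _ _ _ _ h2 h3
  have m6 := nc _ _ _ _ h2 h3.symm
  have m7 := nc _ _ _ _ h2.symm h3
  have m8 := nc _ _ _ _ h2.symm h3.symm
  unfold Btw at *
  grind

end Order

/-! ### Counting edges -/

section Count

variable {V : Type u} [LinearOrder V] {G : SimpleGraph V}

/-- The edges with both ends between `a` and `b`. -/
def edgesBetween (G : SimpleGraph V) (a b : V) : Set (Sym2 V) :=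
  {e | e ∈ G.edgeSet ∧ ∀ x ∈ e, a ≤ x ∧ x ≤ b}

theorem mem_edgesBetween {a b x y : V} :
    s(x, y) ∈ edgesBetween G a b ↔ G.Adj x y ∧ (a ≤ x ∧ x ≤ b) ∧ (a ≤ y ∧ y ≤ b) := by
  simp [edgesBetween]

/-- A triangulated polygon with k vertices has 2k - 3 edges. The apex z of ab splits the interval
into two that share only z, and (2k₁ - 3) + (2k₂ - 3) + 1 = 2k - 3 when k₁ + k₂ = k + 1. -/
theorem ncard_edgesBetween [Finite V] (nc : NonCrossing G) (hs : Saturated Set.univ G.Adj) (n : ℕ) :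
    ∀ a b, G.Adj a b → a < b → (Set.Icc a b).ncard ≤ n →
      (edgesBetween G a b).ncard + 3 = 2 * (Set.Icc a b).ncard := by
  induction n with
  | zero =>
    intro a b _ hab h
    have : 0 < (Set.Icc a b).ncard := (Set.ncard_pos (Set.toFinite _)).2 ⟨a, le_rfl, hab.le⟩
    omega
  | succ n ih =>
    intro a b hadj hab h
    by_cases hx : ∃ x, a < x ∧ x < b
    · obtain ⟨x, h1, h2⟩ := hx
      obtain ⟨z, h3, h4, h5, h6⟩ := exists_apex nc (P := ⊤) hs hadj trivial h1 h2
      change G.Adj a z at h5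
      change G.Adj z b at h6
      have e1 : Set.Icc a b = Set.Icc a z ∪ Set.Ioc z b :=
        (Set.Icc_union_Ioc_eq_Icc h3.le h4.le).symm
      have e2 : Set.Icc z b = insert z (Set.Ioc z b) := by
        ext y; simp only [Set.mem_Icc, Set.mem_insert_iff, Set.mem_Ioc]; grind
      have c1 : (Set.Icc a b).ncard = (Set.Icc a z).ncard + (Set.Ioc z b).ncard := by
        rw [e1]
        refine Set.ncard_union_eq (Set.disjoint_left.2 fun y h7 h8 => ?_)
        exact not_lt_of_ge h7.2 h8.1
      have c2 : (Set.Icc z b).ncard = (Set.Ioc z b).ncard + 1 := by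
        rw [e2]; exact Set.ncard_insert_of_notMem (by simp)
      have c3 : 0 < (Set.Ioc z b).ncard := (Set.ncard_pos (Set.toFinite _)).2 ⟨b, h4, le_rfl⟩
      have c4 : 1 < (Set.Icc a z).ncard := by
        rw [Set.one_lt_ncard]
        exact ⟨a, ⟨le_rfl, h3.le⟩, z, ⟨h3.le, le_rfl⟩, h3.ne⟩
      have i1 := ih a z h5 h3 (by omega)
      have i2 := ih z b h6 h4 (by omega)
      have e3 : edgesBetween G a b =
          insert s(a, b) (edgesBetween G a z ∪ edgesBetween G z b) := by
        ext e
        induction e with | _ p q =>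
        simp only [Set.mem_insert_iff, Set.mem_union, mem_edgesBetween, Sym2.eq_iff]
        constructor
        · rintro ⟨hpq, hp, hq⟩
          rcases nc.regions.edge a b z p q ⟨Or.inl ⟨h3, h4⟩, h5, h6.symm⟩
            (by simp only [region, Btw, Set.mem_ofPred_eq]; grind)
            (by simp only [region, Btw, Set.mem_ofPred_eq]; grind) hpq with h7 | h7 | h7 | h7
          · simp only [region, Btw, Set.mem_ofPred_eq] at h7
            grind
          · simp only [region, Btw, Set.mem_ofPred_eq] at h7
            grind
          · exact Or.inl (Or.inl h7)
          · exact Or.inl (Or.inr h7)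
        · rintro ((⟨rfl, rfl⟩ | ⟨rfl, rfl⟩) | ⟨hpq, hp, hq⟩ | ⟨hpq, hp, hq⟩)
          · exact ⟨hadj, ⟨le_rfl, hab.le⟩, ⟨hab.le, le_rfl⟩⟩
          · exact ⟨hadj.symm, ⟨hab.le, le_rfl⟩, ⟨le_rfl, hab.le⟩⟩
          · exact ⟨hpq, ⟨hp.1, hp.2.trans h4.le⟩, ⟨hq.1, hq.2.trans h4.le⟩⟩
          · exact ⟨hpq, ⟨h3.le.trans hp.1, hp.2⟩, ⟨h3.le.trans hq.1, hq.2⟩⟩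
      have c5 : (edgesBetween G a b).ncard =
          (edgesBetween G a z).ncard + (edgesBetween G z b).ncard + 1 := by
        rw [e3, Set.ncard_insert_of_notMem, Set.ncard_union_eq]
        · rw [Set.disjoint_left]
          intro e
          induction e with | _ p q =>
          rw [mem_edgesBetween, mem_edgesBetween]
          rintro ⟨hpq, hp, hq⟩ ⟨-, hp', hq'⟩
          exact hpq.ne ((le_antisymm hp.2 hp'.1).trans (le_antisymm hq.2 hq'.1).symm)
        · rw [Set.mem_union, mem_edgesBetween, mem_edgesBetween]
          rintro (⟨-, -, h7⟩ | ⟨-, h7, -⟩)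
          · exact not_lt_of_ge h7.2 h4
          · exact not_lt_of_ge h7.1 h3
      omega
    · have e1 : Set.Icc a b = {a, b} := by
        ext y
        have : y ≤ a ∨ b ≤ y := by
          by_contra! h1
          exact hx ⟨y, h1⟩
        simp only [Set.mem_Icc, Set.mem_insert_iff, Set.mem_singleton_iff]
        clear ih
        grind
      have e2 : edgesBetween G a b = {s(a, b)} := by
        ext e
        induction e with | _ p q =>
        rw [mem_edgesBetween, ← Set.mem_Icc, ← Set.mem_Icc, e1]
        simp only [Set.mem_insert_iff, Set.mem_singleton_iff, Sym2.eq_iff]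
        constructor
        · rintro ⟨hpq, hp, hq⟩
          have := hpq.ne
          grind
        · rintro (⟨rfl, rfl⟩ | ⟨rfl, rfl⟩)
          · simp [hadj]
          · simp [hadj.symm]
      rw [e1, e2, Set.ncard_singleton, Set.ncard_pair hab.ne]

theorem ncard_edgeSet [Finite V] (nc : NonCrossing G) (hs : Saturated Set.univ G.Adj)
    (hV : 2 ≤ Nat.card V) : G.edgeSet.ncard + 3 = 2 * Nat.card V := by
  have : Nontrivial V := Finite.one_lt_card_iff_nontrivial.1 hV
  obtain ⟨a, ha⟩ := Finite.exists_min (id : V → V)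
  obtain ⟨b, hb⟩ := Finite.exists_max (id : V → V)
  have hab : a < b := by
    refine lt_of_le_of_ne (ha b) fun h => ?_
    obtain ⟨x, y, hxy⟩ := exists_pair_ne V
    exact hxy ((le_antisymm ((hb x).trans h.ge) (ha x)).trans
      (le_antisymm ((hb y).trans h.ge) (ha y)).symm)
  have h1 := ncard_edgesBetween nc hs _ a b
    (hs a trivial b trivial hab fun _ _ d _ _ _ _ => ⟨ha d, hb d⟩) hab le_rfl
  have h2 : Set.Icc a b = Set.univ := Set.eq_univ_of_forall fun x => ⟨ha x, hb x⟩
  have h3 : edgesBetween G a b = G.edgeSet := by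
    ext e
    exact ⟨fun h => h.1, fun h => ⟨h, fun x _ => ⟨ha x, hb x⟩⟩⟩
  rwa [h2, h3, Set.ncard_univ] at h1

end Count

/-! ### Saturated graphs are maximal outerplanar -/

theorem exists_saturated {V : Type u} [LinearOrder V] [Finite V] {G : SimpleGraph V}
    (nc : NonCrossing G) : ∃ K, G ≤ K ∧ NonCrossing K ∧ Saturated Set.univ K.Adj := by
  obtain ⟨K, hK, hm⟩ := (Set.toFinite {K : SimpleGraph V | NonCrossing K}).exists_le_maximal nc
  exact ⟨K, hK, hm.1, saturated_of_maximal hm.1 fun K' h1 h2 => hm.2 h1 h2⟩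

/-- A larger outerplanar graph may need a different order of the circle, so saturation cannot be
compared directly. Saturating that graph in its own order yields a supergraph of `G` with 2n - 3
edges, as many as `G` has, hence equality. -/
theorem isMaximalOuterplanar_of_saturated {V : Type u} [LinearOrder V] [Finite V]
    {G : SimpleGraph V} (nc : NonCrossing G) (hs : Saturated Set.univ G.Adj)
    (hV : 3 ≤ Nat.card V) : IsMaximalOuterplanar G := by
  refine ⟨hV, nc.isOuterplanar, fun K hK hle => ?_⟩
  obtain ⟨pos, hpos, hc⟩ := hK
  have h1 : ∃ K', K ≤ K' ∧ K'.edgeSet.ncard + 3 = 2 * Nat.card V := by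
    let _ : LinearOrder V := LinearOrder.lift' pos hpos
    obtain ⟨K', h1, h2, h3⟩ := exists_saturated (G := K) hc
    exact ⟨K', h1, ncard_edgeSet h2 h3 (by omega)⟩
  obtain ⟨K', h2, h3⟩ := h1
  have h4 := ncard_edgeSet nc hs (by omega)
  have h5 : G.edgeSet = K'.edgeSet :=
    Set.eq_of_subset_of_ncard_le (SimpleGraph.edgeSet_mono (hle.trans h2)) (by omega)
  rw [SimpleGraph.edgeSet_inj] at h5
  exact h5 ▸ h2

theorem isMaximalOuterplanar_coe {V : Type u} [LinearOrder V] [Finite V] {G : SimpleGraph V}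
    (nc : NonCrossing G) {P : G.Subgraph} (hs : Saturated P.verts P.Adj)
    (hP : 3 ≤ P.verts.ncard) : IsMaximalOuterplanar P.coe := by
  refine isMaximalOuterplanar_of_saturated (nc.coe P) ?_ (by rwa [Nat.card_coe_set_eq])
  intro x _ y _ hxy hc
  refine hs x x.2 y y.2 hxy fun c hcP d hdP => ?_
  exact hc ⟨c, hcP⟩ trivial ⟨d, hdP⟩ trivial

/-! ### Cutting edges and regions -/

section Cutting

variable {V : Type u} [LinearOrder V] [Finite V] {G : SimpleGraph V}

/-- Induction on the number of elements between x and y. It replaces walks along the boundary: a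
property passed between consecutive vertices is constant on an interval. -/
theorem iff_of_consecutive {X I : Set V} {Q : V → Prop}
    (hI : ∀ x ∈ I, ∀ y ∈ I, ∀ z ∈ X, x < z → z < y → z ∈ I)
    (hQ : ∀ x ∈ I, ∀ y ∈ I, x < y → (∀ z ∈ X, ¬ (x < z ∧ z < y)) → (Q x ↔ Q y))
    {x y : V} (hx : x ∈ I) (hy : y ∈ I) : Q x ↔ Q y := by
  have main : ∀ n : ℕ, ∀ x ∈ I, ∀ y ∈ I, x < y → (Set.Ioo x y).ncard < n → (Q x ↔ Q y) := by
    intro n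
    induction n with
    | zero => intro x _ y _ _ h; omega
    | succ n ih =>
      intro x hx y hy hxy hn
      by_cases h : ∃ z ∈ X, x < z ∧ z < y
      · obtain ⟨z, hz, h1, h2⟩ := h
        have hzI := hI x hx y hy z hz h1 h2
        have l1 : (Set.Ioo x z).ncard < (Set.Ioo x y).ncard := Set.ncard_lt_ncard
          ⟨Set.Ioo_subset_Ioo_right h2.le, fun h3 => lt_irrefl z (h3 (show z ∈ _ from ⟨h1, h2⟩)).2⟩
        have l2 : (Set.Ioo z y).ncard < (Set.Ioo x y).ncard := Set.ncard_lt_ncard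
          ⟨Set.Ioo_subset_Ioo_left h1.le, fun h3 => lt_irrefl z (h3 (show z ∈ _ from ⟨h1, h2⟩)).1⟩
        exact (ih x hx z hzI h1 (by omega)).trans (ih z hzI y hy h2 (by omega))
      · push Not at h
        exact hQ x hx y hy hxy fun z hz hz' => not_lt_of_ge (h z hz hz'.1) hz'.2
  rcases lt_trichotomy x y with h | rfl | h
  exacts [main _ x hx y hy h (Nat.lt_succ_self _), Iff.rfl,
    (main _ y hy x hx h (Nat.lt_succ_self _)).symm]

/-- The graph that remains of `H` when the ends of `e` are deleted. -/
abbrev remainder (H : G.Subgraph) (e : Sym2 V) : SimpleGraph (H.deleteVerts {x | x ∈ e}).verts :=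
  (H.deleteVerts {x | x ∈ e}).coe

theorem remainder_reachable_of_interval {H : G.Subgraph} {e : Sym2 V}
    (hl : Linked H.verts H.Adj) {I : Set V} (hIX : I ⊆ H.verts) (hIe : ∀ x ∈ I, x ∉ e)
    (hI : ∀ x ∈ I, ∀ y ∈ I, ∀ z ∈ H.verts, x < z → z < y → z ∈ I)
    {p q : (H.deleteVerts {x | x ∈ e}).verts} (hp : p.1 ∈ I) (hq : q.1 ∈ I) :
    (remainder H e).Reachable p q := by
  have := iff_of_consecutive (Q := fun z => ∀ hz, (remainder H e).Reachable p ⟨z, hz⟩) hI ?_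
    hp hq
  · exact this.1 (fun _ => SimpleGraph.Reachable.refl _) q.2
  · intro x hx y hy hxy hn
    have hx' : x ∈ (H.deleteVerts {x | x ∈ e}).verts := ⟨hIX hx, hIe x hx⟩
    have hy' : y ∈ (H.deleteVerts {x | x ∈ e}).verts := ⟨hIX hy, hIe y hy⟩
    have hadj : (remainder H e).Adj ⟨x, hx'⟩ ⟨y, hy'⟩ := by
      rw [SimpleGraph.Subgraph.coe_adj, SimpleGraph.Subgraph.deleteVerts_adj]
      exact ⟨hx'.1, hx'.2, hy'.1, hy'.2, hl x hx'.1 y hy'.1 hxy hn⟩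
    exact ⟨fun h _ => (h hx').trans hadj.reachable, fun h _ => (h hy').trans hadj.symm.reachable⟩

/-- Deleting two consecutive vertices leaves the boundary paths before x and after y. If neither is
empty, the edge ab joins them. -/
theorem not_isCuttingEdge_of_consecutive {H : G.Subgraph} (hl : Linked H.verts H.Adj)
    {a b x y : V} (hab : H.Adj a b) (hb : ∀ z ∈ H.verts, a ≤ z ∧ z ≤ b) (hxy : x < y)
    (hx : x ∈ H.verts) (hy : y ∈ H.verts)
    (hn : ∀ z ∈ H.verts, ¬ (x < z ∧ z < y)) : ¬ IsCuttingEdge H s(x, y) := by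
  rintro ⟨-, hc⟩
  refine hc ?_
  have side : ∀ z ∈ (H.deleteVerts {z | z ∈ s(x, y)}).verts,
      (z ∈ H.verts ∧ z < x) ∨ (z ∈ H.verts ∧ y < z) := by
    rintro z ⟨hz, hz'⟩
    have := hn z hz
    simp only [Set.mem_ofPred_eq, Sym2.mem_iff, not_or] at hz'
    grind
  have left : ∀ p q : (H.deleteVerts {z | z ∈ s(x, y)}).verts, p.1 < x → q.1 < x →
      (remainder H s(x, y)).Reachable p q := fun p q hp hq =>
    remainder_reachable_of_interval hl (I := {z | z ∈ H.verts ∧ z < x}) (fun z hz => hz.1)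
      (fun z hz h => by
        have h2 : z < x := hz.2
        rcases Sym2.mem_iff.1 h with rfl | rfl
        exacts [lt_irrefl _ h2, lt_asymm h2 hxy])
      (fun p _ q hq z hz _ h => ⟨hz, h.trans hq.2⟩) ⟨p.2.1, hp⟩ ⟨q.2.1, hq⟩
  have right : ∀ p q : (H.deleteVerts {z | z ∈ s(x, y)}).verts, y < p.1 → y < q.1 →
      (remainder H s(x, y)).Reachable p q := fun p q hp hq =>
    remainder_reachable_of_interval hl (I := {z | z ∈ H.verts ∧ y < z}) (fun z hz => hz.1)
      (fun z hz h => by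
        have h2 : y < z := hz.2
        rcases Sym2.mem_iff.1 h with rfl | rfl
        exacts [lt_asymm h2 hxy, lt_irrefl _ h2])
      (fun p hp q _ z hz h _ => ⟨hz, hp.2.trans h⟩) ⟨p.2.1, hp⟩ ⟨q.2.1, hq⟩
  have mixed : ∀ p q : (H.deleteVerts {z | z ∈ s(x, y)}).verts, p.1 < x → y < q.1 →
      (remainder H s(x, y)).Reachable p q := by
    intro p q hp hq
    have ha : a < x := (hb p p.2.1).1.trans_lt hp
    have hb' : y < b := hq.trans_le (hb q q.2.1).2
    have ha' : a ∈ (H.deleteVerts {z | z ∈ s(x, y)}).verts := by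
      refine ⟨hab.fst_mem, fun h => ?_⟩
      rcases Sym2.mem_iff.1 h with rfl | rfl
      exacts [lt_irrefl _ ha, lt_asymm ha hxy]
    have hb'' : b ∈ (H.deleteVerts {z | z ∈ s(x, y)}).verts := by
      refine ⟨hab.snd_mem, fun h => ?_⟩
      rcases Sym2.mem_iff.1 h with rfl | rfl
      exacts [lt_asymm hb' hxy, lt_irrefl _ hb']
    refine (left p ⟨a, ha'⟩ hp ha).trans (SimpleGraph.Reachable.trans ?_ (right ⟨b, hb''⟩ q hb' hq))
    refine SimpleGraph.Adj.reachable ?_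
    rw [SimpleGraph.Subgraph.coe_adj, SimpleGraph.Subgraph.deleteVerts_adj]
    exact ⟨ha'.1, ha'.2, hb''.1, hb''.2, hab⟩
  intro p q
  rcases side p p.2 with ⟨-, hp⟩ | ⟨-, hp⟩ <;> rcases side q q.2 with ⟨-, hq⟩ | ⟨-, hq⟩
  exacts [left p q hp hq, mixed p q hp hq, (mixed q p hq hp).symm, right p q hp hq]

/-- Without the two extreme vertices a single boundary path remains. -/
theorem not_isCuttingEdge_extreme {H : G.Subgraph} (hl : Linked H.verts H.Adj)
    {a b : V} (hb : ∀ z ∈ H.verts, a ≤ z ∧ z ≤ b) : ¬ IsCuttingEdge H s(a, b) := by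
  rintro ⟨-, hc⟩
  refine hc ?_
  have side : ∀ z ∈ (H.deleteVerts {z | z ∈ s(a, b)}).verts, z ∈ {z | z ∈ H.verts ∧ a < z ∧ z < b} := by
    rintro z ⟨hz, hz'⟩
    have := hb z hz
    simp only [Set.mem_ofPred_eq, Sym2.mem_iff, not_or] at hz' ⊢
    grind
  intro p q
  refine remainder_reachable_of_interval hl (I := {z | z ∈ H.verts ∧ a < z ∧ z < b})
      (fun z hz => hz.1) (fun z hz h => ?_)
      (fun p hp q hq z hz h h' => ⟨hz, hp.2.1.trans h, h'.trans hq.2.2⟩) (side p p.2) (side q q.2)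
  have h1 : a < z := hz.2.1
  have h2 : z < b := hz.2.2
  rcases Sym2.mem_iff.1 h with rfl | rfl
  exacts [lt_irrefl _ h1, lt_irrefl _ h2]

omit [Finite V] in
-- An edge that avoids x and y cannot leave the open interval between them without crossing xy, so z
-- is separated from t.
theorem isCuttingEdge_of_separates (nc : NonCrossing G) {H : G.Subgraph} {x y z t : V}
    (h : H.Adj x y) (hz : z ∈ H.verts) (hxz : x < z) (hzy : z < y) (ht : t ∈ H.verts)
    (ht' : t < x ∨ y < t) : IsCuttingEdge H s(x, y) := by
  refine ⟨h, fun hc => ?_⟩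
  have hxy := hxz.trans hzy
  have hz' : z ∈ (H.deleteVerts {z | z ∈ s(x, y)}).verts := by
    refine ⟨hz, fun h => ?_⟩
    rcases Sym2.mem_iff.1 h with rfl | rfl
    exacts [lt_irrefl _ hxz, lt_irrefl _ hzy]
  have htd : t ∈ (H.deleteVerts {z | z ∈ s(x, y)}).verts := by
    refine ⟨ht, fun h => ?_⟩
    rcases Sym2.mem_iff.1 h with rfl | rfl
    · exact ht'.elim (lt_irrefl _) (lt_asymm hxy)
    · exact ht'.elim (lt_asymm hxy) (lt_irrefl _)
  have key : ∀ p q, (remainder H s(x, y)).Reachable p q → x < p.1 ∧ p.1 < y →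
      x < q.1 ∧ q.1 < y := by
    intro p q hpq
    rw [SimpleGraph.reachable_iff_reflTransGen] at hpq
    induction hpq with
    | refl => exact id
    | @tail p q _ hpq ih =>
      intro hp
      have hp' := ih hp
      have hpq : (H.deleteVerts {z | z ∈ s(x, y)}).Adj p.1 q.1 := hpq
      have hpq' : G.Adj p.1 q.1 := hpq.adj_sub
      have n1 := nc _ _ _ _ h.adj_sub hpq'
      have n2 := nc _ _ _ _ hpq'.symm h.adj_sub
      have hq := q.2.2
      simp only [Set.mem_ofPred_eq, Sym2.mem_iff, not_or] at hq
      grind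
  have := key ⟨z, hz'⟩ ⟨t, htd⟩ (hc _ _) ⟨hxz, hzy⟩
  exact ht'.elim (lt_asymm this.1) (lt_asymm this.2)

/-- The subgraph induced on the vertices between `a` and `b`. -/
def segment (G : SimpleGraph V) (a b : V) : G.Subgraph := (⊤ : G.Subgraph).induce (Set.Icc a b)

omit [Finite V] in
theorem mem_segment_verts {a b x : V} : x ∈ (segment G a b).verts ↔ a ≤ x ∧ x ≤ b := Iff.rfl

/-- Consecutive vertices are adjacent, and the edge between them lies in S or in T, which share only
x and y. Hence membership in S is constant before x, between x and y, and after y. The root lies in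
T, which excludes the two outer intervals, and the third vertex of S forces the inner one. -/
theorem eq_segment_of_areCutComponents (nc : NonCrossing G) (hs : Saturated Set.univ G.Adj)
    {a b x y : V} (hab : a < b) (hadj : G.Adj a b) (hxy : x < y) {S T : G.Subgraph}
    (h : AreCutComponents (segment G a b) s(x, y) S T) (he : s(a, b) ∉ S.edgeSet) :
    S = segment G x y := by
  have hS := h.left_maximalOuterplanar.saturated_coe nc
  have hxyS : S.Adj x y := by
    have : s(x, y) ∈ (S ⊓ T).edgeSet := by rw [h.inf_edgeSet]; rfl
    exact this.1
  have hinf : ∀ z, z ∈ S.verts → z ∈ T.verts → z = x ∨ z = y := fun z h1 h2 => by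
    have : z ∈ (S ⊓ T).verts := ⟨h1, h2⟩
    rw [h.inf_verts] at this
    exact Sym2.mem_iff.1 this
  have hadj' : ∀ p q, (segment G a b).Adj p q → S.Adj p q ∨ T.Adj p q := fun p q hpq => by
    rw [← h.sup_eq] at hpq; exact hpq
  have hle : S ≤ segment G a b := h.sup_eq ▸ le_sup_left
  have hQ : ∀ p q, (segment G a b).Adj p q → (p ≠ x ∧ p ≠ y) → (q ≠ x ∧ q ≠ y) →
      (p ∈ S.verts ↔ q ∈ S.verts) := by
    intro p q hpq hp hq
    rcases hadj' p q hpq with h1 | h1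
    · exact ⟨fun _ => h1.snd_mem, fun _ => h1.fst_mem⟩
    · constructor
      · intro h2
        have := hinf p h2 h1.fst_mem
        tauto
      · intro h2
        have := hinf q h2 h1.snd_mem
        tauto
  have hxab := hle.1 hxyS.fst_mem
  have hyab := hle.1 hxyS.snd_mem
  rw [mem_segment_verts] at hxab hyab
  have hne : ¬ (x = a ∧ y = b) := by
    rintro ⟨rfl, rfl⟩
    exact he hxyS
  have hT : T.Adj a b :=
    (hadj' a b ⟨⟨le_rfl, hab.le⟩, ⟨hab.le, le_rfl⟩, hadj⟩).resolve_left he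
  have hconst : ∀ I : Set V, (∀ z ∈ I, (a ≤ z ∧ z ≤ b) ∧ z ≠ x ∧ z ≠ y) →
      (∀ p ∈ I, ∀ q ∈ I, ∀ z, p < z → z < q → z ∈ I) → ∀ p ∈ I, ∀ q ∈ I,
      (p ∈ S.verts ↔ q ∈ S.verts) := by
    intro I hI hI' p hp q hq
    refine iff_of_consecutive (X := Set.univ)
      (fun p hp q hq z _ => hI' p hp q hq z) ?_ hp hq
    intro p hp q hq hpq hn
    exact hQ p q ⟨(hI p hp).1, (hI q hq).1, hs.linked p trivial q trivial hpq hn⟩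
      (hI p hp).2 (hI q hq).2
  have hsub : ∀ z ∈ S.verts, x ≤ z ∧ z ≤ y := by
    intro z hz
    have hz' := hle.1 hz
    rw [mem_segment_verts] at hz'
    constructor
    · by_contra! h1
      have := (hconst {p | a ≤ p ∧ p < x} (fun p hp => ?_) (fun p hp q hq r h2 h3 => ?_)
        z ⟨hz'.1, h1⟩ a ⟨le_rfl, hz'.1.trans_lt h1⟩).1 hz
      · have := hinf a this hT.fst_mem
        grind
      · simp only [Set.mem_ofPred_eq] at hp
        grind
      · exact ⟨hp.1.trans h2.le, h3.trans hq.2⟩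
    · by_contra! h1
      have := (hconst {p | y < p ∧ p ≤ b} (fun p hp => ?_) (fun p hp q hq r h2 h3 => ?_)
        z ⟨h1, hz'.2⟩ b ⟨h1.trans_le hz'.2, le_rfl⟩).1 hz
      · have := hinf b this hT.snd_mem
        grind
      · simp only [Set.mem_ofPred_eq] at hp
        grind
      · exact ⟨hp.1.trans h2, h3.le.trans hq.2⟩
  have hex : ∃ s ∈ S.verts, x < s ∧ s < y := by
    by_contra! h1
    have h2 : S.verts ⊆ {x, y} := fun z hz => by
      rcases (hsub z hz).1.eq_or_lt with rfl | h3
      · exact Or.inl rfl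
      · exact Or.inr (le_antisymm (hsub z hz).2 (h1 z hz h3))
    have h3 := Set.ncard_le_ncard h2
    have h4 : 3 ≤ Nat.card S.verts := h.left_maximalOuterplanar.1
    rw [Set.ncard_pair hxy.ne] at h3
    rw [Nat.card_coe_set_eq] at h4
    omega
  obtain ⟨s, hsS, hxs, hsy⟩ := hex
  have hverts : S.verts = Set.Icc x y := by
    ext z
    refine ⟨hsub z, fun hz => ?_⟩
    rcases hz.1.eq_or_lt with rfl | h1
    · exact hxyS.fst_mem
    rcases hz.2.eq_or_lt with rfl | h2
    · exact hxyS.snd_mem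
    refine (hconst {p | x < p ∧ p < y} (fun p hp => ?_) (fun p hp q hq r h2 h3 => ?_)
      z ⟨h1, h2⟩ s ⟨hxs, hsy⟩).2 hsS
    · simp only [Set.mem_ofPred_eq] at hp
      grind
    · exact ⟨hp.1.trans h2, h3.trans hq.2⟩
  refine SimpleGraph.Subgraph.ext hverts ?_
  ext p q
  constructor
  · intro h1
    exact ⟨hsub p h1.fst_mem, hsub q h1.snd_mem, h1.adj_sub⟩
  · rintro ⟨h1, h2, h3⟩
    exact adj_of_saturated nc hS (hverts ▸ h1) (hverts ▸ h2) h3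

end Cutting

/-! ### Faces and the dual tree -/

section Faces

variable {V : Type u} [LinearOrder V] {G : SimpleGraph V}

/-- The face spanned by three pairwise adjacent vertices. -/
def mkFace {P : G.Subgraph} {a b c : V} (hab : P.Adj a b) (hac : P.Adj a c) (hbc : P.Adj b c) :
    Face P :=
  ⟨{a, b, c}, SimpleGraph.is3Clique_triple_iff.2 ⟨hab, hac, hbc⟩⟩

theorem exists_third {P : G.Subgraph} (t : Face P) {c d : V} (hcd : c ≠ d) (hc : c ∈ t.1)
    (hd : d ∈ t.1) : ∃ s, P.Adj c s ∧ P.Adj d s ∧ P.Adj c d ∧ t.1 = {c, d, s} := by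
  obtain ⟨x, y, z, hxy, hxz, hyz, ht⟩ := SimpleGraph.is3Clique_iff.1 t.2
  rw [SimpleGraph.Subgraph.spanningCoe_adj] at hxy hxz hyz
  rw [ht] at hc hd ⊢
  simp only [Finset.mem_insert, Finset.mem_singleton] at hc hd
  rcases hc with rfl | rfl | rfl <;> rcases hd with rfl | rfl | rfl
  · contradiction
  · exact ⟨z, hxz, hyz, hxy, rfl⟩
  · exact ⟨y, hxy, hyz.symm, hxz, by ext; simp; tauto⟩
  · exact ⟨z, hyz, hxz, hxy.symm, by ext; simp; tauto⟩
  · contradiction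
  · exact ⟨x, hxy.symm, hxz.symm, hyz, by ext; simp; tauto⟩
  · exact ⟨y, hyz.symm, hxy, hxz.symm, by ext; simp; tauto⟩
  · exact ⟨x, hxz.symm, hxy.symm, hyz.symm, by ext; simp; tauto⟩
  · contradiction

/-- With `pathGraph_end`, this is how the path condition on the dual tree enters: a face has at most
two neighbours, and a face with at most one is an end. -/
theorem pathGraph_no_three {α : Type*} {D : SimpleGraph α} {k : ℕ}
    (f : SimpleGraph.pathGraph (k + 1) ≃g D) {s a b c : α} (ha : D.Adj s a) (hb : D.Adj s b)
    (hc : D.Adj s c) : a = b ∨ a = c ∨ b = c := by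
  rw [← f.symm.map_adj_iff, SimpleGraph.pathGraph_adj] at ha hb hc
  by_contra! h
  have h1 : (f.symm a).val ≠ (f.symm b).val := fun h' => h.1 (f.symm.injective (Fin.ext h'))
  have h2 : (f.symm a).val ≠ (f.symm c).val := fun h' => h.2.1 (f.symm.injective (Fin.ext h'))
  have h3 : (f.symm b).val ≠ (f.symm c).val := fun h' => h.2.2 (f.symm.injective (Fin.ext h'))
  omega

theorem pathGraph_end {α : Type*} {D : SimpleGraph α} {k : ℕ}
    (f : SimpleGraph.pathGraph (k + 1) ≃g D) {s : α}
    (h : ∀ a b, D.Adj s a → D.Adj s b → a = b) : s = f 0 ∨ s = f (Fin.last k) := by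
  by_contra! hne
  obtain ⟨i, rfl⟩ := f.surjective s
  have h0 : i ≠ 0 := fun h => hne.1 (by rw [h])
  have h1 : i ≠ Fin.last k := fun h => hne.2 (by rw [h])
  have h0' : i.val ≠ 0 := fun h => h0 (Fin.ext h)
  have h1' : i.val ≠ k := fun h => h1 (Fin.ext h)
  have := f.injective (h (f ⟨i - 1, by omega⟩) (f ⟨i + 1, by omega⟩)
    (by rw [f.map_adj_iff, SimpleGraph.pathGraph_adj]; dsimp only; omega)
    (by rw [f.map_adj_iff, SimpleGraph.pathGraph_adj]; dsimp only; omega))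
  have := congrArg Fin.val this
  dsimp only at this
  omega

end Faces

/-! ### From bonnets to the recursive structure -/

section Ribbons

variable {V : Type u} [LinearOrder V] [Finite V] {G : SimpleGraph V}

omit [Finite V] in
theorem Apex.symm {a b w : V} (h : Apex G a b w) : Apex G b a w :=
  ⟨h.1.symm.imp id id, h.2.2, h.2.1⟩

/-- Otherwise the face abz would have three neighbours in the dual tree, across ab, az and zb. -/
theorem not_both_extend {P : G.Subgraph}
    (hs : Saturated P.verts P.Adj) (nc : NonCrossing G)
    (h3 : ∀ s a b c : Face P, (dualTree P).Adj s a → (dualTree P).Adj s b → (dualTree P).Adj s c →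
      a = b ∨ a = c ∨ b = c)
    {a b z t x y : V} (hab : P.Adj a b) (haz : P.Adj a z) (hzb : P.Adj z b) (h1 : a < z)
    (h2 : z < b) (ht : t < a ∨ b < t) (hta : P.Adj a t) (htb : P.Adj b t)
    (hx : x ∈ P.verts) (hax : a < x) (hxz : x < z) (hy : y ∈ P.verts) (hzy : z < y)
    (hyb : y < b) : False := by
  obtain ⟨p, hp1, hp2, hp3, hp4⟩ := exists_apex nc hs haz hx hax hxz
  obtain ⟨q, hq1, hq2, hq3, hq4⟩ := exists_apex nc hs hzb hy hzy hyb
  have hab' := h1.trans h2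
  have key : ∀ (s r : Face P) (c d e f : V), s.1 = {c, d, e} → r.1 = {c, d, f} → c ≠ d → f ≠ c →
      f ≠ d → f ≠ e → (dualTree P).Adj s r := by
    intro s r c d e f hs hr hcd hfc hfd hfe
    refine ⟨fun h => ?_, c, d, hcd, by simp [hs], by simp [hs], by simp [hr], by simp [hr]⟩
    have : f ∈ s.1 := by rw [h, hr]; simp
    rw [hs] at this
    simp [hfc, hfd, hfe] at this
  have n1 : t ≠ z := by rintro rfl; exact ht.elim (lt_asymm h1) (lt_asymm h2)
  rcases h3 (mkFace hab haz hzb.symm) (mkFace hab hta htb) (mkFace haz hp3 hp4.symm)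
    (mkFace hzb hq3 hq4.symm) (key _ _ a b z t rfl rfl hab'.ne hta.ne.symm htb.ne.symm n1)
    (key _ _ a z b p (by ext; simp [mkFace]; tauto) rfl h1.ne hp1.ne' hp2.ne (hp2.trans h2).ne)
    (key _ _ z b a q (by ext; simp [mkFace]; tauto) rfl h2.ne hq1.ne' hq2.ne (h1.trans hq1).ne')
    with h | h | h
  · have : b ∈ ({a, z, p} : Finset V) := by
      rw [← show ({a, b, t} : Finset V) = {a, z, p} from congrArg Subtype.val h]; simp
    simp [hab'.ne', h2.ne', (hp2.trans h2).ne'] at this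
  · have : a ∈ ({z, b, q} : Finset V) := by
      rw [← show ({a, b, t} : Finset V) = {z, b, q} from congrArg Subtype.val h]; simp
    simp [hab'.ne, h1.ne, (h1.trans hq1).ne] at this
  · have : a ∈ ({z, b, q} : Finset V) := by
      rw [← show ({a, z, p} : Finset V) = {z, b, q} from congrArg Subtype.val h]; simp
    simp [hab'.ne, h1.ne, (h1.trans hq1).ne] at this

omit [Finite V] in
-- A second face at az or zb would need its third vertex in a gap without vertices of `P`; outside
-- the gap the third vertex is forced and gives back abz. Only ab remains to be crossed.
theorem unique_neighbor {P : G.Subgraph} (nc : NonCrossing G)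
    {a b z t : V} (hab : P.Adj a b) (haz : P.Adj a z) (hzb : P.Adj z b) (h1 : a < z)
    (h2 : z < b) (ht : t < a ∨ b < t) (hta : P.Adj a t) (htb : P.Adj b t)
    (hx : ∀ x ∈ P.verts, ¬ (a < x ∧ x < z)) (hy : ∀ y ∈ P.verts, ¬ (z < y ∧ y < b))
    (r : Face P) (hr : (dualTree P).Adj (mkFace hab haz hzb.symm) r) : r.1 = {a, b, t} := by
  obtain ⟨hne, c, d, hcd, hc, hd, hc', hd'⟩ := hr
  have hab' := h1.trans h2
  have key : ∀ c d, c ≠ d → c ∈ r.1 → d ∈ r.1 → (c = a ∧ d = z) ∨ (c = z ∧ d = b) ∨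
      (c = a ∧ d = b) → r.1 = {a, b, t} := by
    intro c d hcd hc' hd' h
    obtain ⟨s, hs1, hs2, hs3, hs4⟩ := exists_third r hcd hc' hd'
    rcases h with ⟨rfl, rfl⟩ | ⟨rfl, rfl⟩ | ⟨rfl, rfl⟩
    · have hs5 := hx s hs1.snd_mem
      have : s = b := outer_apex_unique nc (by unfold Btw; grind) (by unfold Btw; grind)
        hs1.adj_sub hs2.adj_sub hab.adj_sub hzb.adj_sub hcd
      subst this
      refine absurd (Subtype.ext ?_) hne
      rw [hs4]
      ext; simp [mkFace]; tauto
    · have hs5 := hy s hs1.snd_mem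
      have : s = a := outer_apex_unique nc (by unfold Btw; grind) (by unfold Btw; grind)
        hs1.adj_sub hs2.adj_sub haz.symm.adj_sub hab.symm.adj_sub hcd
      subst this
      refine absurd (Subtype.ext ?_) hne
      rw [hs4]
      ext; simp [mkFace]; tauto
    · by_cases hb : Btw c s d
      · have : s = z := apex_unique nc ⟨hb, hs1.adj_sub, hs2.adj_sub⟩
          ⟨Or.inl ⟨h1, h2⟩, haz.adj_sub, hzb.symm.adj_sub⟩
        subst this
        exact absurd (Subtype.ext hs4.symm) hne
      · have : s = t := outer_apex_unique nc hb (by unfold Btw; grind)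
          hs1.adj_sub hs2.adj_sub hta.adj_sub htb.adj_sub hcd
        rw [hs4, this]
  simp only [mkFace, Finset.mem_insert, Finset.mem_singleton] at hc hd
  have k1 := key c d hcd hc' hd'
  have k2 := key d c hcd.symm hd' hc'
  grind

/-- A ribbon `P` with ends in outer edges, everything left aside by `P` satisfying `Q`. -/
structure RibbonData (P : G.Subgraph) (Q : V → V → Prop) (u v : V) : Prop where
  saturated : Saturated P.verts P.Adj
  no_three : ∀ s a b c : Face P, (dualTree P).Adj s a → (dualTree P).Adj s b →
    (dualTree P).Adj s c → a = b ∨ a = c ∨ b = c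
  end_outer : ∀ s : Face P, (∀ a b, (dualTree P).Adj s a → (dualTree P).Adj s b → a = b) →
    ∃ x y, x < y ∧ x ∈ s.1 ∧ y ∈ s.1 ∧ ((x = u ∧ y = v) ∨ ∀ z, ¬ (x < z ∧ z < y))
  aside : ∀ x y, x < y → u < x → y < v → P.Adj x y → (∀ z ∈ P.verts, ¬ (x < z ∧ z < y)) → Q x y
  symm : ∀ x y, Q x y → Q y x

omit [Finite V] in
theorem consecutive_of_lt {x y : V} (h : x < y) (hn : ∀ z, ¬ (x < z ∧ z < y)) :
    Consecutive x y :=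
  ⟨h.ne, fun z hz => hz.elim (hn z) fun h' => lt_asymm h (h'.1.trans h'.2)⟩

theorem ncard_Ioo_lt {a b c d x : V} (hac : a ≤ c) (hdb : d ≤ b) (hax : a < x)
    (hxb : x < b) (hx : ¬ (c < x ∧ x < d)) : (Set.Ioo c d).ncard < (Set.Ioo a b).ncard :=
  Set.ncard_lt_ncard ⟨Set.Ioo_subset_Ioo hac hdb, fun h => hx (h ⟨hax, hxb⟩)⟩

/-- Induction on the number of vertices between a and b. The ribbon has entered through ab from the
face abt, so it continues across at most one of az and zb, and the other side is left to `Q`. -/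
theorem RibbonData.ribbon {P : G.Subgraph} {Q : V → V → Prop} {u v : V} (h : RibbonData P Q u v)
    (nc : NonCrossing G) (n : ℕ) : ∀ a b t x, a < b → u < a → b < v → P.Adj a b →
      (t < a ∨ b < t) → P.Adj a t → P.Adj b t → x ∈ P.verts → a < x → x < b →
      (Set.Ioo a b).ncard < n → Ribbon Consecutive (Apex G) Q a b := by
  induction n with
  | zero => intros; omega
  | succ n ih =>
    intro a b t x hab hua hbv hadj ht hta htb hx hax hxb hn
    obtain ⟨z, h1, h2, haz, hzb⟩ := exists_apex nc h.saturated hadj hx hax hxb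
    have hap : Apex G a b z := ⟨Or.inl ⟨h1, h2⟩, haz.adj_sub, hzb.symm.adj_sub⟩
    have l1 := ncard_Ioo_lt (a := a) (b := b) (c := a) (d := z) le_rfl h2.le h1 h2
      (fun h => lt_irrefl _ h.2)
    have l2 := ncard_Ioo_lt (a := a) (b := b) (c := z) (d := b) h1.le le_rfl h1 h2
      (fun h => lt_irrefl _ h.1)
    by_cases hl : ∃ y ∈ P.verts, a < y ∧ y < z
    · obtain ⟨y, hy, hay, hyz⟩ := hl
      by_cases hr : ∃ y ∈ P.verts, z < y ∧ y < b
      · obtain ⟨y', hy', hzy', hyb'⟩ := hr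
        exact (not_both_extend h.saturated nc h.no_three hadj haz hzb h1 h2 ht hta htb hy hay hyz
          hy' hzy' hyb').elim
      · push Not at hr
        have hQ := h.aside z b h2 (hua.trans h1) hbv hzb
          fun y hy hy' => not_lt_of_ge (hr y hy hy'.1) hy'.2
        have hR := ih a z b y h1 hua (h2.trans hbv) haz (Or.inr h2) hadj hzb hy hay hyz
          (by omega)
        exact (Ribbon.step hap.symm hQ hR.swap).swap
    · push Not at hl
      have hl' : ∀ y ∈ P.verts, ¬ (a < y ∧ y < z) := fun y hy hy' =>
        not_lt_of_ge (hl y hy hy'.1) hy'.2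
      have hQ := h.symm _ _ (h.aside a z h1 hua (h2.trans hbv) haz hl')
      by_cases hr : ∃ y ∈ P.verts, z < y ∧ y < b
      · obtain ⟨y', hy', hzy', hyb'⟩ := hr
        have hR := ih z b a y' h2 (hua.trans h1) hbv hzb (Or.inl h1) haz.symm hadj.symm hy' hzy'
          hyb' (by omega)
        exact Ribbon.step hap hQ hR
      · push Not at hr
        have hr' : ∀ y ∈ P.verts, ¬ (z < y ∧ y < b) := fun y hy hy' =>
          not_lt_of_ge (hr y hy hy'.1) hy'.2
        have hQ' := h.aside z b h2 (hua.trans h1) hbv hzb hr'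
        -- The ribbon continues across neither side, so the face is an end of the dual path and has
        -- an outer edge. This is not the root edge, because u < a.
        obtain ⟨p, q, hpq, hp, hq, h3⟩ := h.end_outer (mkFace hadj haz hzb.symm) fun r r' hr hr' =>
          Subtype.ext ((unique_neighbor nc hadj haz hzb h1 h2 ht hta htb hl' ‹_› r hr).trans
            (unique_neighbor nc hadj haz hzb h1 h2 ht hta htb hl' ‹_› r' hr').symm)
        simp only [mkFace, Finset.mem_insert, Finset.mem_singleton] at hp hq
        have h4 : (p = a ∧ q = z) ∨ (p = z ∧ q = b) ∨ (p = a ∧ q = b) := by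
          clear ih
          grind
        have h5 : ∀ r, ¬ (p < r ∧ r < q) := by
          refine h3.resolve_left ?_
          rintro ⟨rfl, rfl⟩
          rcases h4 with ⟨h4, -⟩ | ⟨h4, -⟩ | ⟨h4, -⟩
          · exact hua.ne h4
          · exact (hua.trans h1).ne h4
          · exact hua.ne h4
        rcases h4 with ⟨rfl, rfl⟩ | ⟨rfl, rfl⟩ | ⟨rfl, rfl⟩
        · exact (Ribbon.step hap.symm hQ' (Ribbon.leaf (consecutive_of_lt hpq h5)).swap).swap
        · exact Ribbon.step hap hQ (Ribbon.leaf (consecutive_of_lt hpq h5))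
        · exact absurd ⟨h1, h2⟩ (h5 z)

/-- A ribbon that never leaves a. -/
theorem FanBeyond.ribbonFan {α : Type*} {Lf : α → α → Prop} {Ap : α → α → α → Prop}
    {Q : α → α → Prop} (hQ : ∀ x y, Q x y → Q y x) {a x : α} (h : FanBeyond Lf Ap Q a x) :
    RibbonFan Lf Ap Q a x := by
  induction h with
  | leaf h => exact .leaf h
  | step h h1 _ ih => exact .along h (hQ _ _ h1) ih

/-- Let z be the apex of ux in the ribbon. If the ribbon continues across zx, it cannot also
continue across uz, where only the fan remains. If it does not, zx is left aside and the ribbon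
keeps turning around u. -/
theorem RibbonData.ribbonFan {P : G.Subgraph} {Q : V → V → Prop} {u v : V}
    (h : RibbonData P Q u v) (nc : NonCrossing G)
    (hF : ∀ x, P.Adj u x → u < x → (∀ z ∈ P.verts, ¬ (u < z ∧ z < x)) →
      FanBeyond Consecutive (Apex G) Q u x) (n : ℕ) :
    ∀ x t, u < x → x < v → P.Adj u x → x < t → P.Adj u t → P.Adj x t →
      (Set.Ioo u x).ncard < n → RibbonFan Consecutive (Apex G) Q u x := by
  induction n with
  | zero => intros; omega
  | succ n ih =>
    intro x t hux hxv hadj ht hut hxt hn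
    by_cases hy : ∃ y ∈ P.verts, u < y ∧ y < x
    · obtain ⟨y, hy, huy, hyx⟩ := hy
      obtain ⟨z, h1, h2, huz, hzx⟩ := exists_apex nc h.saturated hadj hy huy hyx
      have hap : Apex G u x z := ⟨Or.inl ⟨h1, h2⟩, huz.adj_sub, hzx.symm.adj_sub⟩
      by_cases hr : ∃ y ∈ P.verts, z < y ∧ y < x
      · obtain ⟨y', hy', hzy', hyx'⟩ := hr
        refine .leave hap (hF z huz h1 fun y hy hy1 => ?_)
          (h.ribbon nc _ z x u y' h2 h1 hxv hzx (Or.inl h1) huz.symm hadj.symm hy' hzy' hyx'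
            (Nat.lt_succ_self _))
        exact not_both_extend h.saturated nc h.no_three hadj huz hzx h1 h2 (Or.inr ht) hut hxt
          hy hy1.1 hy1.2 hy' hzy' hyx'
      · push Not at hr
        refine .along hap (h.aside z x h2 h1 hxv hzx
          fun y hy hy' => not_lt_of_ge (hr y hy hy'.1) hy'.2) ?_
        have := ncard_Ioo_lt (a := u) (b := x) (c := u) (d := z) le_rfl h2.le h1 h2
          (fun h => lt_irrefl _ h.2)
        exact ih z x h1 (h2.trans hxv) huz h2 hadj hzx (by omega)
    · push Not at hy
      exact (hF x hadj hux fun y hy1 hy2 => not_lt_of_ge (hy y hy1 hy2.1) hy2.2).ribbonFan h.symm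

end Ribbons

/-! ### Fans of a bonnet -/

section Fans

variable {V : Type u} [LinearOrder V] [Finite V] {G : SimpleGraph V}

/-- For the next neighbour z of a after b, an edge crossing bz would cross ab or az, or start in a
and end before z. -/
theorem exists_next_neighbor (nc : NonCrossing G) {P : G.Subgraph}
    (hs : Saturated P.verts P.Adj) {a b x : V} (hmin : ∀ z ∈ P.verts, a ≤ z) (h : P.Adj a b)
    (hx : P.Adj a x) (hbx : b < x) :
    ∃ z, b < z ∧ P.Adj a z ∧ P.Adj b z ∧ ∀ y, P.Adj a y → b < y → z ≤ y := by
  obtain ⟨z, ⟨hz1, hz2⟩, hz3⟩ := Set.exists_min_image {z | P.Adj a z ∧ b < z} id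
    (Set.toFinite _) ⟨x, hx, hbx⟩
  have hab : a < b := lt_of_le_of_ne (hmin b h.snd_mem) h.ne
  refine ⟨z, hz2, hz1, hs b h.snd_mem z hz1.snd_mem hz2 fun c hc d hd hcd h1 h2 => ⟨?_, ?_⟩,
    fun y h1 h2 => hz3 y ⟨h1, h2⟩⟩
  · by_contra! h3
    rcases (hmin d hd).eq_or_lt with rfl | h4
    · exact not_lt_of_ge (hz3 c ⟨hcd.symm, h1⟩) h2
    · exact nc a b d c h.adj_sub hcd.adj_sub.symm ⟨h4, h3, h1⟩
  · by_contra! h3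
    exact nc a z c d hz1.adj_sub hcd.adj_sub ⟨hab.trans h1, h2, h3⟩

/-- A fan at `u` occupies the gap between `u` and the next vertex `p` of the ribbon. -/
theorem IsFan.fills_gap (nc : NonCrossing G) {H P F : G.Subgraph} {u v p : V}
    (hF : IsFan H P u F) (hP : Saturated P.verts P.Adj)
    (hH : ∀ z ∈ H.verts, u ≤ z ∧ z ≤ v) (hPH : P ≤ H) (huv : P.Adj u v) (hup : u < p)
    (hp : p ∈ P.verts) (hmin : ∀ z ∈ P.verts, ¬ (u < z ∧ z < p)) :
    (∀ x ∈ F.verts, x ∈ P.verts ∨ (u < x ∧ x < p ∧ G.Adj u x)) ∧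
    (∀ x y, x ∈ F.verts ∨ x ∈ P.verts → y ∈ F.verts ∨ y ∈ P.verts → x < y → y ≤ p →
      (∀ z, z ∈ F.verts ∨ z ∈ P.verts → ¬ (x < z ∧ z < y)) → F.Adj x y ∨ P.Adj x y) := by
  obtain ⟨y, hy⟩ := hF.common_edge
  have hyFP : s(u, y) ∈ F.edgeSet ∩ P.edgeSet := hy ▸ rfl
  have hFy : F.Adj u y := hyFP.1
  have hPy : P.Adj u y := hyFP.2
  have hcommon : ∀ z, F.Adj u z → P.Adj u z → z = y := fun z h1 h2 => by
    have : s(u, z) ∈ F.edgeSet ∩ P.edgeSet := ⟨h1, h2⟩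
    rw [hy] at this
    exact Sym2.congr_right.1 this
  rcases hF.path_or_empty with hpath | ⟨y', hy', rfl⟩
  · have hFs := hpath.1.saturated_coe nc
    have hadj : ∀ z ∈ F.verts, z ≠ u → F.Adj u z := fun z hz hzu =>
      adj_of_saturated nc hFs hFy.fst_mem hz (((hF.neighbors z hz).resolve_left hzu).adj_sub)
    have hminF : ∀ z ∈ F.verts, u ≤ z := fun z hz => (hH z (hF.le.1 hz)).1
    have hminP : ∀ z ∈ P.verts, u ≤ z := fun z hz => (hH z (hPH.1 hz)).1
    have huy : u < y := lt_of_le_of_ne (hminF y hFy.snd_mem) hFy.ne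
    -- Beyond y, fan and ribbon would both contain the triangle over uy, hence a second common edge
    -- at u.
    have hle : ∀ t ∈ F.verts, t ≤ y := by
      intro t ht
      by_contra! hyt
      obtain ⟨z, h1, h2, h3, -⟩ := exists_next_neighbor nc hFs hminF hFy
        (hadj t ht (huy.trans hyt).ne') hyt
      obtain ⟨z', k1, k2, k3, -⟩ := exists_next_neighbor nc hP hminP hPy huv
        (hyt.trans_le (hH t (hF.le.1 ht)).2)
      have hz : z = z' := by
        have n1 := nc _ _ _ _ h2.adj_sub k3.adj_sub
        have n2 := nc _ _ _ _ k2.adj_sub h3.adj_sub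
        rcases lt_trichotomy z z' with h | h | h
        · exact absurd ⟨huy, h1, h⟩ n1
        · exact h
        · exact absurd ⟨huy, k1, h⟩ n2
      subst hz
      exact h1.ne' (hcommon z h2 k2)
    have hex : ∃ t ∈ F.verts, u < t ∧ t < y := by
      by_contra! h1
      have h2 : F.verts ⊆ {u, y} := fun z hz => by
        rcases (hminF z hz).eq_or_lt with rfl | h3
        · exact Or.inl rfl
        · exact Or.inr (le_antisymm (hle z hz) (h1 z hz h3))
      have h3 := Set.ncard_le_ncard h2
      have h4 : 3 ≤ Nat.card F.verts := hpath.1.1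
      rw [Set.ncard_pair huy.ne] at h3
      rw [Nat.card_coe_set_eq] at h4
      omega
    -- If the ribbon had vertices between u and y, it would share the apex of uy with the fan, again
    -- giving a second common edge.
    have hpy : p = y := by
      by_contra hne
      have hpy : p < y := lt_of_le_of_ne (by
        by_contra! h
        exact hmin y hPy.snd_mem ⟨huy, h⟩) hne
      obtain ⟨t, ht, h1, h2⟩ := hex
      obtain ⟨z, h3, h4, h5, h6⟩ := exists_apex nc hFs hFy ht h1 h2
      obtain ⟨z', k3, k4, k5, k6⟩ := exists_apex nc hP hPy hp hup hpy
      have := apex_unique nc ⟨Or.inl ⟨h3, h4⟩, h5.adj_sub, h6.symm.adj_sub⟩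
        ⟨Or.inl ⟨k3, k4⟩, k5.adj_sub, k6.symm.adj_sub⟩
      subst this
      exact h4.ne (hcommon z h5 k5)
    subst hpy
    constructor
    · intro x hx
      rcases (hminF x hx).eq_or_lt with rfl | h1
      · exact Or.inl hPy.fst_mem
      rcases (hle x hx).eq_or_lt with rfl | h2
      · exact Or.inl hPy.snd_mem
      exact Or.inr ⟨h1, h2, (hadj x hx h1.ne').adj_sub⟩
    · intro x z hx hz hxz hzp hn
      have hmem : ∀ x, x ∈ F.verts ∨ x ∈ P.verts → x ≤ p → x ∈ F.verts := by
        intro x hx hxp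
        refine hx.elim id fun hx => ?_
        rcases (hminP x hx).eq_or_lt with rfl | h1
        · exact hFy.fst_mem
        rcases hxp.eq_or_lt with rfl | h2
        · exact hFy.snd_mem
        exact absurd ⟨h1, h2⟩ (hmin x hx)
      exact Or.inl (hFs.linked x (hmem x hx (hxz.le.trans hzp)) z (hmem z hz hzp) hxz
        fun r hr => hn r (Or.inl hr))
  · have hsub : ∀ x ∈ (G.subgraphOfAdj hy').verts, x ∈ P.verts := by
      have : y = y' := by
        have h1 : s(u, y) ∈ (G.subgraphOfAdj hy').edgeSet := hFy
        rw [SimpleGraph.edgeSet_subgraphOfAdj] at h1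
        exact Sym2.congr_right.1 h1
      subst this
      rintro x (rfl | rfl)
      exacts [hPy.fst_mem, hPy.snd_mem]
    refine ⟨fun x hx => Or.inl (hsub x hx), fun x z hx hz hxz _ hn => Or.inr ?_⟩
    exact hP.linked x (hx.elim (hsub x) id) z (hz.elim (hsub z) id) hxz
      fun r hr => hn r (Or.inr hr)

/-- The gap between `u` and the next vertex `p` of the ribbon is a fan at `u`. -/
theorem fanBeyond_of_gap (nc : NonCrossing G) (hs : Saturated Set.univ G.Adj) {U : G.Subgraph}
    {Q : V → V → Prop} {u p : V} (hgap : ∀ x ∈ U.verts, u < x → x < p → G.Adj u x)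
    (hnb : ∀ x, u < x → x < p → G.Adj u x → x ∈ U.verts)
    (hQ : ∀ x y, u < x → x < y → y ≤ p → x ∈ U.verts → y ∈ U.verts →
      (∀ z ∈ U.verts, ¬ (x < z ∧ z < y)) → Q y x) (n : ℕ) :
    ∀ x, G.Adj u x → u < x → x ≤ p → x ∈ U.verts → (Set.Ioo u x).ncard < n →
      FanBeyond Consecutive (Apex G) Q u x := by
  induction n with
  | zero => intros; omega
  | succ n ih =>
    intro x hadj hux hxp hx hn
    by_cases hy : ∃ y, u < y ∧ y < x
    · obtain ⟨y, huy, hyx⟩ := hy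
      obtain ⟨z, h1, h2, h3, h4⟩ := exists_apex nc (P := ⊤) hs hadj trivial huy hyx
      change G.Adj u z at h3
      change G.Adj z x at h4
      have hz := hnb z h1 (h2.trans_le hxp) h3
      -- A vertex of `U` between z and x is a neighbour of u, and the edge to it would cross zx. So
      -- z and x are consecutive in `U`.
      refine .step ⟨Or.inl ⟨h1, h2⟩, h3, h4.symm⟩ (hQ z x h1 h2 hxp hz hx fun r hr hr' => ?_) ?_
      · exact nc _ _ _ _ (hgap r hr (h1.trans hr'.1) (hr'.2.trans_le hxp)) h4 ⟨h1, hr'.1, hr'.2⟩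
      · have := ncard_Ioo_lt (a := u) (b := x) (c := u) (d := z) le_rfl h2.le h1 h2
          (fun h => lt_irrefl _ h.2)
        exact ih z h3 h1 (h2.le.trans hxp) hz (by omega)
    · push Not at hy
      exact .leaf (consecutive_of_lt hux fun z hz => not_lt_of_ge (hy z hz.1) hz.2)

end Fans

/-! ### Monotonicity and symmetry of the recursive structure -/

section Levels

variable {V : Type u} {Lf : V → V → Prop} {Ap : V → V → V → Prop} {Q Q' : V → V → Prop}

theorem Ribbon.mono (hQ : ∀ a b, Q a b → Q' a b) {a b : V} (h : Ribbon Lf Ap Q a b) :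
    Ribbon Lf Ap Q' a b := by
  induction h with
  | leaf h => exact .leaf h
  | swap _ ih => exact .swap ih
  | step h h1 _ ih => exact .step h (hQ _ _ h1) ih

theorem FanBeyond.mono (hQ : ∀ a b, Q a b → Q' a b) {a b : V} (h : FanBeyond Lf Ap Q a b) :
    FanBeyond Lf Ap Q' a b := by
  induction h with
  | leaf h => exact .leaf h
  | step h h1 _ ih => exact .step h (hQ _ _ h1) ih

theorem RibbonFan.mono (hQ : ∀ a b, Q a b → Q' a b) {a b : V} (h : RibbonFan Lf Ap Q a b) :
    RibbonFan Lf Ap Q' a b := by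
  induction h with
  | leaf h => exact .leaf h
  | along h h1 _ ih => exact .along h (hQ _ _ h1) ih
  | leave h h1 h2 => exact .leave h (h1.mono hQ) (h2.mono hQ)

theorem BonnetLevels.succ (d : ℕ) :
    ∀ {a b : V}, BonnetLevels Lf Ap d a b → BonnetLevels Lf Ap (d + 1) a b := by
  induction d with
  | zero => exact fun h => Or.inl h
  | succ d ih =>
    rintro a b (h | ⟨w, h, h1, h2⟩)
    · exact Or.inl h
    · exact Or.inr ⟨w, h, h1.mono fun _ _ => ih, h2.mono fun _ _ => ih⟩

theorem BonnetLevels.mono {d d' : ℕ} (hd : d ≤ d') {a b : V} (h : BonnetLevels Lf Ap d a b) :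
    BonnetLevels Lf Ap d' a b := by
  induction hd with
  | refl => exact h
  | step _ ih => exact ih.succ

theorem BonnetLevels.symm (hLf : ∀ a b, Lf a b → Lf b a) (hAp : ∀ a b w, Ap a b w → Ap b a w)
    {d : ℕ} {a b : V} (h : BonnetLevels Lf Ap d a b) : BonnetLevels Lf Ap d b a := by
  cases d with
  | zero => exact hLf _ _ h
  | succ d =>
    rcases h with h | ⟨w, h, h1, h2⟩
    exacts [Or.inl (hLf _ _ h), Or.inr ⟨w, hAp _ _ _ h, h2, h1⟩]

end Levels

/-! ### Reversing the order -/

section Dual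

variable {V : Type u}

/-- The reverse of a linear order. -/
abbrev reverseOrder (o : LinearOrder V) : LinearOrder V := inferInstanceAs (LinearOrder Vᵒᵈ)

variable [o : LinearOrder V] {G : SimpleGraph V}

/-- Betweenness, and with it `Consecutive` and `Apex`, ignores the direction of the order. Arguments
made at the least vertex u thus apply to the greatest vertex v. -/
theorem btw_reverse (a x b : V) : @Btw V (reverseOrder o) a x b = Btw a x b :=
  propext ⟨fun h => h.elim (fun h => Or.inr h.symm) fun h => Or.inl h.symm,
    fun h => h.elim (fun h => Or.inr h.symm) fun h => Or.inl h.symm⟩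

theorem consecutive_reverse : @Consecutive V (reverseOrder o) = Consecutive := by
  funext a b
  unfold Consecutive
  simp only [btw_reverse]

theorem apex_reverse : @Apex V (reverseOrder o) G = Apex G := by
  funext a b
  unfold Apex
  simp only [btw_reverse]

theorem NonCrossing.reverse (nc : NonCrossing G) : @NonCrossing V (reverseOrder o) G :=
  fun a b c d hab hcd h => nc d c b a hcd.symm hab.symm ⟨h.2.2, h.2.1, h.1⟩

theorem Saturated.reverse {X : Set V} {r : V → V → Prop} (hr : ∀ x y, r x y → r y x)
    (h : Saturated X r) : @Saturated V (reverseOrder o) X r :=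
  fun x hx y hy hxy hc => hr _ _ <| h y hy x hx hxy fun c hcX d hd hcd h1 h2 =>
    (hc c hcX d hd hcd h2 h1).symm

theorem RibbonData.reverse {P : G.Subgraph} {Q : V → V → Prop} {u v : V}
    (h : RibbonData P Q u v) : @RibbonData V (reverseOrder o) G P Q v u := by
  refine @RibbonData.mk V (reverseOrder o) G P Q v u (h.saturated.reverse fun _ _ h => h.symm)
    h.no_three (fun s hs => ?_) (fun x y hxy hx hy hadj hn => ?_) h.symm
  · obtain ⟨x, y, h1, h2, h3, h4⟩ := h.end_outer s hs
    exact ⟨y, x, h1, h3, h2, h4.imp And.symm fun h5 z hz => h5 z hz.symm⟩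
  · exact h.symm _ _ (h.aside y x hxy hy hx hadj.symm fun z hz hz' => hn z hz hz'.symm)

end Dual

/-! ### The shape of a bonnet and its recursive structure -/

section Bonnets

variable {V : Type u} [o : LinearOrder V] [Finite V] {G : SimpleGraph V}

omit o [Finite V] in
theorem IsBonnetWith.swap {H U P F₁ F₂ : G.Subgraph} {u v : V}
    (h : IsBonnetWith H U u v P F₁ F₂) : IsBonnetWith H U v u P F₂ F₁ where
  cap := Sym2.eq_swap (a := u) ▸ h.cap
  le := h.le
  union := by rw [h.union, sup_assoc, sup_comm F₁, ← sup_assoc]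
  ribbon_path := h.ribbon_path
  ribbon_connects := h.ribbon_connects
  ribbon_contains := by
    obtain ⟨w, h1, h2, h3, h4, h5⟩ := h.ribbon_contains
    exact ⟨w, h2, h1, h4, h3, h5⟩
  fan_left := h.fan_right
  fan_right := h.fan_left
  fans_disjoint := h.fans_disjoint.symm
  neighbors_left := h.neighbors_right
  neighbors_right := h.neighbors_left

/-- Where the vertices of a bonnet lie, and how they are linked. -/
structure BonnetShape (U P : G.Subgraph) (u v p w q : V) : Prop where
  lt_left : u < p
  left_le : p ≤ w
  le_right : w ≤ q
  lt_right : q < v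
  left_mem : p ∈ P.verts
  right_mem : q ∈ P.verts
  gap_left : ∀ z ∈ P.verts, ¬ (u < z ∧ z < p)
  gap_right : ∀ z ∈ P.verts, ¬ (q < z ∧ z < v)
  saturated : Saturated P.verts P.Adj
  adj_root : P.Adj u v
  adj_left : P.Adj u w
  adj_right : P.Adj w v
  le : P ≤ U
  mem : ∀ x ∈ U.verts, x ∈ P.verts ∨ (u < x ∧ x < p ∧ G.Adj u x) ∨ (q < x ∧ x < v ∧ G.Adj v x)
  linked : Linked U.verts U.Adj

theorem exists_gap {X : Set V} {a w : V} (hw : w ∈ X) (haw : a < w) :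
    ∃ p ∈ X, a < p ∧ p ≤ w ∧ ∀ z ∈ X, ¬ (a < z ∧ z < p) := by
  obtain ⟨p, ⟨h1, h2⟩, h3⟩ := Set.exists_min_image {p | p ∈ X ∧ a < p} id (Set.toFinite _)
    ⟨w, hw, haw⟩
  exact ⟨p, h1, h2, h3 w ⟨hw, haw⟩, fun z hz h => not_lt_of_ge (h3 z ⟨hz, h.1⟩) h.2⟩

/-- p and q are the ribbon vertices nearest to u and v. By `IsFan.fills_gap`, used at v in the
reversed order, new fan vertices lie only in the two outer gaps. Consecutive vertices of `U` are
both at most p, both at least q, or both on the ribbon from p to q, and each zone is linked. -/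
theorem IsBonnetWith.exists_shape (nc : NonCrossing G) {U P F₁ F₂ : G.Subgraph} {u v : V}
    (h : IsBonnetWith (segment G u v) U u v P F₁ F₂) :
    ∃ p w q, BonnetShape U P u v p w q := by
  obtain ⟨w, huw, hvw, huP, hvP, hwP⟩ := h.ribbon_contains
  have hPs := h.ribbon_path.1.saturated_coe nc
  have hPU : P ≤ U := by rw [h.union]; exact le_sup_left.trans le_sup_left
  have hF₁U : F₁ ≤ U := by rw [h.union]; exact le_sup_right.trans le_sup_left
  have hF₂U : F₂ ≤ U := by rw [h.union]; exact le_sup_right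
  have hPH := hPU.trans h.le
  have hH : ∀ z ∈ (segment G u v).verts, u ≤ z ∧ z ≤ v := fun z hz => hz
  have hw := hH w huw.snd_mem
  have h1 : u < w := lt_of_le_of_ne hw.1 huw.ne
  have h2 : w < v := lt_of_le_of_ne hw.2 hvw.ne.symm
  have a1 : P.Adj u v :=
    adj_of_saturated nc hPs huP hvP (show (segment G u v).Adj u v from h.cap.1).adj_sub
  have a2 : P.Adj u w := adj_of_saturated nc hPs huP hwP huw.adj_sub
  have a3 : P.Adj w v := adj_of_saturated nc hPs hwP hvP hvw.adj_sub.symm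
  obtain ⟨p, hp, hup, hpw, hpm⟩ := exists_gap hwP h1
  have hq : ∃ q ∈ P.verts, q < v ∧ w ≤ q ∧ ∀ z ∈ P.verts, ¬ (z < v ∧ q < z) :=
    @exists_gap V (reverseOrder o) _ _ _ _ hwP h2
  obtain ⟨q, hq, hqv, hwq, hqm⟩ := hq
  obtain ⟨A1, B1⟩ := h.fan_left.fills_gap nc hPs hH hPH a1 hup hp hpm
  have hr : (∀ x ∈ F₂.verts, x ∈ P.verts ∨ (x < v ∧ q < x ∧ G.Adj v x)) ∧
    (∀ x y, x ∈ F₂.verts ∨ x ∈ P.verts → y ∈ F₂.verts ∨ y ∈ P.verts → y < x → q ≤ y →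
      (∀ z, z ∈ F₂.verts ∨ z ∈ P.verts → ¬ (z < x ∧ y < z)) → F₂.Adj x y ∨ P.Adj x y) :=
    @IsFan.fills_gap V (reverseOrder o) _ G nc.reverse _ _ _ _ u _ h.fan_right
      (hPs.reverse fun _ _ h => h.symm) (fun z hz => (hH z hz).symm) hPH a1.symm hqv hq hqm
  obtain ⟨A2, B2⟩ := hr
  have hmem : ∀ x ∈ U.verts, x ∈ P.verts ∨ x ∈ F₁.verts ∨ x ∈ F₂.verts := by
    intro x hx
    rw [h.union] at hx
    rcases hx with (hx | hx) | hx
    exacts [Or.inl hx, Or.inr (Or.inl hx), Or.inr (Or.inr hx)]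
  refine ⟨p, w, q, hup, hpw, hwq, hqv, hp, hq, hpm, fun z hz hz' => hqm z hz hz'.symm, hPs, a1, a2,
    a3, hPU, fun x hx => ?_, fun x hx y hy hxy hn => ?_⟩
  · rcases hmem x hx with hx | hx | hx
    · exact Or.inl hx
    · exact (A1 x hx).imp id Or.inl
    · exact (A2 x hx).imp id fun h => Or.inr ⟨h.2.1, h.1, h.2.2⟩
  · have hn1 : ∀ z, z ∈ F₁.verts ∨ z ∈ P.verts → ¬ (x < z ∧ z < y) := fun z hz =>
      hn z (hz.elim (fun h => hF₁U.1 h) fun h => hPU.1 h)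
    have hn2 : ∀ z, z ∈ F₂.verts ∨ z ∈ P.verts → ¬ (x < z ∧ z < y) := fun z hz =>
      hn z (hz.elim (fun h => hF₂U.1 h) fun h => hPU.1 h)
    have left_of : ∀ z ∈ U.verts, z ≤ p → z ∈ F₁.verts ∨ z ∈ P.verts := by
      intro z hz hzp
      rcases hmem z hz with hz | hz | hz
      · exact Or.inr hz
      · exact Or.inl hz
      · rcases A2 z hz with hz | hz
        · exact Or.inr hz
        · exact absurd (hz.2.1.trans_le hzp) (not_lt_of_ge (hpw.trans hwq))
    have right_of : ∀ z ∈ U.verts, q ≤ z → z ∈ F₂.verts ∨ z ∈ P.verts := by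
      intro z hz hzp
      rcases hmem z hz with hz | hz | hz
      · exact Or.inr hz
      · rcases A1 z hz with hz | hz
        · exact Or.inr hz
        · exact absurd (hzp.trans_lt hz.2.1) (not_lt_of_ge (hpw.trans hwq))
      · exact Or.inl hz
    by_cases hyp : y ≤ p
    · rcases B1 x y (left_of x hx (hxy.le.trans hyp)) (left_of y hy hyp) hxy hyp hn1 with h3 | h3
      exacts [hF₁U.2 h3, hPU.2 h3]
    by_cases hxq : q ≤ x
    · rcases B2 y x (right_of y hy (hxq.trans hxy.le)) (right_of x hx hxq) hxy hxq
        (fun z hz hz' => hn2 z hz hz'.symm) with h3 | h3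
      exacts [hF₂U.2 h3.symm, hPU.2 h3.symm]
    push Not at hyp hxq
    have hxp : p ≤ x := by
      by_contra! h3
      exact hn p (hPU.1 hp) ⟨h3, hyp⟩
    have hyq : y ≤ q := by
      by_contra! h3
      exact hn q (hPU.1 hq) ⟨hxq, h3⟩
    have mid : ∀ z ∈ U.verts, p ≤ z → z ≤ q → z ∈ P.verts := by
      intro z hz h3 h4
      rcases hmem z hz with hz | hz | hz
      · exact hz
      · exact (A1 z hz).resolve_right fun h5 => not_lt_of_ge h3 h5.2.1
      · exact (A2 z hz).resolve_right fun h5 => not_lt_of_ge h4 h5.2.1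
    exact hPU.2 (hPs.linked x (mid x hx hxp (hxy.le.trans hyq)) y (mid y hy (hxp.trans hxy.le) hyq)
      hxy fun z hz => hn z (hPU.1 hz))

/-- The ribbon leaves u a fan only over the gap up to p, which `fanBeyond_of_gap` handles. -/
theorem BonnetShape.ribbonFan_left (nc : NonCrossing G) (hs : Saturated Set.univ G.Adj)
    {U P : G.Subgraph} {u v p w q : V} {Q : V → V → Prop} (h : BonnetShape U P u v p w q)
    (hR : RibbonData P Q u v) (hnb : ∀ x, u < x → x < v → G.Adj u x → x ∈ U.verts)
    (hQ : ∀ x y, u < x → x < y → y < v → x ∈ U.verts → y ∈ U.verts →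
      (∀ z ∈ U.verts, ¬ (x < z ∧ z < y)) → Q x y) :
    RibbonFan Consecutive (Apex G) Q u w := by
  have hpq := h.left_le.trans h.le_right
  have hpv := hpq.trans_lt h.lt_right
  refine hR.ribbonFan nc ?_ _ w v (h.lt_left.trans_le h.left_le) (h.le_right.trans_lt h.lt_right)
    h.adj_left (h.le_right.trans_lt h.lt_right) h.adj_root h.adj_right (Nat.lt_succ_self _)
  intro x hux hlt hn
  have hxp : x = p := by
    rcases lt_trichotomy x p with h1 | h1 | h1
    · exact absurd ⟨hlt, h1⟩ (h.gap_left x hux.snd_mem)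
    · exact h1
    · exact absurd ⟨h.lt_left, h1⟩ (hn p h.left_mem)
  subst hxp
  refine fanBeyond_of_gap nc hs (U := U) (fun y hy h1 h2 => ?_)
    (fun y h1 h2 => hnb y h1 (h2.trans hpv))
    (fun y z h1 h2 h3 hy hz hyz => hR.symm _ _ (hQ y z h1 h2 (h3.trans_lt hpv) hy hz hyz)) _
    x hux.adj_sub hlt le_rfl (h.le.1 h.left_mem) (Nat.lt_succ_self _)
  rcases h.mem y hy with h3 | h3 | h3
  · exact absurd ⟨h1, h2⟩ (hn y h3)
  · exact h3.2.2
  · exact absurd (h3.1.trans h2) (not_lt_of_ge hpq)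

omit [Finite V] in
theorem BonnetShape.reverse {U P : G.Subgraph} {u v p w q : V}
    (h : BonnetShape U P u v p w q) : @BonnetShape V (reverseOrder o) G U P v u q w p :=
  @BonnetShape.mk V (reverseOrder o) G U P v u q w p h.lt_right h.le_right h.left_le h.lt_left
    h.right_mem h.left_mem (fun z hz hz' => h.gap_right z hz hz'.symm)
    (fun z hz hz' => h.gap_left z hz hz'.symm) (h.saturated.reverse fun _ _ h => h.symm)
    h.adj_root.symm h.adj_right.symm h.adj_left.symm h.le
    (fun x hx => (h.mem x hx).imp id fun h => h.symm.imp (fun h => ⟨h.2.1, h.1, h.2.2⟩)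
      fun h => ⟨h.2.1, h.1, h.2.2⟩)
    (fun x hx y hy hxy hn => (h.linked y hy x hx hxy fun z hz hz' => hn z hz hz'.symm).symm)

omit [Finite V] in
-- An edge over some vertex z that is not the root has u or v outside its interval, and so separates
-- that vertex from z.
theorem consecutive_or_root (nc : NonCrossing G) {u v x y : V}
    (h : IsNonCuttingEdge (segment G u v) s(x, y)) :
    (x = u ∧ y = v) ∨ ∀ z, ¬ (x < z ∧ z < y) := by
  by_contra! hc
  obtain ⟨h1, z, hxz, hzy⟩ := hc
  have hadj : (segment G u v).Adj x y := h.1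
  have hx := hadj.1
  have hy := hadj.2.1
  have huv : u ≤ v := hx.1.trans hx.2
  have hz : z ∈ (segment G u v).verts := ⟨hx.1.trans hxz.le, hzy.le.trans hy.2⟩
  by_cases hxu : x = u
  · exact h.2 (isCuttingEdge_of_separates nc hadj hz hxz hzy (t := v) ⟨huv, le_rfl⟩
      (Or.inr (lt_of_le_of_ne hy.2 (h1 hxu))))
  · exact h.2 (isCuttingEdge_of_separates nc hadj hz hxz hzy (t := u) ⟨le_rfl, huv⟩
      (Or.inl (lt_of_le_of_ne hx.1 (Ne.symm hxu))))

theorem IsBonnetWith.bonnetLevels (nc : NonCrossing G) (hs : Saturated Set.univ G.Adj)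
    {U P F₁ F₂ : G.Subgraph} {u v : V} (huv : u < v)
    (h : IsBonnetWith (segment G u v) U u v P F₁ F₂) {d : ℕ}
    (hD : ∀ x y, x < y → IsCuttingEdge (segment G u v) s(x, y) → U.Adj x y →
      ¬ IsCuttingEdge U s(x, y) → BonnetLevels Consecutive (Apex G) d x y) :
    BonnetLevels Consecutive (Apex G) (d + 1) u v := by
  obtain ⟨p, w, q, sh⟩ := h.exists_shape nc
  have hUH : ∀ z ∈ U.verts, u ≤ z ∧ z ≤ v := fun z hz => h.le.1 hz
  have zero : ∀ {d : ℕ} {x y : V}, Consecutive x y →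
      BonnetLevels Consecutive (Apex G) d x y := fun hxy =>
    BonnetLevels.mono (Nat.zero_le _) (show BonnetLevels Consecutive (Apex G) 0 _ _ from hxy)
  -- Away from u and v, an edge over a gap of `U` is an outer edge or an anchor-edge: it separates u
  -- from the vertices in the gap, but cuts nothing off in `U`.
  have hQ : ∀ x y, u < x → x < y → y < v → x ∈ U.verts → y ∈ U.verts →
      (∀ z ∈ U.verts, ¬ (x < z ∧ z < y)) → BonnetLevels Consecutive (Apex G) d x y := by
    intro x y hux hxy hyv hx hy hn
    by_cases hz : ∃ z, x < z ∧ z < y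
    · obtain ⟨z, hxz, hzy⟩ := hz
      have hadj := sh.linked x hx y hy hxy hn
      refine hD x y hxy ?_ hadj ?_
      · exact isCuttingEdge_of_separates nc (h.le.2 hadj) (t := u)
          ⟨(hux.trans hxz).le, (hzy.trans hyv).le⟩ hxz hzy ⟨le_rfl, huv.le⟩ (Or.inl hux)
      · exact not_isCuttingEdge_of_consecutive sh.linked (sh.le.2 sh.adj_root) hUH hxy hx hy hn
    · push Not at hz
      exact zero (consecutive_of_lt hxy fun z hz' => not_lt_of_ge (hz z hz'.1) hz'.2)
  have hR : RibbonData P (BonnetLevels Consecutive (Apex G) d) u v := by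
    obtain ⟨-, k, ⟨f⟩⟩ := h.ribbon_path
    obtain ⟨e, e', -, he, he', heP, heP', k', f', h1, h2⟩ := h.ribbon_connects
    refine ⟨sh.saturated, fun s a b c => pathGraph_no_three f, fun s hs => ?_,
      fun x y hxy hux hyv hadj hn => ?_, fun x y => ?_⟩
    · have key : ∀ e ∈ P.edgeSet, IsNonCuttingEdge (segment G u v) e → (∀ x ∈ e, x ∈ s.1) →
          ∃ x y, x < y ∧ x ∈ s.1 ∧ y ∈ s.1 ∧ ((x = u ∧ y = v) ∨ ∀ z, ¬ (x < z ∧ z < y)) := by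
        intro e heP he hes
        induction e with | _ x y =>
        have hadj : P.Adj x y := heP
        rcases lt_or_gt_of_ne hadj.ne with hxy | hxy
        · exact ⟨x, y, hxy, hes x (by simp), hes y (by simp), consecutive_or_root nc he⟩
        · exact ⟨y, x, hxy, hes y (by simp), hes x (by simp),
            consecutive_or_root nc (Sym2.eq_swap (a := x) ▸ he)⟩
      -- The end faces carry the two non-cutting edges that the ribbon connects.
      rcases pathGraph_end f' hs with rfl | rfl
      exacts [key e heP he h1, key e' heP' he' h2]
    · refine hQ x y hux hxy hyv (sh.le.1 hadj.fst_mem) (sh.le.1 hadj.snd_mem) fun z hz hz' => ?_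
      -- Fan vertices lie next to u or v, so none separates two ribbon vertices other than u and v.
      rcases sh.mem z hz with h1 | h1 | h1
      · exact hn z h1 hz'
      · exact sh.gap_left x hadj.fst_mem ⟨hux, hz'.1.trans h1.2.1⟩
      · exact sh.gap_right y hadj.snd_mem ⟨h1.1.trans hz'.2, hyv⟩
    · exact BonnetLevels.symm (fun a b (h : Consecutive a b) => ⟨h.1.symm, fun x hx => h.2 x hx.symm⟩)
        (fun a b w (h : Apex G a b w) => h.symm)
  have hnb : ∀ a x, (a = u ∨ a = v) → u < x → x < v → G.Adj a x → x ∈ U.verts := by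
    intro a x ha hux hxv hadj
    rcases ha with rfl | rfl
    · exact h.neighbors_left x ⟨⟨le_rfl, huv.le⟩, ⟨hux.le, hxv.le⟩, hadj⟩
    · exact h.neighbors_right x ⟨⟨huv.le, le_rfl⟩, ⟨hux.le, hxv.le⟩, hadj⟩
  have left := sh.ribbonFan_left nc hs hR (hnb u · (Or.inl rfl)) hQ
  have right := @BonnetShape.ribbonFan_left V (reverseOrder o) _ G nc.reverse
    (hs.reverse fun _ _ h => h.symm) U P v u q w p _ sh.reverse hR.reverse
    (fun x hxv hux => hnb v x (Or.inr rfl) hux hxv)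
    (fun x y hvx hxy hyu hx hy hn => hR.symm _ _ (hQ y x hyu hxy hvx hy hx
      fun z hz hz' => hn z hz hz'.symm))
  rw [consecutive_reverse, apex_reverse] at right
  exact Or.inr ⟨w, ⟨Or.inl ⟨sh.lt_left.trans_le sh.left_le, sh.le_right.trans_lt sh.lt_right⟩,
    sh.adj_left.adj_sub, sh.adj_right.adj_sub.symm⟩, left, right⟩

/-- Induction on the system. A hanging subgraph is given only as a cut-component, so it first has to
be recognized as a segment, the form needed for the induction hypothesis. -/
theorem BonnetSystem.bonnetLevels (nc : NonCrossing G) (hs : Saturated Set.univ G.Adj)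
    {H : G.Subgraph} {e : Sym2 V} (B : BonnetSystem H e) :
    ∀ a b, a < b → H = segment G a b → e = s(a, b) →
      BonnetLevels Consecutive (Apex G) B.depth a b := by
  induction B with
  | mk H e U hU S hS sub ih =>
    rintro a b hab rfl rfl
    have hcap : G.Adj a b := by
      obtain ⟨u, v, P, F₁, F₂, huv, h⟩ := hU
      have hcap := h.cap.1
      rw [← huv] at hcap
      exact SimpleGraph.Subgraph.Adj.adj_sub (show (segment G a b).Adj a b from hcap)
    have hdepth : (BonnetSystem.mk _ _ U hU S hS sub).depth = (⨆ i, (sub i).depth) + 1 := by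
      rw [BonnetSystem.depth, add_comm]
    rw [hdepth]
    have hD : ∀ x y, x < y → IsCuttingEdge (segment G a b) s(x, y) → U.Adj x y →
        ¬ IsCuttingEdge U s(x, y) →
          BonnetLevels Consecutive (Apex G) (⨆ i, (sub i).depth) x y := by
      intro x y hxy hc hadj hnc
      obtain ⟨⟨T, hT⟩, he⟩ := hS ⟨s(x, y), hadj, hc, hnc⟩
      have := ih ⟨s(x, y), hadj, hc, hnc⟩ x y hxy
        (eq_segment_of_areCutComponents nc hs hab hcap hxy hT he) rfl
      -- Finiteness matters: an unbounded supremum in ℕ would be 0. Without anchor-edges it is 0 as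
      -- well, and the depth is 1.
      exact this.mono (le_ciSup (f := fun i => (sub i).depth) (Set.finite_range _).bddAbove _)
    obtain ⟨u, v, P, F₁, F₂, huv, h⟩ := hU
    rcases Sym2.eq_iff.1 huv with ⟨rfl, rfl⟩ | ⟨rfl, rfl⟩
    · exact h.bonnetLevels nc hs hab hD
    · exact h.swap.bonnetLevels nc hs hab hD

end Bonnets

/-! ### Fans are outerplanar paths -/

section FanGraph

variable {V : Type u} [LinearOrder V] {G : SimpleGraph V}

/-- The subgraph induced on `u` and its neighbours between `u` and `t`. -/
def fan (G : SimpleGraph V) (u t : V) : G.Subgraph :=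
  (⊤ : G.Subgraph).induce {x | x = u ∨ (G.Adj u x ∧ u < x ∧ x ≤ t)}

/-- The condition on `X` ensures that a chord of `X` crossed in `G` is already crossed within `X`.
-/
theorem saturated_induce {X : Set V} (h : ∀ p ∈ X, ∀ q ∈ X, ∀ c d, p < c → c < q →
    (d < p ∨ q < d) → G.Adj c d → c ∈ X ∧ d ∈ X) (hs : Saturated Set.univ G.Adj) :
    Saturated X ((⊤ : G.Subgraph).induce X).Adj := by
  refine fun p hp q hq hpq hc => ⟨hp, hq, hs p trivial q trivial hpq fun c _ d _ hcd h1 h2 => ?_⟩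
  by_contra h3
  have h4 : d < p ∨ q < d := by
    rw [not_and_or, not_le, not_le] at h3; exact h3
  have h5 := h p hp q hq c d h1 h2 h4 hcd
  exact h3 (hc c h5.1 d h5.2 ⟨h5.1, h5.2, hcd⟩ h1 h2)

theorem saturated_segment (nc : NonCrossing G) (hs : Saturated Set.univ G.Adj) {a b : V}
    (hab : G.Adj a b) : Saturated (segment G a b).verts (segment G a b).Adj := by
  refine saturated_induce (fun p hp q hq c d hpc hcq hd hcd => ?_) hs
  have h1 := hp.1.trans_lt hpc
  have h2 := hcq.trans_le hq.2
  refine ⟨⟨h1.le, h2.le⟩, ?_, ?_⟩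
  · by_contra! h3
    exact nc d c a b hcd.symm hab ⟨h3, h1, h2⟩
  · by_contra! h3
    exact nc a b c d hab hcd ⟨h1, h2, h3⟩

variable [Finite V]

theorem adj_of_consecutive_neighbors (nc : NonCrossing G) (hs : Saturated Set.univ G.Adj)
    {u t x y : V} (hut : G.Adj u t) (hx : G.Adj u x) (hy : G.Adj u y) (hux : u < x) (hxy : x < y)
    (hyt : y ≤ t) (hn : ∀ z, G.Adj u z → ¬ (x < z ∧ z < y)) : G.Adj x y := by
  have hu := (hux.trans hxy).trans_le hyt
  have hadj : ∀ z, G.Adj u z → u < z → z ≤ t → (segment G u t).Adj u z := fun z hz h1 h2 =>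
    ⟨⟨le_rfl, hu.le⟩, ⟨h1.le, h2⟩, hz⟩
  obtain ⟨z, h1, h2, h3, h4⟩ := exists_next_neighbor nc (saturated_segment nc hs hut)
    (fun z hz => hz.1) (hadj x hx hux (hxy.le.trans hyt)) (hadj y hy (hux.trans hxy) hyt) hxy
  have h5 := h4 y (hadj y hy (hux.trans hxy) hyt) hxy
  rcases h5.eq_or_lt with rfl | h5
  · exact h3.adj_sub
  · exact absurd ⟨h1, h5⟩ (hn z h2.adj_sub)

theorem saturated_fan (nc : NonCrossing G) (hs : Saturated Set.univ G.Adj) {u t : V}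
    (hut : G.Adj u t) (hlt : u < t) : Saturated (fan G u t).verts (fan G u t).Adj := by
  intro x hx y hy hxy hc
  rcases hx with rfl | ⟨hx, hux, hxt⟩
  · rcases hy with rfl | hy
    · exact absurd hxy (lt_irrefl _)
    · exact ⟨Or.inl rfl, Or.inr hy, hy.1⟩
  · rcases hy with rfl | hy
    · exact absurd hxy (lt_asymm hux)
    · refine ⟨Or.inr ⟨hx, hux, hxt⟩, Or.inr hy,
        adj_of_consecutive_neighbors nc hs hut hx hy.1 hux hxy hy.2.2 fun z hz hz' => ?_⟩
      have hzm : z = u ∨ (G.Adj u z ∧ u < z ∧ z ≤ t) :=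
        Or.inr ⟨hz, hux.trans hz'.1, hz'.2.le.trans hy.2.2⟩
      have := hc z hzm u (Or.inl rfl) ⟨hzm, Or.inl rfl, hz.symm⟩ hz'.1 hz'.2
      exact not_lt_of_ge this.1 hux

theorem fan_isMaximalOuterplanar (nc : NonCrossing G) (hs : Saturated Set.univ G.Adj) {u t x : V}
    (hut : G.Adj u t) (hux : u < x) (hxt : x < t) : IsMaximalOuterplanar (fan G u t).coe := by
  have hlt := hux.trans hxt
  refine isMaximalOuterplanar_coe nc (saturated_fan nc hs hut hlt) ?_
  obtain ⟨z, h1, h2, h3, -⟩ := exists_apex nc (P := ⊤) hs hut trivial hux hxt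
  have hsub : ({u, z, t} : Set V) ⊆ (fan G u t).verts := by
    rintro y (rfl | rfl | rfl)
    · exact Or.inl rfl
    · exact Or.inr ⟨h3, h1, h2.le⟩
    · exact Or.inr ⟨hut, hlt, le_rfl⟩
  have h4 := Set.ncard_le_ncard hsub
  have h5 : ({u, z, t} : Set V).ncard = 3 := Set.ncard_eq_three.2
    ⟨u, z, t, h1.ne, hlt.ne, h2.ne, rfl⟩
  omega

/-- With the neighbours of u up to t listed in increasing order, the faces are the triangles spanned
by u and two successive neighbours. Two of them share an edge exactly if they follow each other. -/
theorem fan_path (nc : NonCrossing G) (hs : Saturated Set.univ G.Adj) {u t x : V}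
    (hut : G.Adj u t) (hux : u < x) (hxt : x < t) :
    ∃ (k : ℕ) (f : SimpleGraph.pathGraph (k + 1) ≃g dualTree (fan G u t)),
      u ∈ (f 0).1 ∧ u ∈ (f (Fin.last k)).1 ∧ t ∈ (f (Fin.last k)).1 ∧
      ∀ y, G.Adj u y → u < y → (∀ z, ¬ (u < z ∧ z < y)) → y ∈ (f 0).1 := by
  have hlt := hux.trans hxt
  have : Fintype V := Fintype.ofFinite V
  classical
  set N : Finset V := {y | G.Adj u y ∧ u < y ∧ y ≤ t} with hN
  have memN : ∀ y, y ∈ N ↔ G.Adj u y ∧ u < y ∧ y ≤ t := fun y => by simp [hN]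
  obtain ⟨z, h1, h2, h3, -⟩ := exists_apex nc (P := ⊤) hs hut trivial hux hxt
  have hcard : 1 < N.card := Finset.one_lt_card.2
    ⟨z, (memN z).2 ⟨h3, h1, h2.le⟩, t, (memN t).2 ⟨hut, hlt, le_rfl⟩, h2.ne⟩
  -- k + 2 neighbours give k + 1 triangles.
  obtain ⟨k, hk⟩ : ∃ k, N.card = k + 2 := ⟨N.card - 2, by omega⟩
  set g : Fin (k + 2) ↪o V := N.orderEmbOfFin hk with hg
  have gN : ∀ i, G.Adj u (g i) ∧ u < g i ∧ g i ≤ t := fun i =>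
    (memN _).1 (N.orderEmbOfFin_mem hk i)
  have gsurj : ∀ y, G.Adj u y → u < y → y ≤ t → ∃ i, g i = y := fun y h1 h2 h3 => by
    have : y ∈ Set.range g := by
      rw [hg, Finset.range_orderEmbOfFin]; exact (memN y).2 ⟨h1, h2, h3⟩
    exact this
  have glt : ∀ i j, g i < g j ↔ i < j := fun i j => g.lt_iff_lt
  have gne : ∀ i, g i ≠ u := fun i => (gN i).2.1.ne'
  have ginj : ∀ i j, g i = g j ↔ i = j := fun i j => g.injective.eq_iff
  have gadj : ∀ i : Fin (k + 1), G.Adj (g i.castSucc) (g i.succ) := by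
    intro i
    refine adj_of_consecutive_neighbors nc hs hut (gN _).1 (gN _).1 (gN _).2.1
      ((glt _ _).2 i.castSucc_lt_succ) (gN _).2.2 fun y hy hy' => ?_
    obtain ⟨j, rfl⟩ := gsurj y hy ((gN _).2.1.trans hy'.1) (hy'.2.le.trans (gN _).2.2)
    rw [glt, glt, Fin.lt_def, Fin.lt_def, Fin.val_castSucc, Fin.val_succ] at hy'
    omega
  let F : Fin (k + 1) → Face (fan G u t) := fun i =>
    mkFace (a := u) (b := g i.castSucc) (c := g i.succ) ⟨Or.inl rfl, Or.inr (gN _), (gN _).1⟩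
      ⟨Or.inl rfl, Or.inr (gN _), (gN _).1⟩ ⟨Or.inr (gN _), Or.inr (gN _), gadj i⟩
  have memF : ∀ i y, y ∈ (F i).1 ↔ y = u ∨ y = g i.castSucc ∨ y = g i.succ := fun i y => by
    simp [F, mkFace]
  -- An edge that skips a neighbour of u would cross the edge from u to it.
  have key : ∀ c d, (fan G u t).Adj c d → c ≠ u → d ≠ u → c < d →
      ∃ i : Fin (k + 1), c = g i.castSucc ∧ d = g i.succ := by
    rintro c d ⟨hc, hd, hcd⟩ hcu hdu hlt'
    have hc := hc.resolve_left hcu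
    have hd := hd.resolve_left hdu
    obtain ⟨i, rfl⟩ := gsurj c hc.1 hc.2.1 hc.2.2
    obtain ⟨j, rfl⟩ := gsurj d hd.1 hd.2.1 hd.2.2
    have hij := (glt _ _).1 hlt'
    rw [Fin.lt_def] at hij
    have hj : j.val = i.val + 1 := by
      by_contra hne
      have hm : i.val + 1 < k + 2 := by omega
      refine nc _ _ _ _ (gN ⟨i + 1, hm⟩).1 hcd ⟨(gN i).2.1, ?_, ?_⟩ <;>
        rw [glt, Fin.lt_def] <;> dsimp only <;> omega
    refine ⟨⟨i, by omega⟩, rfl, ?_⟩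
    rw [ginj]
    exact Fin.ext hj
  have hbij : Function.Bijective F := by
    constructor
    · intro i j hij
      have h1 : g i.castSucc ∈ (F j).1 := by rw [← hij, memF]; simp
      have h2 : g i.succ ∈ (F j).1 := by rw [← hij, memF]; simp
      simp only [memF, gne, ginj, false_or, Fin.ext_iff, Fin.val_castSucc, Fin.val_succ] at h1 h2
      exact Fin.ext (by omega)
    · intro s
      have hu : u ∈ s.1 := by
        by_contra hu
        obtain ⟨a, b, c, hab, hac, hbc, hs'⟩ := SimpleGraph.is3Clique_iff.1 s.2
        rw [SimpleGraph.Subgraph.spanningCoe_adj] at hab hac hbc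
        rw [hs'] at hu
        simp only [Finset.mem_insert, Finset.mem_singleton, not_or] at hu
        -- In a triangle p < q < r of neighbours of u, the edge pr would cross uq; hence every face
        -- contains u.
        have bad : ∀ p q r, p ≠ u → q ≠ u → (fan G u t).Adj p r → (fan G u t).Adj q r →
            p < q → q < r → False := by
          intro p q r hp hq hpr hqr h1 h2
          have hp := hpr.1.resolve_left hp
          have hq := hqr.1.resolve_left hq
          exact nc _ _ _ _ hq.1 hpr.2.2 ⟨hp.2.1, h1, h2⟩
        have hau := Ne.symm hu.1
        have hbu := Ne.symm hu.2.1
        have hcu := Ne.symm hu.2.2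
        rcases lt_or_gt_of_ne hab.ne with l1 | l1 <;> rcases lt_or_gt_of_ne hac.ne with l2 | l2 <;>
          rcases lt_or_gt_of_ne hbc.ne with l3 | l3
        · exact bad a b c hau hbu hac hbc l1 l3
        · exact bad a c b hau hcu hab hbc.symm l2 l3
        · exact absurd (l1.trans l3) (lt_asymm l2)
        · exact bad c a b hcu hau hbc.symm hab l2 l1
        · exact bad b a c hbu hau hbc hac l1 l2
        · exact absurd (l3.trans l1) (lt_asymm l2)
        · exact bad b c a hbu hcu hab.symm hac.symm l3 l2
        · exact bad c b a hcu hbu hac.symm hab.symm l3 l1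
      obtain ⟨c, hc, hcu⟩ := Finset.exists_mem_ne (by rw [s.2.card_eq]; norm_num) u
      obtain ⟨d, huc, hud, -, hs'⟩ := exists_third s hcu.symm hu hc
      have hcd : (fan G u t).Adj c d := hud
      have hdu := huc.ne.symm
      rcases lt_or_gt_of_ne hcd.ne with h4 | h4
      · obtain ⟨i, h5, h6⟩ := key c d hcd hcu hdu h4
        refine ⟨i, Subtype.ext ?_⟩
        rw [hs']; ext y; rw [memF, h5, h6]; simp
      · obtain ⟨i, h5, h6⟩ := key d c hcd.symm hdu hcu h4
        refine ⟨i, Subtype.ext ?_⟩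
        rw [hs']; ext y; rw [memF, h5, h6]; simp; tauto
  refine ⟨k, ⟨Equiv.ofBijective F hbij, ?_⟩, (memF _ _).2 (Or.inl rfl), (memF _ _).2 (Or.inl rfl),
    (memF _ _).2 (Or.inr (Or.inr ?_)), fun y hy huy hn => (memF _ _).2 (Or.inr (Or.inl ?_))⟩
  · intro i j
    rw [SimpleGraph.pathGraph_adj]
    change (F i ≠ F j ∧ ∃ a b, a ≠ b ∧ a ∈ (F i).1 ∧ b ∈ (F i).1 ∧ a ∈ (F j).1 ∧ b ∈ (F j).1) ↔ _
    constructor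
    · rintro ⟨hne, a, b, hab, h1, h2, h3, h4⟩
      have hij : i.val ≠ j.val := fun h => hne (by rw [Fin.ext h])
      rw [memF] at h1 h2 h3 h4
      have main : ∀ a, a ≠ u → (a = g i.castSucc ∨ a = g i.succ) →
          (a = g j.castSucc ∨ a = g j.succ) → i.val + 1 = j.val ∨ j.val + 1 = i.val := by
        rintro a - (rfl | rfl) h <;>
          simp only [ginj, Fin.ext_iff, Fin.val_castSucc, Fin.val_succ] at h <;> omega
      by_cases hau : a = u
      · have hbu : b ≠ u := fun h => hab (hau.trans h.symm)
        exact main b hbu (h2.resolve_left hbu) (h4.resolve_left hbu)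
      · exact main a hau (h1.resolve_left hau) (h3.resolve_left hau)
    · intro h
      refine ⟨fun h' => ?_, ?_⟩
      · have := congrArg Fin.val (hbij.1 h')
        omega
      · rcases h with h | h
        · refine ⟨u, g i.succ, (gne _).symm, by simp [memF], by simp [memF], by simp [memF], ?_⟩
          rw [memF, ginj]
          exact Or.inr (Or.inl (Fin.ext h))
        · refine ⟨u, g j.succ, (gne _).symm, by simp [memF], ?_, by simp [memF], by simp [memF]⟩
          rw [memF, ginj]
          exact Or.inr (Or.inl (Fin.ext h))
  · obtain ⟨i, hi⟩ := gsurj t hut hlt le_rfl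
    refine le_antisymm ?_ (gN _).2.2
    rw [← hi, g.le_iff_le, Fin.succ_last]
    exact Fin.le_last i
  · have h4 : y ≤ g (Fin.castSucc 0) := by
      by_contra! h
      exact hn _ ⟨(gN _).2.1, h⟩
    obtain ⟨i, rfl⟩ := gsurj y hy huy (h4.trans (gN _).2.2)
    refine le_antisymm h4 ?_
    rw [g.le_iff_le]
    exact Fin.zero_le i

end FanGraph

/-! ### Existence of bonnet systems -/

section Existence

variable {V : Type u} [o : LinearOrder V] [Finite V] {G : SimpleGraph V}

/-- Edges with an end strictly between x and y stay in the interval from x to y, so removing the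
open interval leaves the other component. The vertices z and t provide the third vertex of each. -/
theorem areCutComponents_segment (nc : NonCrossing G) (hs : Saturated Set.univ G.Adj)
    {a b x y z t : V} (hab : G.Adj a b) (hxy : G.Adj x y) (hax : a ≤ x) (hyb : y ≤ b)
    (hxz : x < z) (hzy : z < y) (hat : a ≤ t) (htb : t ≤ b) (ht : t < x ∨ y < t) :
    AreCutComponents (segment G a b) s(x, y) (segment G x y)
      ((⊤ : G.Subgraph).induce (Set.Icc a b \ Set.Ioo x y)) := by
  have hlt := hxz.trans hzy
  have hxT : x ∈ Set.Icc a b \ Set.Ioo x y :=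
    ⟨⟨hax, hlt.le.trans hyb⟩, fun h => lt_irrefl _ h.1⟩
  have hyT : y ∈ Set.Icc a b \ Set.Ioo x y :=
    ⟨⟨hax.trans hlt.le, hyb⟩, fun h => lt_irrefl _ h.2⟩
  have htT : t ∈ Set.Icc a b \ Set.Ioo x y :=
    ⟨⟨hat, htb⟩, fun h => ht.elim (lt_asymm h.1) (lt_asymm h.2)⟩
  have inside : ∀ p q, G.Adj p q → x < p → p < y → x ≤ q ∧ q ≤ y := by
    intro p q hpq h1 h2
    constructor
    · by_contra! h3
      exact nc q p x y hpq.symm hxy ⟨h3, h1, h2⟩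
    · by_contra! h3
      exact nc x y p q hxy hpq ⟨h1, h2, h3⟩
  constructor
  · refine isMaximalOuterplanar_coe nc (saturated_segment nc hs hxy) ?_
    have hsub : ({x, z, y} : Set V) ⊆ (segment G x y).verts := by
      rintro w (rfl | rfl | rfl)
      exacts [⟨le_rfl, hlt.le⟩, ⟨hxz.le, hzy.le⟩, ⟨hlt.le, le_rfl⟩]
    have h4 := Set.ncard_le_ncard hsub
    have h5 : ({x, z, y} : Set V).ncard = 3 := Set.ncard_eq_three.2
      ⟨x, z, y, hxz.ne, hlt.ne, hzy.ne, rfl⟩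
    omega
  · refine isMaximalOuterplanar_coe nc
      (saturated_induce (fun p hp q hq c d hpc hcq hd hcd => ?_) hs) ?_
    · have h1 := hp.1.1.trans_lt hpc
      have h2 := hcq.trans_le hq.1.2
      have had : a ≤ d := by
        by_contra! h3
        exact nc d c a b hcd.symm hab ⟨h3, h1, h2⟩
      have hdb : d ≤ b := by
        by_contra! h3
        exact nc a b c d hab hcd ⟨h1, h2, h3⟩
      have hp' := hp.2
      have hq' := hq.2
      rw [Set.mem_Ioo] at hp' hq'
      refine ⟨⟨⟨h1.le, h2.le⟩, fun h3 => ?_⟩, ⟨had, hdb⟩, fun h3 => ?_⟩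
      · have := inside c d hcd h3.1 h3.2
        have := h3.1
        have := h3.2
        grind
      · have := inside d c hcd.symm h3.1 h3.2
        have := h3.1
        have := h3.2
        grind
    · have hsub : ({x, y, t} : Set V) ⊆ Set.Icc a b \ Set.Ioo x y := by
        rintro w (rfl | rfl | rfl)
        exacts [hxT, hyT, htT]
      have h4 := Set.ncard_le_ncard hsub
      have h5 : ({x, y, t} : Set V).ncard = 3 := Set.ncard_eq_three.2
        ⟨x, y, t, hlt.ne, ht.elim (fun h => h.ne') (fun h => (hlt.trans h).ne),
          ht.elim (fun h => (h.trans hlt).ne') (fun h => h.ne), rfl⟩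
      exact h5 ▸ h4
  · refine SimpleGraph.Subgraph.ext ?_ ?_
    · ext p
      refine ⟨fun hp => hp.elim (fun hp => ⟨hax.trans hp.1, hp.2.trans hyb⟩) fun hp => hp.1,
        fun hp => ?_⟩
      by_cases h : p ∈ Set.Ioo x y
      · exact Or.inl ⟨h.1.le, h.2.le⟩
      · exact Or.inr ⟨hp, h⟩
    · ext p q
      constructor
      · rintro (⟨hp, hq, h⟩ | ⟨hp, hq, h⟩)
        · exact ⟨⟨hax.trans hp.1, hp.2.trans hyb⟩, ⟨hax.trans hq.1, hq.2.trans hyb⟩, h⟩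
        · exact ⟨hp.1, hq.1, h⟩
      · rintro ⟨hp, hq, h⟩
        by_cases h1 : p ∈ Set.Ioo x y
        · exact Or.inl ⟨⟨h1.1.le, h1.2.le⟩, inside p q h h1.1 h1.2, h⟩
        by_cases h2 : q ∈ Set.Ioo x y
        · exact Or.inl ⟨inside q p h.symm h2.1 h2.2, ⟨h2.1.le, h2.2.le⟩, h⟩
        exact Or.inr ⟨⟨hp, h1⟩, ⟨hq, h2⟩, h⟩
  · ext p
    constructor
    · rintro ⟨hp, hp'⟩
      have h1 : x ≤ p ∧ p ≤ y := hp
      have h2 : ¬ (x < p ∧ p < y) := hp'.2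
      simp only [Set.mem_ofPred_eq, Sym2.mem_iff]
      grind
    · intro hp
      rcases Sym2.mem_iff.1 hp with rfl | rfl
      exacts [⟨⟨le_rfl, hlt.le⟩, hxT⟩, ⟨⟨hlt.le, le_rfl⟩, hyT⟩]
  · ext e
    induction e with | _ p q =>
    constructor
    · rintro ⟨⟨hp, hq, h⟩, hp', hq', -⟩
      have hne := h.ne
      have h1 : x ≤ p ∧ p ≤ y := hp
      have h2 : ¬ (x < p ∧ p < y) := hp'.2
      have h3 : x ≤ q ∧ q ≤ y := hq
      have h4 : ¬ (x < q ∧ q < y) := hq'.2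
      rw [Set.mem_singleton_iff, Sym2.eq_iff]
      grind
    · intro h
      rw [Set.mem_singleton_iff, Sym2.eq_iff] at h
      rcases h with ⟨rfl, rfl⟩ | ⟨rfl, rfl⟩
      · exact ⟨⟨⟨le_rfl, hlt.le⟩, ⟨hlt.le, le_rfl⟩, hxy⟩, hxT, hyT, hxy⟩
      · exact ⟨⟨⟨hlt.le, le_rfl⟩, ⟨le_rfl, hlt.le⟩, hxy.symm⟩, hyT, hxT, hxy.symm⟩

/-- If w immediately precedes b there is no triangle, and the empty fan has to serve. -/
theorem exists_right_fan (nc : NonCrossing G) (hs : Saturated Set.univ G.Adj) {b w : V}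
    (hwb : w < b) (hadj : G.Adj b w) : ∃ F : G.Subgraph,
      (IsOuterplanarPath F ∨ ∃ (y : V) (h : G.Adj b y), F = G.subgraphOfAdj h) ∧
      F.Adj b w ∧ ∀ x, x ∈ F.verts ↔ x = b ∨ (G.Adj b x ∧ x < b ∧ w ≤ x) := by
  by_cases hx : ∃ x, w < x ∧ x < b
  · obtain ⟨x, hwx, hxb⟩ := hx
    have hs' := hs.reverse fun _ _ (h : G.Adj _ _) => h.symm
    refine ⟨@fan V (reverseOrder o) G b w, Or.inl ⟨?_, ?_⟩, ?_, fun x => Iff.rfl⟩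
    · exact @fan_isMaximalOuterplanar V (reverseOrder o) G _ nc.reverse hs' b w x hadj hxb hwx
    · obtain ⟨k, f, -⟩ := @fan_path V (reverseOrder o) G _ nc.reverse hs' b w x hadj hxb hwx
      exact ⟨k, ⟨f⟩⟩
    · exact ⟨Or.inl rfl, Or.inr ⟨hadj, hwb, le_rfl⟩, hadj⟩
  · refine ⟨G.subgraphOfAdj hadj, Or.inr ⟨w, hadj, rfl⟩, rfl, fun x => ?_⟩
    push Not at hx
    constructor
    · rintro (rfl | rfl)
      exacts [Or.inl rfl, Or.inr ⟨hadj, hwb, le_rfl⟩]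
    · rintro (rfl | ⟨-, h1, h2⟩)
      · exact Or.inl rfl
      · rcases h2.eq_or_lt with rfl | h2
        · exact Or.inr rfl
        · exact absurd h1 (not_lt_of_ge (hx x h2))

theorem isNonCuttingEdge_of_consecutive (nc : NonCrossing G) (hs : Saturated Set.univ G.Adj)
    {a b x y : V} (hab : G.Adj a b) (hlt : a < b) (hxy : (segment G a b).Adj x y) (hlt' : x < y)
    (hn : ∀ z, ¬ (x < z ∧ z < y)) : IsNonCuttingEdge (segment G a b) s(x, y) :=
  ⟨hxy, not_isCuttingEdge_of_consecutive (saturated_segment nc hs hab).linked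
    (a := a) (b := b) ⟨⟨le_rfl, hlt.le⟩, ⟨hlt.le, le_rfl⟩, hab⟩ (fun _ hz => hz) hlt' hxy.1 hxy.2.1
    fun z _ => hn z⟩

theorem isNonCuttingEdge_root (nc : NonCrossing G) (hs : Saturated Set.univ G.Adj)
    {a b : V} (hab : G.Adj a b) (hlt : a < b) : IsNonCuttingEdge (segment G a b) s(a, b) :=
  ⟨⟨⟨le_rfl, hlt.le⟩, ⟨hlt.le, le_rfl⟩, hab⟩,
    not_isCuttingEdge_extreme (saturated_segment nc hs hab).linked fun _ hz => hz⟩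

/-- The ribbon is the full fan at a, from the edge to its successor y up to the root ab. The fan at
a is empty, consisting of ay, and the fan at b takes the neighbours of b from the apex w on. -/
theorem exists_bonnet (nc : NonCrossing G) (hs : Saturated Set.univ G.Adj) {a b x : V}
    (hab : G.Adj a b) (hax : a < x) (hxb : x < b) :
    ∃ U, IsBonnet (segment G a b) U s(a, b) := by
  have hlt := hax.trans hxb
  obtain ⟨w, haw, hwb, h1, h2⟩ := exists_apex nc (P := ⊤) hs hab trivial hax hxb
  change G.Adj a w at h1
  change G.Adj w b at h2
  obtain ⟨y, -, hay, hyx, hyn⟩ := exists_gap (Set.mem_univ x) hax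
  have hyn : ∀ z, ¬ (a < z ∧ z < y) := fun z => hyn z trivial
  have hya : G.Adj a y := hs.linked a trivial y trivial hay fun z _ => hyn z
  have hyb := hyx.trans_lt hxb
  obtain ⟨F, hF, hFadj, hFv⟩ := exists_right_fan nc hs hwb h2.symm
  obtain ⟨k, f, f1, f2, f3, f4⟩ := fan_path nc hs hab hax hxb
  have f5 := f4 y hya hay hyn
  have hPH : fan G a b ≤ segment G a b := by
    have hv : ∀ z, (z = a ∨ (G.Adj a z ∧ a < z ∧ z ≤ b)) → a ≤ z ∧ z ≤ b := by
      rintro z (rfl | hz)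
      exacts [⟨le_rfl, hlt.le⟩, ⟨hz.2.1.le, hz.2.2⟩]
    exact ⟨hv, fun p q hpq => ⟨hv p hpq.1, hv q hpq.2.1, hpq.2.2⟩⟩
  have hFvb : ∀ z ∈ F.verts, w ≤ z ∧ z ≤ b := by
    intro z hz
    rcases (hFv z).1 hz with rfl | hz
    exacts [⟨hwb.le, le_rfl⟩, ⟨hz.2.2, hz.2.1.le⟩]
  have hFH : F ≤ segment G a b := by
    have hv : ∀ z ∈ F.verts, a ≤ z ∧ z ≤ b := fun z hz =>
      ⟨haw.le.trans (hFvb z hz).1, (hFvb z hz).2⟩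
    exact ⟨hv, fun p q hpq => ⟨hv p hpq.fst_mem, hv q hpq.snd_mem, hpq.adj_sub⟩⟩
  have hPy : (fan G a b).Adj a y := ⟨Or.inl rfl, Or.inr ⟨hya, hay, hyb.le⟩, hya⟩
  have hPb : (fan G a b).Adj a b := ⟨Or.inl rfl, Or.inr ⟨hab, hlt, le_rfl⟩, hab⟩
  have hEP : G.subgraphOfAdj hya ≤ fan G a b := by
    refine SimpleGraph.subgraphOfAdj_le_of_adj _ hPy
  refine ⟨fan G a b ⊔ G.subgraphOfAdj hya ⊔ F, a, b, fan G a b, G.subgraphOfAdj hya, F, rfl, ?_⟩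
  refine
    { cap := isNonCuttingEdge_root nc hs hab hlt
      le := sup_le (sup_le hPH (hEP.trans hPH)) hFH
      union := rfl
      ribbon_path := ⟨fan_isMaximalOuterplanar nc hs hab hax hxb, k, ⟨f⟩⟩
      ribbon_connects := ⟨s(a, y), s(a, b), fun h => hyb.ne (Sym2.congr_right.1 h),
        isNonCuttingEdge_of_consecutive nc hs hab hlt (hPH.2 hPy) hay hyn,
        isNonCuttingEdge_root nc hs hab hlt, hPy, hPb, k, f, ?_, ?_⟩
      ribbon_contains := ⟨w, hPH.2 ⟨Or.inl rfl, Or.inr ⟨h1, haw, hwb.le⟩, h1⟩,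
        hFH.2 hFadj, hPb.fst_mem, hPb.snd_mem, Or.inr ⟨h1, haw, hwb.le⟩⟩
      fan_left := ⟨hEP.trans hPH, Or.inr ⟨y, hya, rfl⟩, ?_, y, ?_⟩
      fan_right := ⟨hFH, hF, ?_, w, ?_⟩
      fans_disjoint := ?_
      neighbors_left := ?_
      neighbors_right := ?_ }
  · intro z hz
    rcases Sym2.mem_iff.1 hz with rfl | rfl
    exacts [f1, f5]
  · intro z hz
    rcases Sym2.mem_iff.1 hz with rfl | rfl
    exacts [f2, f3]
  · rintro z (rfl | rfl)
    exacts [Or.inl rfl, Or.inr (hPH.2 hPy)]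
  · rw [SimpleGraph.edgeSet_subgraphOfAdj, Set.inter_eq_left, Set.singleton_subset_iff]
    exact hPy
  · intro z hz
    refine ((hFv z).1 hz).imp id fun h => ?_
    exact ⟨⟨hlt.le, le_rfl⟩, ⟨haw.le.trans h.2.2, h.2.1.le⟩, h.1⟩
  -- A vertex other than b common to the ribbon and this fan is adjacent to both a and b, so it is
  -- the apex w.
  · have both : ∀ z, z ∈ F.verts → z ∈ (fan G a b).verts → z = b ∨ z = w := by
      intro z hz hz'
      rcases (hFv z).1 hz with rfl | h3
      · exact Or.inl rfl
      · rcases hz' with rfl | h4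
        · exact absurd h3.2.2 (not_le_of_gt haw)
        · exact Or.inr (apex_unique nc ⟨Or.inl ⟨h4.2.1, h3.2.1⟩, h4.1, h3.1⟩
            ⟨Or.inl ⟨haw, hwb⟩, h1, h2.symm⟩)
    ext e
    induction e with | _ p q =>
    rw [Set.mem_singleton_iff, Sym2.eq_iff]
    constructor
    · rintro ⟨hp : F.Adj p q, hq : (fan G a b).Adj p q⟩
      have hne := hp.ne
      rcases both p hp.fst_mem hq.fst_mem with rfl | rfl <;>
        rcases both q hp.snd_mem hq.snd_mem with rfl | rfl
      · contradiction
      · exact Or.inl ⟨rfl, rfl⟩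
      · exact Or.inr ⟨rfl, rfl⟩
      · contradiction
    · have hbw : (fan G a b).Adj b w :=
        ⟨Or.inr ⟨hab, hlt, le_rfl⟩, Or.inr ⟨h1, haw, hwb.le⟩, h2.symm⟩
      rintro (⟨rfl, rfl⟩ | ⟨rfl, rfl⟩)
      exacts [⟨hFadj, hbw⟩, ⟨hFadj.symm, hbw.symm⟩]
  · rw [SimpleGraph.edgeSet_subgraphOfAdj, Set.disjoint_singleton_left]
    intro (h : F.Adj a y)
    exact not_le_of_gt haw (hFvb a h.fst_mem).1
  · rintro z ⟨-, hz, h⟩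
    exact Or.inl (Or.inl (Or.inr ⟨h, lt_of_le_of_ne hz.1 h.ne, hz.2⟩))
  · rintro z ⟨-, hz, h⟩
    rcases hz.1.eq_or_lt with rfl | h3
    · exact Or.inl (Or.inl (Or.inl rfl))
    · refine Or.inr ((hFv z).2 (Or.inr ⟨h, lt_of_le_of_ne hz.2 h.ne.symm, ?_⟩))
      by_contra! h4
      exact nc a w z b h1 h.symm ⟨h3, h4, hwb⟩

/-- Hanging subgraphs are segments with fewer inner vertices, so the induction closes. This is what
makes the infimum in `bonnetDepth` a true minimum. -/
theorem exists_bonnetSystem (nc : NonCrossing G) (hs : Saturated Set.univ G.Adj) (n : ℕ) :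
    ∀ a b x, G.Adj a b → a < x → x < b → (Set.Ioo a b).ncard < n →
      Nonempty (BonnetSystem (segment G a b) s(a, b)) := by
  induction n with
  | zero => intros; omega
  | succ n ih =>
    intro a b x hab hax hxb hn
    have hlt := hax.trans hxb
    obtain ⟨U, hU⟩ := exists_bonnet nc hs hab hax hxb
    have key : ∀ e : anchorEdges (segment G a b) U, ∃ S,
        IsHangingSubgraph (segment G a b) s(a, b) e.1 S ∧ Nonempty (BonnetSystem S e.1) := by
      have main : ∀ p q, p < q → IsCuttingEdge (segment G a b) s(p, q) → ∃ S,
          IsHangingSubgraph (segment G a b) s(a, b) s(p, q) S ∧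
            Nonempty (BonnetSystem S s(p, q)) := by
        intro p q hpq hc
        have hadj : (segment G a b).Adj p q := hc.1
        obtain ⟨hp, hq, hpq'⟩ := hadj
        have hz : ∃ z, p < z ∧ z < q := by
          by_contra! h
          exact (isNonCuttingEdge_of_consecutive nc hs hab hlt hc.1 hpq
            fun z hz => not_lt_of_ge (h z hz.1) hz.2).2 hc
        have hne : ¬ (p = a ∧ q = b) := by
          rintro ⟨rfl, rfl⟩
          exact (isNonCuttingEdge_root nc hs hab hlt).2 hc
        have ht : ∃ t, (a ≤ t ∧ t ≤ b) ∧ (t < p ∨ q < t) := by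
          by_cases hpa : p = a
          · exact ⟨b, ⟨hlt.le, le_rfl⟩, Or.inr (lt_of_le_of_ne hq.2 fun h => hne ⟨hpa, h⟩)⟩
          · exact ⟨a, ⟨le_rfl, hlt.le⟩, Or.inl (lt_of_le_of_ne hp.1 (Ne.symm hpa))⟩
        obtain ⟨z, hpz, hzq⟩ := hz
        obtain ⟨t, ht1, ht2⟩ := ht
        refine ⟨segment G p q, ⟨⟨_, areCutComponents_segment nc hs hab hpq' hp.1 hq.2 hpz hzq ht1.1
          ht1.2 ht2⟩, fun h => ?_⟩, ih p q z hpq' hpz hzq ?_⟩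
        · have h : (segment G p q).Adj a b := h
          exact hne ⟨le_antisymm h.1.1 hp.1, le_antisymm hq.2 h.2.1.2⟩
        · have : (Set.Ioo p q).ncard < (Set.Ioo a b).ncard := by
            by_cases hpa : p = a
            · refine ncard_Ioo_lt hp.1 hq.2 (x := q) (hp.1.trans_lt hpq)
                (lt_of_le_of_ne hq.2 fun h => hne ⟨hpa, h⟩) fun h => lt_irrefl _ h.2
            · exact ncard_Ioo_lt hp.1 hq.2 (x := p) (lt_of_le_of_ne hp.1 (Ne.symm hpa))
                (hpq.trans_le hq.2) fun h => lt_irrefl _ h.1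
          omega
      rintro ⟨e, -, hc, -⟩
      induction e with | _ p q =>
      have hadj : (segment G a b).Adj p q := hc.1
      rcases lt_or_gt_of_ne hadj.ne with h | h
      · exact main p q h hc
      · rw [Sym2.eq_swap (a := p)] at hc
        have := main q p h hc
        rwa [Sym2.eq_swap (a := q)] at this
    choose S hS hB using key
    exact ⟨.mk _ _ U hU S hS fun e => (hB e).some⟩

end Existence

/-! ### The height bound -/

section Main

variable {V : Type u}

theorem segment_eq_top [LinearOrder V] {G : SimpleGraph V} {a b : V} (h : ∀ x, a ≤ x ∧ x ≤ b) :
    segment G a b = ⊤ := by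
  refine SimpleGraph.Subgraph.ext (Set.eq_univ_of_forall h) ?_
  ext x y
  exact ⟨fun h => h.2.2, fun hxy => ⟨h x, h y, hxy⟩⟩

theorem BonnetLevels.exists_representation [LinearOrder V] {G : SimpleGraph V}
    (nc : NonCrossing G) {a b : V} (hab : a < b) (h : ∀ x, a ≤ x ∧ x ≤ b) {d : ℕ}
    (hd : BonnetLevels Consecutive (Apex G) d a b) :
    ∃ R : FlatVisibilityRepresentation G, R.height ≤ ((2 * d + 1 : ℕ) : ℕ∞) := by
  obtain ⟨A, B, hA, hB, fa, fb, na, nb, w, br, sh⟩ := hd.hasCapDrawing nc.regions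
  have hreg : ∀ x, x ∈ region a b := by
    intro x
    rcases (h x).1.eq_or_lt with rfl | h1
    · exact Or.inl rfl
    rcases (h x).2.eq_or_lt with rfl | h2
    · exact Or.inr (Or.inl rfl)
    exact Or.inr (Or.inr (Or.inl ⟨h1, h2⟩))
  have hbar : ∀ x, Bar x (A ++ B) := by
    intro x
    by_cases hxa : x = a
    · subst hxa
      exact (fa.ends hA).bar.append_right na
    by_cases hxb : x = b
    · subst hxb
      exact (fb.ends hB).bar.append_left nb
    exact br x (hreg x) hxa hxb
  obtain ⟨D⟩ := exists_gridDrawing (n := 2 * d) (by exact_mod_cast w) hbar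
    fun x y hxy => sh x (hreg x) y (hreg y) hxy
  exact ⟨D.toRepresentation, D.height_le⟩

theorem exists_btw_of_three_le [LinearOrder V] [Finite V] {a b : V} (h : ∀ x, a ≤ x ∧ x ≤ b)
    (hV : 3 ≤ Nat.card V) : ∃ x, a < x ∧ x < b := by
  by_contra! hx
  have h1 : (Set.univ : Set V) ⊆ {a, b} := fun x _ => by
    rcases (h x).1.eq_or_lt with rfl | h1
    · exact Or.inl rfl
    · exact Or.inr (le_antisymm (h x).2 (hx x h1))
  have h2 := Set.ncard_le_ncard h1
  have h3 := Set.ncard_insert_le a {b}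
  rw [Set.ncard_univ] at h2
  rw [Set.ncard_singleton] at h3
  omega

theorem exists_representation_of_root [LinearOrder V] [Finite V] {G : SimpleGraph V}
    (nc : NonCrossing G) (hs : Saturated Set.univ G.Adj) {a b : V} (h : ∀ x, a ≤ x ∧ x ≤ b)
    (hadj : G.Adj a b) (hV : 3 ≤ Nat.card V) :
    ∃ R : FlatVisibilityRepresentation G,
      R.height ≤ ((2 * bonnetDepth G s(a, b) + 1 : ℕ) : ℕ∞) := by
  obtain ⟨x, hax, hxb⟩ := exists_btw_of_three_le h hV
  have hab := hax.trans hxb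
  obtain ⟨B⟩ := exists_bonnetSystem nc hs _ a b x hadj hax hxb (Nat.lt_succ_self _)
  rw [segment_eq_top h] at B
  obtain ⟨B', hB'⟩ := Nat.sInf_mem
    (⟨_, B, rfl⟩ : {d | ∃ B : BonnetSystem (⊤ : G.Subgraph) s(a, b), B.depth = d}.Nonempty)
  have := B'.bonnetLevels nc hs a b hab (segment_eq_top h).symm rfl
  rw [hB'] at this
  exact this.exists_representation nc hab h

/-- Rotating a circular order keeps chords from crossing. -/
theorem noncrossing_rotate {G : SimpleGraph V} {pos : V → ℕ} {n t : ℕ} (hn : ∀ x, pos x < n)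
    (h : ∀ a b c d : V, G.Adj a b → G.Adj c d →
      ¬ (pos a < pos c ∧ pos c < pos b ∧ pos b < pos d)) (a b c d : V) (hab : G.Adj a b)
    (hcd : G.Adj c d) :
    ¬ ((if pos a ≤ t then pos a + n else pos a) < (if pos c ≤ t then pos c + n else pos c) ∧
      (if pos c ≤ t then pos c + n else pos c) < (if pos b ≤ t then pos b + n else pos b) ∧
      (if pos b ≤ t then pos b + n else pos b) < (if pos d ≤ t then pos d + n else pos d)) := by
  have h1 := h a b c d hab hcd
  have h2 := h d c a b hcd.symm hab
  have h3 := h b a d c hab.symm hcd.symm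
  have h4 := h c d b a hcd hab.symm
  have := hn a
  have := hn b
  have := hn c
  have := hn d
  split_ifs <;> omega

/-- In the given order the root is the extreme pair or a consecutive pair. In the second case the
circle is cut open between its ends instead. -/
theorem exists_representation_of_nonCutting [Finite V] {G : SimpleGraph V}
    (hG : IsMaximalOuterplanar G) {e : Sym2 V} (he : IsNonCuttingEdge (⊤ : G.Subgraph) e) :
    ∃ R : FlatVisibilityRepresentation G, R.height ≤ ((2 * bonnetDepth G e + 1 : ℕ) : ℕ∞) := by
  obtain ⟨pos, hpos, hc⟩ := hG.2.1
  obtain ⟨n, hn⟩ : ∃ n, ∀ x, pos x < n := by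
    obtain ⟨n, hn⟩ := (Set.finite_range pos).bddAbove
    exact ⟨n + 1, fun x => Nat.lt_succ_of_le (hn ⟨x, rfl⟩)⟩
  have : Nonempty V := Finite.card_pos_iff.1 (by have := hG.1; omega)
  have sat : ∀ o : LinearOrder V, NonCrossing G → Saturated Set.univ G.Adj := fun o nc =>
    saturated_of_maximal nc fun K hK hle => hG.2.2 hK.isOuterplanar hle
  have main : ∀ x y, pos x < pos y → IsNonCuttingEdge (⊤ : G.Subgraph) s(x, y) →
      ∃ R : FlatVisibilityRepresentation G,
        R.height ≤ ((2 * bonnetDepth G s(x, y) + 1 : ℕ) : ℕ∞) := by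
    intro x y hxy he
    have hadj : G.Adj x y := he.1
    obtain ⟨a, ha⟩ := Finite.exists_min pos
    obtain ⟨b, hb⟩ := Finite.exists_max pos
    have h1 : (x = a ∧ y = b) ∨ ∀ z, ¬ (pos x < pos z ∧ pos z < pos y) := by
      let _ : LinearOrder V := LinearOrder.lift' pos hpos
      refine consecutive_or_root (G := G) hc ?_
      rwa [segment_eq_top (fun z => ⟨ha z, hb z⟩)]
    rcases h1 with ⟨rfl, rfl⟩ | h1
    · let o : LinearOrder V := LinearOrder.lift' pos hpos
      exact exists_representation_of_root (G := G) hc (sat o hc) (fun z => ⟨ha z, hb z⟩) hadj hG.1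
    -- Moving the positions up to that of x behind all others makes y the least and x the greatest
    -- vertex.
    · have hinj : Function.Injective fun z => if pos z ≤ pos x then pos z + n else pos z := by
        intro p q hpq
        have := hn p
        have := hn q
        dsimp only at hpq
        refine hpos ?_
        split_ifs at hpq <;> omega
      let o : LinearOrder V := LinearOrder.lift' _ hinj
      have nc : NonCrossing G := noncrossing_rotate hn hc
      have h2 : ∀ z, (if pos y ≤ pos x then pos y + n else pos y) ≤
            (if pos z ≤ pos x then pos z + n else pos z) ∧
          (if pos z ≤ pos x then pos z + n else pos z) ≤
            (if pos x ≤ pos x then pos x + n else pos x) := by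
        intro z
        have := h1 z
        have := hn z
        have := hn y
        split_ifs <;> omega
      rw [Sym2.eq_swap]
      exact exists_representation_of_root nc (sat o nc) (fun z => h2 z) hadj.symm hG.1
  induction e with | _ x y =>
  have hadj : G.Adj x y := he.1
  rcases lt_or_gt_of_ne (hpos.ne hadj.ne) with h | h
  · exact main x y h he
  · rw [Sym2.eq_swap] at he ⊢
    exact main y x h he

theorem exists_isNonCuttingEdge [Finite V] {G : SimpleGraph V} (hG : IsMaximalOuterplanar G) :
    ∃ e, IsNonCuttingEdge (⊤ : G.Subgraph) e := by
  obtain ⟨pos, hpos, hc⟩ := hG.2.1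
  let _ : LinearOrder V := LinearOrder.lift' pos hpos
  have nc : NonCrossing G := hc
  have hs := saturated_of_maximal nc fun K hK hle => hG.2.2 hK.isOuterplanar hle
  have hV := hG.1
  have : Nontrivial V := Finite.one_lt_card_iff_nontrivial.1 (by omega)
  obtain ⟨a, ha⟩ := Finite.exists_min (id : V → V)
  obtain ⟨b, hb⟩ := Finite.exists_max (id : V → V)
  have hab : a < b := by
    refine lt_of_le_of_ne (ha b) fun h => ?_
    obtain ⟨x, y, hxy⟩ := exists_pair_ne V
    exact hxy ((le_antisymm ((hb x).trans h.ge) (ha x)).trans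
      (le_antisymm ((hb y).trans h.ge) (ha y)).symm)
  have hadj : G.Adj a b := hs a trivial b trivial hab fun _ _ d _ _ _ _ => ⟨ha d, hb d⟩
  have := isNonCuttingEdge_root nc hs hadj hab
  have ha' : ∀ x, a ≤ x := ha
  have hb' : ∀ x, x ≤ b := hb
  rw [segment_eq_top fun x => ⟨ha' x, hb' x⟩] at this
  exact ⟨_, this⟩

end Main

end BonnetDrawing

theorem mainTheorem1 {V : Type*} [Finite V] (G : SimpleGraph V)
    (hG : BonnetDrawing.IsMaximalOuterplanar G) :
    ∃ R : BonnetDrawing.FlatVisibilityRepresentation G,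
      R.height ≤ ((2 * BonnetDrawing.freeBonnetDepth G + 1 : ℕ) : ℕ∞) := by
  obtain ⟨e, he⟩ := BonnetDrawing.exists_isNonCuttingEdge hG
  obtain ⟨e', he', h⟩ := Nat.sInf_mem (⟨_, e, he, rfl⟩ : {d | ∃ e : Sym2 V,
    BonnetDrawing.IsNonCuttingEdge (⊤ : G.Subgraph) e ∧
      BonnetDrawing.bonnetDepth G e = d}.Nonempty)
  have := BonnetDrawing.exists_representation_of_nonCutting hG he'
  rwa [h] at this
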